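/- **Conventions.** A *half-lattice path* of length $L\in\frac12\mathbb{Z}_{\ge0}$ is a sequence $h=(h_{-1/2},h_0,h_{1/2},h_1,\ldots,h_L,h_{L+1/2})$ of elements of $\frac12\mathbb{Z}$ with $|h_x-h_{x-1/2}|=\frac12$ for all $x\in\frac12\mathbb{Z}$, $0\le x\le L+\frac12$, such that whenever $h_x=h_{x+1}\in\mathbb{Z}$ (for $-\frac12\le x\le L-\frac12$) one has $h_{x+1/2}=h_x+\frac12$. For $t,a,b\in\frac12\mathbb{Z}$ and $e,f\in\{0,1\}$, let $\mathcal H^{e,f;t}_{a,b}(L)$ be the set of those with $1\le h_x\le t$ for $0\le x\le L$, $h_0=a$, $h_L=b$, $h_{-1/2}=a+\frac12-e$, $h_{L+1/2}=b+\frac12-f$. Put $$w(h)=\frac14\sum_{i=1}^{2L} i\,\bigl|h_{(i+1)/2}-h_{(i-1)/2}\bigr|,\qquad H^{e,f;t}_{a,b}(L)=\sum_{h\in\mathcal H^{e,f;t}_{a,b}(L)}q^{w(h)},$$ so that $w(h)$ is half the sum of the positions $x\in[0,L]$ at which $(x,h_x)$ is a straight vertex, i.e. $|h_{x+1/2}-h_{x-1/2}|=1$.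 Let $(q)_n=\prod_{i=1}^n(1-q^i)$ and, for integers $n,m$, let ${n+m\brack n}'=\frac{(q)_{n+m}}{(q)_n(q)_m}$ if $n,m\ge0$; $=1$ if $n=0$ and $m=-1$; $=0$ otherwise. Write $|i|_+=\max(i,0)$ and, for $1\le i\le j$, $$Q^{(c,j)}_i=|c-1-i|_+\bmod 2,\qquad R^{(c,j)}_i=\bigl(|i+c-j-1|_++c+1\bigr)\bmod 2.$$ Let $C$ be the Cartan matrix of type $A_{2t-3}$, i.e. the $(2t-3)\times(2t-3)$ tridiagonal matrix with $2$ on the diagonal and $-1$ next to it. **Theorem.** Let $a,b,t\in\frac12\mathbb{Z}$ and $L\in\frac12\mathbb{Z}_{\ge0}$ with $1\le a,b\le t$ and $L+a+b\in\mathbb{Z}$, and let $e,f\in\{0,1\}$. Assume $a\ne1$ if $e=1$, $a\ne t$ if $e=0$, $b\ne1$ if $f=1$, and $b\ne t$ if $f=0$. Define $\ell$, $\Delta_i$, $T^L,T^R\in\{0,1\}^{2t-2}$ by - (a) $(e,f)=(1,1)$: $\ell=2a-2$, $\Delta_i=|2a-2-i|_++|2b-2-i|_+$, $T^L=Q^{(2a-1,2t-2)}$,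 $T^R=Q^{(2b-1,2t-2)}$; - (b) $(e,f)=(0,1)$: $\ell=2t-2a$, $\Delta_i=|2t-2a-i|_++|2b-2-i|_++2t-2-i$, $T^L=R^{(2a-1,2t-2)}$, $T^R=Q^{(2b-1,2t-2)}$; - (c) $(e,f)=(0,0)$: $\ell=2t-2a$, $\Delta_i=|2t-2a-i|_++|2t-2b-i|_+$, $T^L=R^{(2a-1,2t-2)}$, $T^R=R^{(2b-1,2t-2)}$; - (d) $(e,f)=(1,0)$: $\ell=2a-2$, $\Delta_i=|2a-2-i|_++|2t-2b-i|_++2t-2-i$, $T^L=Q^{(2a-1,2t-2)}$, $T^R=R^{(2b-1,2t-2)}$. For $n=(n_1,\ldots,n_{2t-2})\in\mathbb{Z}_{\ge0}^{2t-2}$ put $$m_i=2\sum_{i<k<2t-1}(k-i)n_k-\Delta_i\ \ (0\le i\le 2t-2),\qquad \hat m_i=\tfrac12(m_i-T^L_i-T^R_i)\ \ (1\le i\le 2t-2),$$ and $m=(m_1,\ldots,m_{2t-3})$. Then $m_{2t-2}=0$; each $\hat m_i$ is an integer equal to $\frac12m_i$, $\frac12(m_i-1)$ or $\frac12m_i-1$;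 there are only finitely many $n$ with $m_0=2L$; and $$H^{e,f;t}_{a,b}(L)=\sum_{n\in\mathbb{Z}_{\ge0}^{2t-2},\ m_0=2L}q^{\frac18 mCm^T-\frac14m_\ell+\frac12 n\cdot T^R}\prod_{i=1}^{2t-3}{n_i+\hat m_i\brack n_i}'.$$ -/

import Mathlib

open scoped Matrix

namespace HalfLattice

/-! ## Half-lattice paths

A path of length `L = N / 2` is the sequence `h_{-1/2}, h_0, h_{1/2}, …, h_L, h_{L+1/2}`.
It is stored as `h : Fin (N + 3) → ℚ`, the entry with index `k` being `h_{(k-1)/2}`. -/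

/-- `x` is a half-integer, i.e. `x ∈ ½ℤ`. -/
def IsHalfInt (x : ℚ) : Prop := ∃ z : ℤ, x = (z : ℚ) / 2

/-- `h` is a half-lattice path of length `N / 2`. -/
structure IsHalfLatticePath (N : ℕ) (h : Fin (N + 3) → ℚ) : Prop where
  half : ∀ k, IsHalfInt (h k)
  step : ∀ k : Fin (N + 2), |h k.succ - h k.castSucc| = 1 / 2
  /-- if `h_x = h_{x+1}` is an integer then `h_{x+1/2} = h_x + 1/2` -/
  valley : ∀ k : Fin (N + 1),
    h k.castSucc.castSucc = h k.succ.succ → (∃ z : ℤ, h k.castSucc.castSucc = (z : ℚ)) →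
      h k.succ.castSucc = h k.castSucc.castSucc + 1 / 2

/-- The set of half-lattice paths of length `L = N / 2` that satisfy `1 ≤ h_x ≤ t` for
`0 ≤ x ≤ L`, with `h_0 = a`, `h_L = b`, `h_{-1/2} = a + 1/2 - e`, `h_{L+1/2} = b + 1/2 - f`. -/
def pathSet (t a b : ℚ) (e f : Fin 2) (N : ℕ) : Set (Fin (N + 3) → ℚ) :=
  {h | IsHalfLatticePath N h ∧
    (∀ k : Fin (N + 1), 1 ≤ h k.succ.castSucc ∧ h k.succ.castSucc ≤ t) ∧
    h ⟨1, by omega⟩ = a ∧ h ⟨N + 1, by omega⟩ = b ∧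
    h ⟨0, by omega⟩ = a + 1 / 2 - ((e : ℕ) : ℚ) ∧
    h ⟨N + 2, by omega⟩ = b + 1 / 2 - ((f : ℕ) : ℚ)}

theorem finite_halfInt_Icc (u v : ℚ) : {x : ℚ | IsHalfInt x ∧ u ≤ x ∧ x ≤ v}.Finite := by
  refine ((Set.finite_Icc (⌈2 * u⌉) (⌊2 * v⌋)).image (fun z : ℤ => (z : ℚ) / 2)).subset ?_
  rintro x ⟨⟨z, rfl⟩, h1, h2⟩
  refine ⟨z, ⟨Int.ceil_le.2 (by linarith), Int.le_floor.2 (by linarith)⟩, rfl⟩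

theorem finite_pathSet (t a b : ℚ) (e f : Fin 2) (N : ℕ) : (pathSet t a b e f N).Finite := by
  have he : ((e : ℕ) : ℚ) ≤ 1 := by
    exact_mod_cast Nat.lt_succ_iff.1 e.isLt
  have hf : ((f : ℕ) : ℚ) ≤ 1 := by
    exact_mod_cast Nat.lt_succ_iff.1 f.isLt
  have he0 : (0 : ℚ) ≤ ((e : ℕ) : ℚ) := Nat.cast_nonneg _
  have hf0 : (0 : ℚ) ≤ ((f : ℕ) : ℚ) := Nat.cast_nonneg _
  refine (Set.Finite.pi' (fun _ : Fin (N + 3) => finite_halfInt_Icc 0 (t + 1))).subset ?_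
  rintro h ⟨hp, hr, ha, hb, h0, h1⟩ k
  have ra := hr ⟨0, by omega⟩
  have rb := hr ⟨N, by omega⟩
  have ea : h (Fin.castSucc (Fin.succ (⟨0, by omega⟩ : Fin (N + 1)))) = a := ha
  have eb : h (Fin.castSucc (Fin.succ (⟨N, by omega⟩ : Fin (N + 1)))) = b := hb
  rw [ea] at ra
  rw [eb] at rb
  refine ⟨hp.half k, ?_⟩
  obtain ⟨k, hk⟩ := k
  rcases Nat.eq_zero_or_pos k with rfl | hk0
  · rw [h0]; constructor <;> linarith [ra.1, ra.2]
  rcases Nat.lt_or_ge k (N + 2) with hk2 | hk2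
  · obtain ⟨j, rfl⟩ := Nat.exists_eq_succ_of_ne_zero hk0.ne'
    have := hr ⟨j, by omega⟩
    have e' : h (Fin.castSucc (Fin.succ (⟨j, by omega⟩ : Fin (N + 1)))) = h ⟨j.succ, hk⟩ := rfl
    rw [e'] at this
    constructor <;> linarith [this.1, this.2]
  · obtain rfl : k = N + 2 := by omega
    rw [h1]; constructor <;> linarith [rb.1, rb.2]

/-- The weight `¼ ∑_{i=1}^{2L} i |h_{(i+1)/2} - h_{(i-1)/2}|`, that is, half the sum of the
positions `x = i / 2` of the straight vertices `(x, h_x)` with `0 ≤ x ≤ L`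
(a vertex is straight when the difference has absolute value `1`, otherwise it is `0`). -/
def weight (N : ℕ) (h : Fin (N + 3) → ℚ) : ℚ :=
  (1 / 4) * ∑ j : Fin N, ((j : ℕ) + 1 : ℚ) *
    |h ⟨(j : ℕ) + 3, by omega⟩ - h ⟨(j : ℕ) + 1, by omega⟩|

/-! ## Formal series in rational powers of `q`

Everything lives in the field `HahnSeries ℚ ℚ`. -/

/-- The monomial `q ^ r` for a rational exponent `r`. -/
noncomputable def qPow (r : ℚ) : HahnSeries ℚ ℚ := HahnSeries.single r 1

/-- The generating function of the paths in `pathSet t a b e f N`. -/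
noncomputable def pathGF (t a b : ℚ) (e f : Fin 2) (N : ℕ) : HahnSeries ℚ ℚ :=
  ∑ h ∈ (finite_pathSet t a b e f N).toFinset, qPow (weight N h)

/-- `(q)_n = ∏_{i=1}^n (1 - q^i)`. -/
noncomputable def qPoch (n : ℕ) : HahnSeries ℚ ℚ :=
  ∏ i ∈ Finset.Icc 1 n, (1 - qPow (i : ℚ))

/-- The modified `q`-binomial with upper entry `n + m` and lower entry `n`. -/
noncomputable def qBinomMod (n m : ℤ) : HahnSeries ℚ ℚ :=
  if 0 ≤ n ∧ 0 ≤ m then qPoch (n + m).toNat / (qPoch n.toNat * qPoch m.toNat)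
  else if n = 0 ∧ m = -1 then 1
  else 0

/-! ## The fermionic sums -/

/-- The positive part `|i|₊`: `i` if `i > 0`, and `0` if `i ≤ 0`. -/
def pabs (i : ℤ) : ℤ := if 0 < i then i else 0

/-- The component `Q^{(c,j)}_i` (it does not depend on `j`). -/
def parityQ (c i : ℤ) : ℤ := pabs (c - 1 - i) % 2

/-- The component `R^{(c,j)}_i`. -/
def parityR (c j i : ℤ) : ℤ := (pabs (i + c - j - 1) + c + 1) % 2

/-- The parameters of a fermionic sum: the index `ℓ`, the numbers `Δ_i`, and the vectors
`T^L`, `T^R`. -/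
structure FermionicData where
  ell : ℤ
  Delta : ℤ → ℤ
  TL : ℤ → ℤ
  TR : ℤ → ℤ

/-- The table of parameters, in terms of `T = 2t`, `A = 2a`, `B = 2b`. -/
def tableRow (T A B : ℤ) : Fin 2 → Fin 2 → FermionicData
  | 1, 1 =>
    { ell := A - 2
      Delta := fun i => pabs (A - 2 - i) + pabs (B - 2 - i)
      TL := parityQ (A - 1)
      TR := parityQ (B - 1) }
  | 0, 1 =>
    { ell := T - A
      Delta := fun i => pabs (T - A - i) + pabs (B - 2 - i) + T - 2 - i
      TL := parityR (A - 1) (T - 2)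
      TR := parityQ (B - 1) }
  | 0, 0 =>
    { ell := T - A
      Delta := fun i => pabs (T - A - i) + pabs (T - B - i)
      TL := parityR (A - 1) (T - 2)
      TR := parityR (B - 1) (T - 2) }
  | 1, 0 =>
    { ell := A - 2
      Delta := fun i => pabs (A - 2 - i) + pabs (T - B - i) + T - 2 - i
      TL := parityQ (A - 1)
      TR := parityR (B - 1) (T - 2) }

/-- The conditions on `a` (according to `e`) and on `b` (according to `f`) in the table. -/
def Allowed (t a : ℚ) (e : Fin 2) : Prop := if e = 1 then a ≠ 1 else a ≠ t

/-- A vector `(n_1, …, n_{2t-2})` is stored as `n : Fin (T - 2) → ℕ` with `T = 2t`; the entry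
with index `k` is `n_{k+1}`. This is `m_i = 2 ∑_{i<k<2t-1} (k - i) n_k - Δ_i`. -/
def mVal {T : ℕ} (P : FermionicData) (n : Fin (T - 2) → ℕ) (i : ℤ) : ℤ :=
  2 * (∑ k : Fin (T - 2),
    if i < ((k : ℕ) : ℤ) + 1 then (((k : ℕ) : ℤ) + 1 - i) * (n k : ℤ) else 0) - P.Delta i

/-- `m̂_i = ½ (m_i - T^L_i - T^R_i)`; the difference is even wherever this is used, which is
part of the theorem. -/
def mHat {T : ℕ} (P : FermionicData) (n : Fin (T - 2) → ℕ) (i : ℤ) : ℤ :=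
  (mVal P n i - P.TL i - P.TR i) / 2

/-- The vector `m = (m_1, …, m_{2t-3})`. -/
def mVec {T : ℕ} (P : FermionicData) (n : Fin (T - 2) → ℕ) : Fin (T - 3) → ℤ :=
  fun i => mVal P n (((i : ℕ) : ℤ) + 1)

/-- The exponent `⅛ m C mᵀ - ¼ m_ℓ + ½ n · T^R`, with `C` the Cartan matrix of type
`A_{2t-3}`. -/
def exponent {T : ℕ} (P : FermionicData) (n : Fin (T - 2) → ℕ) : ℚ :=
  (1 / 8) * ((mVec P n ⬝ᵥ (CartanMatrix.A (T - 3) *ᵥ mVec P n) : ℤ) : ℚ)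
    - (1 / 4) * (mVal P n P.ell : ℚ)
    + (1 / 2) * ((∑ k : Fin (T - 2), (n k : ℤ) * P.TR (((k : ℕ) : ℤ) + 1) : ℤ) : ℚ)

/-- The summand of the fermionic sum. -/
noncomputable def summand {T : ℕ} (P : FermionicData) (n : Fin (T - 2) → ℕ) :
    HahnSeries ℚ ℚ :=
  qPow (exponent P n) *
    ∏ i : Fin (T - 3),
      qBinomMod (n (Fin.castLE (by omega) i) : ℤ) (mHat P n (((i : ℕ) : ℤ) + 1))

end HalfLattice

/-! ### Monomials, `q`-factorials and the modified binomial -/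

namespace HalfLattice

/-! Double all heights and positions: paths then live in the integer strip `[2, T]`, a straight
vertex at time `N` weighs `N / 4`, and the integrality condition says that valleys occur only at
even heights. The number of peaks is recorded as well.

The core is a comparison of two consecutive strips. Raise every peak of a path in `[2, T]` by one
and then insert `n` new peaks of height one at vertices of even height, with repetition: this
produces the paths of `[2, T + 1]`. If the path has `μ + 1` even heights, the insertion contributes
the binomial with entries `n` and `μ`, and the rest of the weight depends only on the length, the
numbers of peaks and the parity of the end height. No bijection is built: both sides satisfy the
same recursion in time, by the `q`-Pascal rule (`insertDown_succ`, `insertUp_step`,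
`arrival_eq_insert`).

To iterate this, paths are first extended at both ends to the floor, height `2`. An end whose edge
goes down, seen from the path, runs straight to the floor; the other kind first climbs to the
ceiling. In the smaller strip the extended path has the same shape, with the end point moved by at
most one (`enlarges_left`, `extendedGF_step`). After `T - 2` reductions only the empty path is left
(`extendedGF_two`). If `n_i` peaks are removed in the `i`-th reduction, the length is `2 ∑ i n_i`,
and `m_i` is the length left after `i` reductions, minus that of the two extensions at that stage
(`extendedGF_eq_sum`). Vectors with some `m_i < 0` contribute nothing, even though the modified
binomial is `1` at `(0, -1)`: a convexity argument excludes them (`nonneg_of_almost_convex`).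

For a fixed number of peaks, extending multiplies the generating function by a single power of `q`
(`extendedGF_eq_innerGF`). The extension lengths are piecewise linear in the stage, with one corner
each, so summation by parts turns the accumulated exponent into this power plus the Cartan form, the
term in `m_ℓ` and the parity term (`exponent_extended`). This power is then cancelled, and the sum
over peaks gives the result (`pathGF_eq_finsum`).

The table agrees with this description except for `(e, f) = (0, 0)`, where both extensions touch the
ceiling; there the last entry of the vector is lowered by one (`Describes.finsum_eq`). -/

theorem qPow_add (r s : ℚ) : qPow (r + s) = qPow r * qPow s := by
  simp [qPow, HahnSeries.single_mul_single]

theorem qPow_zero : qPow 0 = 1 := rfl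

theorem qPow_ne_zero (r : ℚ) : qPow r ≠ 0 := by
  simp [qPow]

theorem one_sub_qPow_ne_zero {r : ℚ} (hr : r ≠ 0) : 1 - qPow r ≠ 0 := by
  intro h
  have h1 : (1 : HahnSeries ℚ ℚ) = qPow r := sub_eq_zero.1 h
  have h2 := congrArg (fun x => HahnSeries.coeff x r) h1
  simp [qPow, HahnSeries.coeff_one, hr] at h2

theorem qPow_mul_qPow_mul (r s : ℚ) (x : HahnSeries ℚ ℚ) :
    qPow r * (qPow s * x) = qPow (r + s) * x := by
  rw [qPow_add, mul_assoc]

theorem qPoch_succ (n : ℕ) : qPoch (n + 1) = qPoch n * (1 - qPow ((n : ℚ) + 1)) := by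
  rw [qPoch, Finset.prod_Icc_succ_top (by omega)]
  simp [qPoch]

theorem qPoch_ne_zero (n : ℕ) : qPoch n ≠ 0 := by
  induction n with
  | zero => simp [qPoch]
  | succ n ih =>
    rw [qPoch_succ]
    exact mul_ne_zero ih (one_sub_qPow_ne_zero (by positivity))

theorem qPoch_zero : qPoch 0 = 1 := by simp [qPoch]

theorem qBinomMod_of_neg {n : ℤ} (hn : n < 0) (m : ℤ) : qBinomMod n m = 0 := by
  unfold qBinomMod
  rw [if_neg (by omega), if_neg (by omega)]

theorem qBinomMod_nat (n m : ℕ) :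
    qBinomMod n m = qPoch (n + m) / (qPoch n * qPoch m) := by
  unfold qBinomMod
  rw [if_pos (by omega)]
  congr 2

theorem qBinomMod_neg_one (n : ℤ) : qBinomMod n (-1) = if n = 0 then 1 else 0 := by
  unfold qBinomMod
  rw [if_neg (by omega)]
  simp

theorem qBinomMod_zero_right {n : ℤ} (hn : 0 ≤ n) : qBinomMod n 0 = 1 := by
  obtain ⟨n, rfl⟩ := Int.eq_ofNat_of_zero_le hn
  have := qBinomMod_nat n 0
  simp only [Nat.cast_zero] at this
  rw [this, qPoch_zero, mul_one, Nat.add_zero, div_self (qPoch_ne_zero n)]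

theorem qBinomMod_zero_left {m : ℤ} (hm : 0 ≤ m) : qBinomMod 0 m = 1 := by
  obtain ⟨n, rfl⟩ := Int.eq_ofNat_of_zero_le hm
  have := qBinomMod_nat 0 n
  simp only [Nat.cast_zero] at this
  rw [this, qPoch_zero, one_mul, Nat.zero_add, div_self (qPoch_ne_zero n)]

/-- The `q`-Pascal rule for the modified binomial. -/
theorem qBinomMod_pascal (n : ℤ) {m : ℤ} (hm : 0 ≤ m) :
    qBinomMod n m = qPow n * qBinomMod n (m - 1) + qBinomMod (n - 1) m := by
  rcases lt_trichotomy n 0 with hn | rfl | hn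
  · rw [qBinomMod_of_neg hn, qBinomMod_of_neg hn, qBinomMod_of_neg (by omega)]
    simp
  · rw [qBinomMod_zero_left hm, qBinomMod_of_neg (n := 0 - 1) (by omega), Int.cast_zero, qPow_zero]
    rcases hm.eq_or_lt with rfl | hm
    -- The value `1` at `n = 0`, `m = -1` is what makes the rule hold at `m = 0`.
    · rw [show (0 : ℤ) - 1 = -1 by norm_num, qBinomMod_neg_one]; simp
    · rw [qBinomMod_zero_left (by omega)]; simp
  rcases hm.eq_or_lt with rfl | hm
  · rw [show (0 : ℤ) - 1 = -1 by norm_num, qBinomMod_neg_one, if_neg hn.ne',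
      qBinomMod_zero_right hn.le, qBinomMod_zero_right (by omega)]
    simp
  obtain ⟨k, rfl⟩ : ∃ k : ℕ, n = ((k + 1 : ℕ) : ℤ) := ⟨(n - 1).toNat, by omega⟩
  obtain ⟨l, rfl⟩ : ∃ l : ℕ, m = ((l + 1 : ℕ) : ℤ) := ⟨(m - 1).toNat, by omega⟩
  have e1 : (((l + 1 : ℕ) : ℤ) - 1) = (l : ℤ) := by push_cast; ring
  have e2 : (((k + 1 : ℕ) : ℤ) - 1) = (k : ℤ) := by push_cast; ring
  rw [e1, e2, qBinomMod_nat, qBinomMod_nat, qBinomMod_nat]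
  rw [show k + 1 + (l + 1) = (k + l + 1) + 1 by ring, show k + 1 + l = k + l + 1 by ring,
    show k + (l + 1) = k + l + 1 by ring, qPoch_succ (k + l + 1), qPoch_succ k, qPoch_succ l]
  have h1 := qPoch_ne_zero k
  have h2 := qPoch_ne_zero l
  have h3 := one_sub_qPow_ne_zero (r := (k : ℚ) + 1) (by positivity)
  have h4 := one_sub_qPow_ne_zero (r := (l : ℚ) + 1) (by positivity)
  have h5 : qPow (((k + l + 1 : ℕ) : ℚ) + 1) = qPow ((k : ℚ) + 1) * qPow ((l : ℚ) + 1) := by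
    rw [← qPow_add]; congr 1; push_cast; ring
  have h6 : qPow (((k + 1 : ℕ) : ℤ) : ℚ) = qPow ((k : ℚ) + 1) := by
    congr 1; push_cast; ring
  rw [h5, h6]
  generalize qPow ((k : ℚ) + 1) = x at *
  generalize qPow ((l : ℚ) + 1) = y at *
  generalize qPoch (k + l + 1) = z at *
  field_simp
  ring

/-! ### Generating functions of paths by recursion in time -/

/-- Generating function, by time, letter (`true` is up), height and number of peaks. -/
abbrev Family := ℤ → Bool → ℤ → ℤ → HahnSeries ℚ ℚ

/-- Paths that leave the vertex `(N, h)` downwards, from the family of paths that arrive there. -/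
noncomputable def leaveDown (I : Family) (N h p : ℤ) : HahnSeries ℚ ℚ :=
  qPow ((N : ℚ) / 4) * I N false h p + I N true h (p - 1)

/-- Paths that leave the vertex `(N, h)` upwards, from the family of paths that arrive there. -/
noncomputable def leaveUp (I : Family) (N h p : ℤ) : HahnSeries ℚ ℚ :=
  qPow ((N : ℚ) / 4) * I N true h p + if Even h then I N false h p else 0

/-- `I N x h p` counts the paths in the strip `[2, T]` that arrive by the letter `x` at the vertex
`(N, h)` with `p` peaks before it, when they start as prescribed by `S`. -/
structure IsArrival (T : ℤ) (S I : Family) : Prop where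
  out : ∀ N x h p, ¬ (2 ≤ h ∧ h ≤ T) → I N x h p = 0
  neg : ∀ N x h p, N < 0 → I N x h p = 0
  down : ∀ N h p, 0 ≤ N → 2 ≤ h → h ≤ T →
    I N false h p = S N false h p + leaveDown I (N - 1) (h + 1) p
  up : ∀ N h p, 0 ≤ N → 2 ≤ h → h ≤ T →
    I N true h p = S N true h p + leaveUp I (N - 1) (h - 1) p

/-- A single starting point, with a weight. -/
noncomputable def pointSource (s : ℤ) (x : Bool) (A c : ℤ) (w : ℚ) : Family := fun N y h p =>
  if N = s ∧ y = x ∧ h = A ∧ p = c then qPow w else 0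

/-- The family of arriving paths at nonnegative times. -/
noncomputable def arrivalNat (T : ℤ) (S : Family) :
    ℕ → Bool → ℤ → ℤ → HahnSeries ℚ ℚ
  | 0, x, h, p => if 2 ≤ h ∧ h ≤ T then S 0 x h p else 0
  | n + 1, false, h, p => if 2 ≤ h ∧ h ≤ T then S (n + 1 : ℕ) false h p +
      (qPow ((n : ℚ) / 4) * arrivalNat T S n false (h + 1) p
        + arrivalNat T S n true (h + 1) (p - 1)) else 0
  | n + 1, true, h, p => if 2 ≤ h ∧ h ≤ T then S (n + 1 : ℕ) true h p +
      (qPow ((n : ℚ) / 4) * arrivalNat T S n true (h - 1) p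
        + if Even (h - 1) then arrivalNat T S n false (h - 1) p else 0) else 0

/-- The family of arriving paths. -/
noncomputable def arrival (T : ℤ) (S : Family) : Family := fun N x h p =>
  if N < 0 then 0 else arrivalNat T S N.toNat x h p

theorem isArrival_arrival (T : ℤ) (S : Family) : IsArrival T S (arrival T S) where
  out N x h p hh := by
    unfold arrival
    split_ifs
    · rfl
    · cases N.toNat <;> cases x <;> simp only [arrivalNat, if_neg hh]
  neg N x h p hN := by simp [arrival, hN]
  down N h p hN h2 hT := by
    obtain ⟨n, rfl⟩ := Int.eq_ofNat_of_zero_le hN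
    cases n with
    | zero => simp [arrival, arrivalNat, leaveDown, h2, hT]
    | succ n =>
      have e : ((n + 1 : ℕ) : ℤ) - 1 = n := by push_cast; ring
      rw [e]
      simp only [arrival, leaveDown]
      rw [if_neg (by omega), if_neg (by omega), if_neg (by omega), Int.toNat_natCast,
        Int.toNat_natCast]
      simp [arrivalNat, h2, hT]
  up N h p hN h2 hT := by
    obtain ⟨n, rfl⟩ := Int.eq_ofNat_of_zero_le hN
    cases n with
    | zero => simp [arrival, arrivalNat, leaveUp, h2, hT]
    | succ n =>
      have e : ((n + 1 : ℕ) : ℤ) - 1 = n := by push_cast; ring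
      rw [e]
      have hn : ¬ ((n : ℕ) : ℤ) < 0 := by omega
      have hn' : ¬ ((n + 1 : ℕ) : ℤ) < 0 := by omega
      simp only [arrival, leaveUp, if_neg hn, if_neg hn', Int.toNat_natCast, arrivalNat, h2, hT,
        and_self, if_true, Int.cast_natCast]

namespace IsArrival

variable {T : ℤ} {S I : Family}

theorem leaveDown_neg (hI : IsArrival T S I) {N : ℤ} (hN : N < 0) (h p : ℤ) :
    leaveDown I N h p = 0 := by
  simp [leaveDown, hI.neg N _ _ _ hN]

theorem leaveUp_neg (hI : IsArrival T S I) {N : ℤ} (hN : N < 0) (h p : ℤ) :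
    leaveUp I N h p = 0 := by
  simp [leaveUp, hI.neg N _ _ _ hN]

theorem leaveDown_out (hI : IsArrival T S I) {h : ℤ} (hh : ¬ (2 ≤ h ∧ h ≤ T)) (N p : ℤ) :
    leaveDown I N h p = 0 := by
  simp [leaveDown, hI.out N _ _ _ hh]

theorem leaveUp_out (hI : IsArrival T S I) {h : ℤ} (hh : ¬ (2 ≤ h ∧ h ≤ T)) (N p : ℤ) :
    leaveUp I N h p = 0 := by
  simp [leaveUp, hI.out N _ _ _ hh]

/-- There are no paths before the first source. -/
theorem eq_zero_of_lt (hI : IsArrival T S I) {s : ℤ}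
    (hS : ∀ N x h p, N < s → S N x h p = 0) (N : ℤ) (x : Bool) (h p : ℤ) (hN : N < s) :
    I N x h p = 0 := by
  rcases lt_or_ge N 0 with h0 | h0
  · exact hI.neg _ _ _ _ h0
  obtain ⟨n, rfl⟩ := Int.eq_ofNat_of_zero_le h0
  induction n generalizing x h p with
  | zero =>
    by_cases hh : 2 ≤ h ∧ h ≤ T
    · cases x
      · rw [hI.down _ _ _ h0 hh.1 hh.2, hS _ _ _ _ hN, hI.leaveDown_neg (by simp), add_zero]
      · rw [hI.up _ _ _ h0 hh.1 hh.2, hS _ _ _ _ hN, hI.leaveUp_neg (by simp), add_zero]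
    · exact hI.out _ _ _ _ hh
  | succ n ih =>
    have e : ((n + 1 : ℕ) : ℤ) - 1 = n := by push_cast; ring
    have ih' := fun x h p => ih x h p (by push_cast at hN; omega) (by omega)
    by_cases hh : 2 ≤ h ∧ h ≤ T
    · cases x
      · rw [hI.down _ _ _ h0 hh.1 hh.2, hS _ _ _ _ hN, e]; simp [leaveDown, ih']
      · rw [hI.up _ _ _ h0 hh.1 hh.2, hS _ _ _ _ hN, e]; simp [leaveUp, ih']
    · exact hI.out _ _ _ _ hh

theorem eq_zero_of_peaks_lt (hI : IsArrival T S I) {c : ℤ}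
    (hS : ∀ N x h p, p < c → S N x h p = 0) (N : ℤ) (x : Bool) (h p : ℤ) (hp : p < c) :
    I N x h p = 0 := by
  rcases lt_or_ge N 0 with h0 | h0
  · exact hI.neg _ _ _ _ h0
  obtain ⟨n, rfl⟩ := Int.eq_ofNat_of_zero_le h0
  induction n generalizing x h p with
  | zero =>
    by_cases hh : 2 ≤ h ∧ h ≤ T
    · cases x
      · rw [hI.down _ _ _ h0 hh.1 hh.2, hS _ _ _ _ hp, hI.leaveDown_neg (by simp), add_zero]
      · rw [hI.up _ _ _ h0 hh.1 hh.2, hS _ _ _ _ hp, hI.leaveUp_neg (by simp), add_zero]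
    · exact hI.out _ _ _ _ hh
  | succ n ih =>
    have e : ((n + 1 : ℕ) : ℤ) - 1 = n := by push_cast; ring
    have ih' := fun x h p hp => ih x h p hp (by omega)
    by_cases hh : 2 ≤ h ∧ h ≤ T
    · cases x
      · rw [hI.down _ _ _ h0 hh.1 hh.2, hS _ _ _ _ hp, e, leaveDown, ih' _ _ _ hp,
          ih' _ _ _ (by omega)]; simp
      · rw [hI.up _ _ _ h0 hh.1 hh.2, hS _ _ _ _ hp, e, leaveUp, ih' _ _ _ hp,
          ih' _ _ _ hp]; simp
    · exact hI.out _ _ _ _ hh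

/-- Two families that agree at some time and have no later sources agree from then on. -/
theorem eq_of_eq {S' J : Family} (hI : IsArrival T S I) (hJ : IsArrival T S' J) {s : ℤ}
    (hs : 0 ≤ s) (hS : ∀ N x h p, s < N → S N x h p = 0) (hS' : ∀ N x h p, s < N → S' N x h p = 0)
    (h0 : ∀ x h p, I s x h p = J s x h p) (N : ℤ) (hN : s ≤ N) (x : Bool) (h p : ℤ) :
    I N x h p = J N x h p := by
  obtain ⟨n, rfl⟩ : ∃ n : ℕ, N = s + n := ⟨(N - s).toNat, by omega⟩
  induction n generalizing x h p with
  | zero => simpa using h0 x h p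
  | succ n ih =>
    have e : s + ((n + 1 : ℕ) : ℤ) - 1 = s + n := by push_cast; ring
    have ih' := fun x h p => ih x h p (by omega)
    by_cases hh : 2 ≤ h ∧ h ≤ T
    · cases x
      · rw [hI.down _ _ _ (by omega) hh.1 hh.2, hJ.down _ _ _ (by omega) hh.1 hh.2,
          hS _ _ _ _ (by push_cast; omega), hS' _ _ _ _ (by push_cast; omega), e]
        simp only [leaveDown, ih']
      · rw [hI.up _ _ _ (by omega) hh.1 hh.2, hJ.up _ _ _ (by omega) hh.1 hh.2,
          hS _ _ _ _ (by push_cast; omega), hS' _ _ _ _ (by push_cast; omega), e]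
        simp only [leaveUp, ih']
    · rw [hI.out _ _ _ _ hh, hJ.out _ _ _ _ hh]

end IsArrival

theorem pointSource_of_lt {s : ℤ} (x : Bool) (A c : ℤ) (w : ℚ) {N : ℤ} (hN : N < s) (y : Bool)
    (h p : ℤ) : pointSource s x A c w N y h p = 0 := by
  rw [pointSource, if_neg]; omega

theorem pointSource_of_gt {s : ℤ} (x : Bool) (A c : ℤ) (w : ℚ) {N : ℤ} (hN : s < N) (y : Bool)
    (h p : ℤ) : pointSource s x A c w N y h p = 0 := by
  rw [pointSource, if_neg]; omega

theorem pointSource_of_peaks_ne {c p : ℤ} (s : ℤ) (x : Bool) (A : ℤ) (w : ℚ) (hp : p ≠ c) (N : ℤ)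
    (y : Bool) (h : ℤ) : pointSource s x A c w N y h p = 0 := by
  rw [pointSource, if_neg]; tauto

theorem pointSource_of_height_ne {A h : ℤ} (s : ℤ) (x : Bool) (c : ℤ) (w : ℚ) (hh : h ≠ A) (N : ℤ)
    (y : Bool) (p : ℤ) : pointSource s x A c w N y h p = 0 := by
  rw [pointSource, if_neg]; tauto

/-! ### Insertion of peaks and its recursion -/

/-- The number of even heights, minus one, of a path that starts at `(s, A)` and ends at `(N, h)`. -/
def slots (s A N h : ℤ) : ℤ := (N - s - A % 2 - h % 2) / 2

/-- From time `s` on, the count at an even height is negative only at `N = s` with `A` odd, and the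
path is then still at `A`, not at `h`. So the Pascal rule, valid for `0 ≤ m`, covers every nonzero
term. -/
theorem IsArrival.eq_zero_of_slots_neg {T : ℤ} {I : Family} {s : ℤ} {x : Bool} {A c : ℤ} {w : ℚ}
    (hI : IsArrival T (pointSource s x A c w) I) {N h : ℤ} (hh : Even h) (hm : slots s A N h < 0)
    (y : Bool) (p : ℤ) : I N y h p = 0 := by
  have hh' : h % 2 = 0 := Int.even_iff.1 hh
  have hz := hI.eq_zero_of_lt (s := s) (fun N x h p hN => pointSource_of_lt _ _ _ _ hN _ _ _)
  rcases lt_or_ge N s with hN | hN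
  · exact hz _ _ _ _ hN
  have hNs : N = s ∧ A % 2 = 1 := by unfold slots at hm; omega
  obtain ⟨rfl, hA⟩ := hNs
  by_cases hr : 2 ≤ h ∧ h ≤ T
  · rcases lt_or_ge N 0 with h0 | h0
    · exact hI.neg _ _ _ _ h0
    have hne : h ≠ A := by rintro rfl; omega
    cases y
    · rw [hI.down _ _ _ h0 hr.1 hr.2, pointSource_of_height_ne _ _ _ _ hne, leaveDown,
        hz _ _ _ _ (by omega), hz _ _ _ _ (by omega)]; simp
    · rw [hI.up _ _ _ h0 hr.1 hr.2, pointSource_of_height_ne _ _ _ _ hne, leaveUp,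
        hz _ _ _ _ (by omega), hz _ _ _ _ (by omega)]; simp
  · exact hI.out _ _ _ _ hr

/-- Paths leaving `(N, h)` upwards after `n` of the `p` peaks have been inserted freely into a path
with `p - n` peaks. -/
noncomputable def insertUp (s A : ℤ) (I : Family) (N h p : ℤ) : HahnSeries ℚ ℚ :=
  ∑ n ∈ Finset.range (p.toNat + 1),
    qPow (((p : ℚ) - n) * (N - 2 * p) / 2 + n * ((h % 2 : ℤ) : ℚ) / 2) *
      (qBinomMod n (slots s A (N - 2 * p) h) * leaveUp I (N - 2 * p) h (p - n))

/-- The analogue of `insertUp` for paths that arrive at `(N, h)` downwards. -/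
noncomputable def insertDown (s A : ℤ) (I : Family) (N h p : ℤ) : HahnSeries ℚ ℚ :=
  ∑ n ∈ Finset.range (p.toNat + 1),
    qPow (((p : ℚ) - n) * (N - 2 * p) / 2 + n * ((h % 2 : ℤ) : ℚ) / 2 - (N - 2 * p) / 4) *
      (qBinomMod n (slots s A (N - 2 * p) h) * leaveDown I (N - 2 * p) h (p - n))

theorem sum_range_shift {M : Type*} [AddCommMonoid M] (g : ℕ → M) {K : ℕ} (h0 : g 0 = 0)
    (hK : g K = 0) : ∑ n ∈ Finset.range K, g (n + 1) = ∑ n ∈ Finset.range K, g n := by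
  have h1 := Finset.sum_range_succ' g K
  have h2 := Finset.sum_range_succ g K
  rw [h0, add_zero] at h1
  rw [hK, add_zero] at h2
  rw [← h1, h2]

section

variable {T s A c : ℤ} {x : Bool} {w : ℚ} {I : Family}

theorem IsArrival.leaveUp_peaks_neg (hI : IsArrival T (pointSource s x A c w) I) (hc : 0 ≤ c)
    {p : ℤ} (hp : p < 0) (N h : ℤ) : leaveUp I N h p = 0 := by
  have hz := hI.eq_zero_of_peaks_lt (c := c)
    (fun N x h p hN => pointSource_of_peaks_ne _ _ _ _ hN.ne _ _ _)
  simp [leaveUp, hz N _ h p (by omega)]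

theorem IsArrival.leaveDown_peaks_neg (hI : IsArrival T (pointSource s x A c w) I) (hc : 0 ≤ c)
    {p : ℤ} (hp : p < 0) (N h : ℤ) : leaveDown I N h p = 0 := by
  have hz := hI.eq_zero_of_peaks_lt (c := c)
    (fun N x h p hN => pointSource_of_peaks_ne _ _ _ _ hN.ne _ _ _)
  simp [leaveDown, hz N _ h p (by omega), hz N _ h (p - 1) (by omega)]

theorem insertUp_eq (hI : IsArrival T (pointSource s x A c w) I) (hc : 0 ≤ c) (N h p : ℤ) {K : ℕ}
    (hK : p.toNat + 1 ≤ K) : insertUp s A I N h p = ∑ n ∈ Finset.range K,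
    qPow (((p : ℚ) - n) * (N - 2 * p) / 2 + n * ((h % 2 : ℤ) : ℚ) / 2) *
      (qBinomMod n (slots s A (N - 2 * p) h) * leaveUp I (N - 2 * p) h (p - n)) := by
  refine Finset.sum_subset (Finset.range_subset_range.2 hK) fun n _ hn => ?_
  rw [Finset.mem_range] at hn
  rw [hI.leaveUp_peaks_neg hc (by omega), mul_zero, mul_zero]

theorem insertUp_peaks_neg (hI : IsArrival T (pointSource s x A c w) I) (hc : 0 ≤ c) (N h : ℤ)
    {p : ℤ} (hp : p < 0) : insertUp s A I N h p = 0 :=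
  Finset.sum_eq_zero fun n _ => by
    rw [hI.leaveUp_peaks_neg hc (by omega), mul_zero, mul_zero]

theorem insertDown_peaks_neg (hI : IsArrival T (pointSource s x A c w) I) (hc : 0 ≤ c) (N h : ℤ)
    {p : ℤ} (hp : p < 0) : insertDown s A I N h p = 0 :=
  Finset.sum_eq_zero fun n _ => by
    rw [hI.leaveDown_peaks_neg hc (by omega), mul_zero, mul_zero]

theorem insertUp_of_neg (hI : IsArrival T (pointSource s x A c w) I) {N p : ℤ}
    (hN : N - 2 * p < 0) (h : ℤ) : insertUp s A I N h p = 0 :=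
  Finset.sum_eq_zero fun n _ => by rw [hI.leaveUp_neg hN, mul_zero, mul_zero]

theorem insertDown_of_neg (hI : IsArrival T (pointSource s x A c w) I) {N p : ℤ}
    (hN : N - 2 * p < 0) (h : ℤ) : insertDown s A I N h p = 0 :=
  Finset.sum_eq_zero fun n _ => by rw [hI.leaveDown_neg hN, mul_zero, mul_zero]

theorem insertUp_out (hI : IsArrival T (pointSource s x A c w) I) {h : ℤ}
    (hh : ¬ (2 ≤ h ∧ h ≤ T)) (N p : ℤ) : insertUp s A I N h p = 0 :=
  Finset.sum_eq_zero fun n _ => by rw [hI.leaveUp_out hh, mul_zero, mul_zero]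

theorem insertDown_out (hI : IsArrival T (pointSource s x A c w) I) {h : ℤ}
    (hh : ¬ (2 ≤ h ∧ h ≤ T)) (N p : ℤ) : insertDown s A I N h p = 0 :=
  Finset.sum_eq_zero fun n _ => by rw [hI.leaveDown_out hh, mul_zero, mul_zero]

/-- Just before the source the path has no even height yet. The binomial with lower argument `-1`
vanishes unless `n = 0`, so nothing is inserted ahead of the starting point. -/
theorem slots_source_down (s A : ℤ) : slots s A (s - 1) (A + 1) = -1 := by
  unfold slots; omega

theorem slots_source_up (s A : ℤ) : slots s A (s - 1) (A - 1) = -1 := by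
  unfold slots; omega

theorem qBinomMod_neg_one_nat (n : ℕ) : qBinomMod n (-1) = if n = 0 then 1 else 0 := by
  rw [qBinomMod_neg_one]; simp

theorem sum_source {N1 p : ℤ} (y : Bool) (h : ℤ) (μ : ℤ)
    (hμ : N1 = s → h = A → μ = -1) (E : ℕ → ℚ) :
    ∑ n ∈ Finset.range (p.toNat + 1),
      qPow (E n) * (qBinomMod n μ * pointSource s x A c w N1 y h (p - n)) =
    if N1 = s ∧ y = x ∧ h = A ∧ p = c then qPow (E 0 + w) else 0 := by
  by_cases hcond : N1 = s ∧ y = x ∧ h = A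
  · obtain ⟨h1, h2, h3⟩ := hcond
    rw [hμ h1 h3]
    rw [Finset.sum_eq_single 0]
    · rw [qBinomMod_neg_one_nat]
      simp only [pointSource, h1, h2, h3, if_true, true_and, one_mul, Nat.cast_zero, sub_zero]
      split_ifs
      · rw [qPow_add]
      · rw [mul_zero]
    · intro n _ hn
      rw [qBinomMod_neg_one_nat, if_neg hn]; simp
    · simp
  · rw [if_neg (by tauto)]
    refine Finset.sum_eq_zero fun n _ => ?_
    rw [pointSource, if_neg (by tauto)]; simp

/-- This is the recursion of downward arrivals in the strip `[2, T + 1]`. The last vertex of the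
smaller path was reached by a descent or an ascent. An ascent gives the straight part of `insertUp`.
A descent, at even height, is split by the Pascal rule: either no peak is inserted at this vertex,
and the path comes from `(N, h + 1)`, or one is, and removing it leaves the valley part of
`insertUp`. -/
theorem insertDown_succ (hI : IsArrival T (pointSource s x A c w) I) (hs : 0 ≤ s) (hc : 0 ≤ c)
    (N p : ℤ) {h : ℤ} (h2 : 2 ≤ h) (hT : h ≤ T) :
    insertDown s A I (N + 1) h p = qPow ((N : ℚ) / 4) * insertDown s A I N (h + 1) p
      + insertUp s A I (N - 1) h (p - 1)
      + if x = false then pointSource (s + 2 * c) false A c (w + c * s / 2) (N + 1) false h p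
        else 0 := by
  have hsrc0 : (N + 1) - 2 * p < 0 ∨ p < 0 →
      (if x = false then pointSource (s + 2 * c) false A c (w + c * s / 2) (N + 1) false h p
        else 0) = 0 := by
    intro hh
    split_ifs
    · rw [pointSource, if_neg (by omega)]
    · rfl
  rcases lt_or_ge p 0 with hp | hp
  · rw [insertDown_peaks_neg hI hc _ _ hp, insertDown_peaks_neg hI hc _ _ hp,
      insertUp_peaks_neg hI hc _ _ (by omega), hsrc0 (Or.inr hp)]; simp
  rcases lt_or_ge (N + 1 - 2 * p) 0 with hN | hN
  · rw [insertDown_of_neg hI hN, insertDown_of_neg hI (by omega), insertUp_of_neg hI (by omega),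
      hsrc0 (Or.inl hN)]; simp
  rw [insertUp_eq hI hc _ _ _ (K := p.toNat + 1) (by omega)]
  -- `N1` is the time at the vertex before the `p` peaks added their two steps each.
  obtain ⟨N1, rfl⟩ : ∃ N1, N = N1 - 1 + 2 * p := ⟨N + 1 - 2 * p, by ring⟩
  have e1 : N1 - 1 + 2 * p + 1 - 2 * p = N1 := by ring
  have e2 : N1 - 1 + 2 * p - 1 - 2 * (p - 1) = N1 := by ring
  have e3 : N1 - 1 + 2 * p - 2 * p = N1 - 1 := by ring
  simp only [insertDown, e1, e2, e3]
  rw [e1] at hN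
  set μ := slots s A N1 h with hμ
  set μ' := slots s A (N1 - 1) (h + 1) with hμ'
  have hD : ∀ n : ℕ, leaveDown I (N1 - 1) (h + 1) (p - n) =
      I N1 false h (p - n) - pointSource s x A c w N1 false h (p - n) := by
    intro n; rw [hI.down _ _ _ hN h2 hT]; ring
  -- the part coming from the sources
  have hS := sum_source (x := x) (w := w) (A := A) (c := c) (s := s) (N1 := N1) (p := p) false h μ'
    (fun ha hb => by rw [hμ', ha, hb, slots_source_down])
    (fun n => (((N1 - 1 + 2 * p : ℤ) : ℚ) / 4) + (((p : ℚ) - n) * ((N1 - 1 + 2 * p : ℤ) - 2 * p) / 2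
      + n * (((h + 1) % 2 : ℤ) : ℚ) / 2 - ((N1 - 1 + 2 * p : ℤ) - 2 * p) / 4))
  have hS' : (if x = false then pointSource (s + 2 * c) false A c (w + c * s / 2)
      (N1 - 1 + 2 * p + 1) false h p else 0) =
      if N1 = s ∧ false = x ∧ h = A ∧ p = c then qPow ((((N1 - 1 + 2 * p : ℤ) : ℚ) / 4) +
        (((p : ℚ) - (0 : ℕ)) * ((N1 - 1 + 2 * p : ℤ) - 2 * p) / 2
      + (0 : ℕ) * (((h + 1) % 2 : ℤ) : ℚ) / 2 - ((N1 - 1 + 2 * p : ℤ) - 2 * p) / 4) + w) else 0 := by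
    by_cases hx : x = false
    · rw [if_pos hx, pointSource]
      by_cases hh : N1 = s ∧ h = A ∧ p = c
      · obtain ⟨ha, hb, hcc⟩ := hh
        rw [if_pos ⟨by omega, rfl, hb, hcc⟩, if_pos ⟨ha, hx.symm, hb, hcc⟩]
        congr 1; subst ha hcc; push_cast; ring
      · rw [if_neg, if_neg (by tauto)]
        rintro ⟨ha, -, hb, hcc⟩
        exact hh ⟨by omega, hb, hcc⟩
    · rw [if_neg hx, if_neg]
      rintro ⟨-, hb, -⟩
      exact hx hb.symm
  rw [hS', ← hS, Finset.mul_sum]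
  -- the shifted sum
  have hshift := sum_range_shift (K := p.toNat + 1) (fun n : ℕ => if Even h then
      qPow (((p : ℚ) - n) * N1 / 2) *
        (qBinomMod ((n : ℤ) - 1) μ * I N1 false h (p - n)) else 0)
    (by simp [qBinomMod_of_neg])
    (by
      have hz := hI.eq_zero_of_peaks_lt (c := c)
        (fun N x h p hN => pointSource_of_peaks_ne _ _ _ _ hN.ne _ _ _)
      have : I N1 false h (p - ((p.toNat + 1 : ℕ) : ℤ)) = 0 := hz _ _ _ _ (by push_cast; omega)
      simp only [this, mul_zero, ite_self])
  have hU : ∀ n : ℕ, qPow ((((p - 1 : ℤ) : ℚ) - n) * ((N1 - 1 + 2 * p - 1 : ℤ) - 2 * (p - 1 : ℤ)) / 2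
        + n * ((h % 2 : ℤ) : ℚ) / 2) * (qBinomMod n μ * leaveUp I N1 h (p - 1 - n)) =
      qPow (((p : ℚ) - n) * N1 / 2 + n * ((h % 2 : ℤ) : ℚ) / 2 - N1 / 4) *
        (qBinomMod n μ * I N1 true h (p - n - 1)) +
      (if Even h then qPow (((p : ℚ) - (n + 1 : ℕ)) * N1 / 2) *
        (qBinomMod (((n + 1 : ℕ) : ℤ) - 1) μ * I N1 false h (p - (n + 1 : ℕ))) else 0) := by
    intro n
    have ea : p - 1 - (n : ℤ) = p - n - 1 := by ring
    have eb : p - ((n + 1 : ℕ) : ℤ) = p - n - 1 := by push_cast; ring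
    have ec : ((n + 1 : ℕ) : ℤ) - 1 = n := by push_cast; ring
    rw [leaveUp, ea, eb, ec, mul_add, mul_add]
    congr 1
    · rw [mul_left_comm (qBinomMod _ _), qPow_mul_qPow_mul]
      congr 2; push_cast; ring
    · split_ifs with hev
      · have : h % 2 = 0 := Int.even_iff.1 hev
        rw [this]; congr 2; push_cast; ring
      · simp
  rw [Finset.sum_congr rfl fun n _ => hU n, Finset.sum_add_distrib, hshift,
    ← Finset.sum_add_distrib, ← Finset.sum_add_distrib, ← Finset.sum_add_distrib]
  refine Finset.sum_congr rfl fun n _ => ?_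
  -- Between the previous vertex and this one the slot count grows by one exactly when `h` is even;
  -- for odd `h` the two binomials coincide and nothing can be inserted.
  have hmain : qPow (((p : ℚ) - n) * ((N1 - 1 + 2 * p + 1 : ℤ) - 2 * p) / 2
        + n * ((h % 2 : ℤ) : ℚ) / 2 - ((N1 - 1 + 2 * p + 1 : ℤ) - 2 * p) / 4) *
        (qBinomMod n μ * (qPow (N1 / 4) * I N1 false h (p - n))) =
      qPow (((N1 - 1 + 2 * p : ℤ) : ℚ) / 4 + (((p : ℚ) - n) * ((N1 - 1 + 2 * p : ℤ) - 2 * p) / 2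
        + n * (((h + 1) % 2 : ℤ) : ℚ) / 2 - ((N1 - 1 + 2 * p : ℤ) - 2 * p) / 4)) *
        (qBinomMod n μ' * I N1 false h (p - n)) +
      (if Even h then qPow (((p : ℚ) - n) * N1 / 2) *
        (qBinomMod ((n : ℤ) - 1) μ * I N1 false h (p - n)) else 0) := by
    rw [mul_left_comm (qBinomMod _ _), qPow_mul_qPow_mul]
    by_cases hev : Even h
    · have ha : h % 2 = 0 := Int.even_iff.1 hev
      have hb : (h + 1) % 2 = 1 := by omega
      have hmm : μ' = μ - 1 := by rw [hμ, hμ']; unfold slots; omega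
      rw [if_pos hev, ha, hb, hmm]
      by_cases hneg : μ < 0
      · rw [hI.eq_zero_of_slots_neg hev hneg]; simp
      rw [qBinomMod_pascal n (not_lt.1 hneg), add_mul, mul_add]
      congr 1
      · rw [mul_assoc, qPow_mul_qPow_mul]
        congr 2; push_cast; ring
      · congr 2; push_cast; ring
    · have ha : h % 2 = 1 := Int.not_even_iff.1 hev
      have hb : (h + 1) % 2 = 0 := by omega
      have hmm : μ' = μ := by rw [hμ, hμ']; unfold slots; omega
      rw [if_neg hev, ha, hb, hmm, add_zero]
      congr 2; push_cast; ring
  have hlast : qPow (((p : ℚ) - n) * ((N1 - 1 + 2 * p + 1 : ℤ) - 2 * p) / 2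
        + n * ((h % 2 : ℤ) : ℚ) / 2 - ((N1 - 1 + 2 * p + 1 : ℤ) - 2 * p) / 4) =
      qPow (((p : ℚ) - n) * N1 / 2 + n * ((h % 2 : ℤ) : ℚ) / 2 - N1 / 4) := by
    congr 1; push_cast; ring
  rw [hD, qPow_mul_qPow_mul, leaveDown, mul_add (qBinomMod _ _),
    mul_add (qPow _) (qBinomMod _ _ * _), hmain, hlast, mul_sub (qBinomMod _ _),
    mul_sub (qPow _) (qBinomMod _ _ * _)]
  abel

end

section

variable {T s A c : ℤ} {x : Bool} {w : ℚ} {I : Family}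

/-- The counterpart for upward departures, with the roles of the letters exchanged: the Pascal rule
is applied to the paths that arrive by an ascent, and the peak split off is the peak part of
`insertDown` at the same vertex. -/
theorem insertUp_step (hI : IsArrival T (pointSource s x A c w) I) (hs : 0 ≤ s) (hc : 0 ≤ c)
    (N p : ℤ) {h : ℤ} (h2 : 2 ≤ h) (hT : h ≤ T) :
    insertUp s A I N h p = qPow ((N : ℚ) / 4) * insertUp s A I (N - 1) (h - 1) p
      + (if Even h then insertDown s A I N h p else 0)
      + if x = true then
          pointSource (s + 2 * c + 1) true (A + 1) c (w + c * s / 2 + s / 4) (N + 1) true (h + 1) p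
        else 0 := by
  have hsrc0 : N - 2 * p < 0 ∨ p < 0 →
      (if x = true then
          pointSource (s + 2 * c + 1) true (A + 1) c (w + c * s / 2 + s / 4) (N + 1) true (h + 1) p
        else 0) = 0 := by
    intro hh
    split_ifs
    · rw [pointSource, if_neg (by omega)]
    · rfl
  rcases lt_or_ge p 0 with hp | hp
  · rw [insertUp_peaks_neg hI hc _ _ hp, insertUp_peaks_neg hI hc _ _ hp,
      insertDown_peaks_neg hI hc _ _ hp, hsrc0 (Or.inr hp)]; simp
  rcases lt_or_ge (N - 2 * p) 0 with hN | hN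
  · rw [insertUp_of_neg hI hN, insertUp_of_neg hI (by omega), insertDown_of_neg hI hN,
      hsrc0 (Or.inl hN)]; simp
  obtain ⟨N1, rfl⟩ : ∃ N1, N = N1 + 2 * p := ⟨N - 2 * p, by ring⟩
  have e1 : N1 + 2 * p - 2 * p = N1 := by ring
  have e2 : N1 + 2 * p - 1 - 2 * p = N1 - 1 := by ring
  simp only [insertUp, insertDown, e1, e2]
  rw [e1] at hN
  set μ := slots s A N1 h with hμ
  set μ' := slots s A (N1 - 1) (h - 1) with hμ'
  have hU : ∀ n : ℕ, leaveUp I (N1 - 1) (h - 1) (p - n) =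
      I N1 true h (p - n) - pointSource s x A c w N1 true h (p - n) := by
    intro n; rw [hI.up _ _ _ hN h2 hT]; ring
  have hS := sum_source (x := x) (w := w) (A := A) (c := c) (s := s) (N1 := N1) (p := p) true h μ'
    (fun ha hb => by rw [hμ', ha, hb, slots_source_up])
    (fun n => (((N1 + 2 * p : ℤ) : ℚ) / 4) +
      (((p : ℚ) - n) * ((N1 + 2 * p - 1 : ℤ) - 2 * p) / 2 + n * (((h - 1) % 2 : ℤ) : ℚ) / 2))
  have hS' : (if x = true then pointSource (s + 2 * c + 1) true (A + 1) c
      (w + c * s / 2 + s / 4) (N1 + 2 * p + 1) true (h + 1) p else 0) =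
      if N1 = s ∧ true = x ∧ h = A ∧ p = c then qPow ((((N1 + 2 * p : ℤ) : ℚ) / 4) +
        (((p : ℚ) - (0 : ℕ)) * ((N1 + 2 * p - 1 : ℤ) - 2 * p) / 2
        + (0 : ℕ) * (((h - 1) % 2 : ℤ) : ℚ) / 2) + w) else 0 := by
    by_cases hx : x = true
    · rw [if_pos hx, pointSource]
      by_cases hh : N1 = s ∧ h = A ∧ p = c
      · obtain ⟨ha, hb, hcc⟩ := hh
        rw [if_pos ⟨by omega, rfl, by omega, hcc⟩, if_pos ⟨ha, hx.symm, hb, hcc⟩]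
        congr 1; subst ha hcc; push_cast; ring
      · rw [if_neg, if_neg (by tauto)]
        rintro ⟨ha, -, hb, hcc⟩
        exact hh ⟨by omega, by omega, hcc⟩
    · rw [if_neg hx, if_neg]
      rintro ⟨-, hb, -⟩
      exact hx hb.symm
  rw [hS', ← hS, Finset.mul_sum]
  have hshift := sum_range_shift (K := p.toNat + 1) (fun n : ℕ => if Even h then
      qPow (((p : ℚ) - n) * N1 / 2 + N1 / 4) *
        (qBinomMod ((n : ℤ) - 1) μ * I N1 true h (p - n)) else 0)
    (by simp [qBinomMod_of_neg])
    (by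
      have hz := hI.eq_zero_of_peaks_lt (c := c)
        (fun N x h p hN => pointSource_of_peaks_ne _ _ _ _ hN.ne _ _ _)
      have : I N1 true h (p - ((p.toNat + 1 : ℕ) : ℤ)) = 0 := hz _ _ _ _ (by push_cast; omega)
      simp only [this, mul_zero, ite_self])
  have hD : ∀ n : ℕ, (if Even h then
      qPow (((p : ℚ) - n) * ((N1 + 2 * p : ℤ) - 2 * p) / 2
        + n * ((h % 2 : ℤ) : ℚ) / 2 - ((N1 + 2 * p : ℤ) - 2 * p) / 4) *
        (qBinomMod n μ * leaveDown I N1 h (p - n)) else 0) =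
      (if Even h then qPow (((p : ℚ) - n) * N1 / 2) *
        (qBinomMod n μ * I N1 false h (p - n)) else 0) +
      (if Even h then qPow (((p : ℚ) - (n + 1 : ℕ)) * N1 / 2 + N1 / 4) *
        (qBinomMod (((n + 1 : ℕ) : ℤ) - 1) μ * I N1 true h (p - (n + 1 : ℕ))) else 0) := by
    intro n
    have eb : p - ((n + 1 : ℕ) : ℤ) = p - n - 1 := by push_cast; ring
    have ec : ((n + 1 : ℕ) : ℤ) - 1 = n := by push_cast; ring
    split_ifs with hev
    · have : h % 2 = 0 := Int.even_iff.1 hev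
      rw [this, leaveDown, eb, ec, mul_add (qBinomMod _ _), mul_add (qPow _) (qBinomMod _ _ * _)]
      congr 1
      · rw [mul_left_comm (qBinomMod _ _), qPow_mul_qPow_mul]
        congr 2; push_cast; ring
      · congr 2; push_cast; ring
    · simp
  have hpull : (if Even h then ∑ n ∈ Finset.range (p.toNat + 1),
      qPow (((p : ℚ) - n) * ((N1 + 2 * p : ℤ) - 2 * p) / 2
        + n * ((h % 2 : ℤ) : ℚ) / 2 - ((N1 + 2 * p : ℤ) - 2 * p) / 4) *
        (qBinomMod n μ * leaveDown I N1 h (p - n)) else 0) =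
      ∑ n ∈ Finset.range (p.toNat + 1), if Even h then
      qPow (((p : ℚ) - n) * ((N1 + 2 * p : ℤ) - 2 * p) / 2
        + n * ((h % 2 : ℤ) : ℚ) / 2 - ((N1 + 2 * p : ℤ) - 2 * p) / 4) *
        (qBinomMod n μ * leaveDown I N1 h (p - n)) else 0 := by
    split_ifs
    · rfl
    · simp
  rw [hpull, Finset.sum_congr rfl fun n _ => hD n, Finset.sum_add_distrib, hshift,
    ← Finset.sum_add_distrib, ← Finset.sum_add_distrib, ← Finset.sum_add_distrib]
  refine Finset.sum_congr rfl fun n _ => ?_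
  have hmain : qPow (((p : ℚ) - n) * ((N1 + 2 * p : ℤ) - 2 * p) / 2
        + n * ((h % 2 : ℤ) : ℚ) / 2) *
        (qBinomMod n μ * (qPow (N1 / 4) * I N1 true h (p - n))) =
      qPow (((N1 + 2 * p : ℤ) : ℚ) / 4 + (((p : ℚ) - n) * ((N1 + 2 * p - 1 : ℤ) - 2 * p) / 2
        + n * (((h - 1) % 2 : ℤ) : ℚ) / 2)) *
        (qBinomMod n μ' * I N1 true h (p - n)) +
      (if Even h then qPow (((p : ℚ) - n) * N1 / 2 + N1 / 4) *
        (qBinomMod ((n : ℤ) - 1) μ * I N1 true h (p - n)) else 0) := by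
    rw [mul_left_comm (qBinomMod _ _), qPow_mul_qPow_mul]
    by_cases hev : Even h
    · have ha : h % 2 = 0 := Int.even_iff.1 hev
      have hb : (h - 1) % 2 = 1 := by omega
      have hmm : μ' = μ - 1 := by rw [hμ, hμ']; unfold slots; omega
      rw [if_pos hev, ha, hb, hmm]
      by_cases hneg : μ < 0
      · rw [hI.eq_zero_of_slots_neg hev hneg]; simp
      rw [qBinomMod_pascal n (not_lt.1 hneg), add_mul, mul_add]
      congr 1
      · rw [mul_assoc, qPow_mul_qPow_mul]
        congr 2; push_cast; ring
      · congr 2; push_cast; ring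
    · have ha : h % 2 = 1 := Int.not_even_iff.1 hev
      have hb : (h - 1) % 2 = 0 := by omega
      have hmm : μ' = μ := by rw [hμ, hμ']; unfold slots; omega
      rw [if_neg hev, ha, hb, hmm, add_zero]
      congr 2; push_cast; ring
  have hlast : qPow (((p : ℚ) - n) * ((N1 + 2 * p : ℤ) - 2 * p) / 2
        + n * ((h % 2 : ℤ) : ℚ) / 2) *
        (qBinomMod n μ * if Even h then I N1 false h (p - n) else 0) =
      if Even h then qPow (((p : ℚ) - n) * N1 / 2) *
        (qBinomMod n μ * I N1 false h (p - n)) else 0 := by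
    split_ifs with hev
    · have : h % 2 = 0 := Int.even_iff.1 hev
      rw [this]; congr 2; push_cast; ring
    · simp
  rw [hU, qPow_mul_qPow_mul, leaveUp, mul_add (qBinomMod _ _),
    mul_add (qPow _) (qBinomMod _ _ * _), hmain, hlast, mul_sub (qBinomMod _ _),
    mul_sub (qPow _) (qBinomMod _ _ * _)]
  abel

/-! ### Enlarging the strip by one -/

/-- The source of the enlarged paths. -/
noncomputable def liftSource (s : ℤ) (x : Bool) (A c : ℤ) (w : ℚ) : Family :=
  if x = true then pointSource (s + 2 * c + 1) true (A + 1) c (w + c * s / 2 + s / 4)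
  else pointSource (s + 2 * c) false A c (w + c * s / 2)

theorem liftSource_false (s : ℤ) (x : Bool) (A c : ℤ) (w : ℚ) (N h p : ℤ) :
    liftSource s x A c w N false h p = if x = false then
      pointSource (s + 2 * c) false A c (w + c * s / 2) N false h p else 0 := by
  cases x <;> simp [liftSource, pointSource]

theorem liftSource_true (s : ℤ) (x : Bool) (A c : ℤ) (w : ℚ) (N h p : ℤ) :
    liftSource s x A c w N true h p = if x = true then
      pointSource (s + 2 * c + 1) true (A + 1) c (w + c * s / 2 + s / 4) N true h p else 0 := by
  cases x <;> simp [liftSource, pointSource]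

/-- Enlarging the strip by one: every path of the larger strip is obtained by inserting peaks into
a path of the smaller one. -/
theorem arrival_eq_insert {J : Family} (hI : IsArrival T (pointSource s x A c w) I) (hs : 0 ≤ s)
    (hc : 0 ≤ c) (hA : 2 ≤ A) (hAT : A ≤ T)
    (hJ : IsArrival (T + 1) (liftSource s x A c w) J) (N : ℤ) :
    (∀ h p, J N false h p = insertDown s A I N h p) ∧
    (∀ h p, J (N + 1) true (h + 1) p = insertUp s A I N h p) := by
  have hnegD : ∀ N : ℤ, N < 0 → ∀ h p, insertDown s A I N h p = 0 := by
    intro N hN h p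
    rcases lt_or_ge p 0 with hp | hp
    · exact insertDown_peaks_neg hI hc _ _ hp
    · exact insertDown_of_neg hI (by omega) _
  have hnegU : ∀ N : ℤ, N < 0 → ∀ h p, insertUp s A I N h p = 0 := by
    intro N hN h p
    rcases lt_or_ge p 0 with hp | hp
    · exact insertUp_peaks_neg hI hc _ _ hp
    · exact insertUp_of_neg hI (by omega) _
  -- the downward claim at `N`, from the claims at earlier times
  have keyD : ∀ N : ℤ, 0 ≤ N →
      (∀ h p, J (N - 1) false h p = insertDown s A I (N - 1) h p) →
      (∀ h p, J (N - 1) true (h + 1) p = insertUp s A I (N - 2) h p) →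
      ∀ h p, J N false h p = insertDown s A I N h p := by
    intro N hN h1 h3 h p
    by_cases hh : 2 ≤ h ∧ h ≤ T
    · have e := insertDown_succ hI hs hc (N - 1) p hh.1 hh.2
      rw [sub_add_cancel, show N - 1 - 1 = N - 2 by ring] at e
      rw [e, hJ.down _ _ _ hN hh.1 (by omega), liftSource_false, leaveDown, h1, h3]
      ring
    · rw [insertDown_out hI hh]
      by_cases hh' : 2 ≤ h ∧ h ≤ T + 1
      · have hne : h ≠ A := by omega
        rw [hJ.down _ _ _ hN hh'.1 hh'.2, liftSource_false, pointSource_of_height_ne _ _ _ _ hne,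
          hJ.leaveDown_out (by omega)]
        simp
      · exact hJ.out _ _ _ _ hh'
  have keyU : ∀ N : ℤ, 0 ≤ N →
      (∀ h p, J N false h p = insertDown s A I N h p) →
      (∀ h p, J N true (h + 1) p = insertUp s A I (N - 1) h p) →
      ∀ h p, J (N + 1) true (h + 1) p = insertUp s A I N h p := by
    intro N hN h1 h3 h p
    by_cases hh : 2 ≤ h ∧ h ≤ T
    · have h3' := h3 (h - 1) p
      rw [sub_add_cancel] at h3'
      rw [insertUp_step hI hs hc N p hh.1 hh.2, hJ.up _ _ _ (by omega) (by omega) (by omega),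
        liftSource_true, leaveUp, add_sub_cancel_right, add_sub_cancel_right, h1, h3']
      ring
    · rw [insertUp_out hI hh]
      by_cases hh' : 2 ≤ h + 1 ∧ h + 1 ≤ T + 1
      · have hne : h + 1 ≠ A + 1 := by omega
        rw [hJ.up _ _ _ (by omega) hh'.1 hh'.2, liftSource_true,
          pointSource_of_height_ne _ _ _ _ hne, add_sub_cancel_right, hJ.leaveUp_out (by omega)]
        simp
      · exact hJ.out _ _ _ _ hh'
  have base : ∀ N : ℤ, N < 0 → (∀ h p, J N false h p = insertDown s A I N h p) ∧
      (∀ h p, J N true (h + 1) p = insertUp s A I (N - 1) h p) := by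
    intro N hN
    exact ⟨fun h p => by rw [hJ.neg _ _ _ _ hN, hnegD _ hN],
      fun h p => by rw [hJ.neg _ _ _ _ hN, hnegU _ (by omega)]⟩
  -- The upward claim is carried at two consecutive times: the downward claim at `n` uses the upward
  -- one at `n - 1`, and the upward claim at `n + 1` uses both claims at `n`.
  have hind : ∀ n : ℕ, (∀ h p, J ((n : ℤ) - 1) false h p = insertDown s A I ((n : ℤ) - 1) h p) ∧
      (∀ h p, J ((n : ℤ) - 1) true (h + 1) p = insertUp s A I ((n : ℤ) - 1 - 1) h p) ∧
      (∀ h p, J (n : ℤ) true (h + 1) p = insertUp s A I ((n : ℤ) - 1) h p) := by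
    intro n
    induction n with
    | zero =>
      refine ⟨(base _ (by simp)).1, (base _ (by simp)).2, fun h p => ?_⟩
      rw [hnegU _ (by simp), Nat.cast_zero]
      by_cases hh : 2 ≤ h + 1 ∧ h + 1 ≤ T + 1
      · rw [hJ.up _ _ _ le_rfl hh.1 hh.2, hJ.leaveUp_neg (by simp), liftSource_true, add_zero]
        split_ifs
        · rw [pointSource, if_neg (by omega)]
        · rfl
      · exact hJ.out _ _ _ _ hh
    | succ n ih =>
      obtain ⟨i1, i2, i3⟩ := ih
      have e : ((n + 1 : ℕ) : ℤ) - 1 = n := by push_cast; ring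
      rw [e]
      have d := keyD n (by omega) i1 (by simpa [sub_sub] using i2)
      exact ⟨d, i3, by simpa using keyU n (by omega) d i3⟩
  rcases lt_or_ge N 0 with hN | hN
  · refine ⟨(base N hN).1, fun h p => ?_⟩
    rw [hnegU _ hN]
    rcases lt_or_ge (N + 1) 0 with hN' | hN'
    · exact hJ.neg _ _ _ _ hN'
    · have : N + 1 = 0 := by omega
      have h0 := (hind 0).2.2 h p
      rw [hnegU _ (by simp)] at h0
      rw [this]; exact_mod_cast h0
  · obtain ⟨n, rfl⟩ := Int.eq_ofNat_of_zero_le hN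
    have := hind (n + 1)
    have e : ((n + 1 : ℕ) : ℤ) - 1 = n := by push_cast; ring
    rw [e] at this
    exact ⟨this.1, by simpa using this.2.2⟩

end

/-! ### Forced first steps and relations between consecutive strips -/

section

variable {T s A c : ℤ} {x : Bool} {w : ℚ} {I : Family}

theorem IsArrival.at_source (hI : IsArrival T (pointSource s x A c w) I) (hs : 0 ≤ s) (hA : 2 ≤ A)
    (hAT : A ≤ T) (y : Bool) (h p : ℤ) : I s y h p = pointSource s x A c w s y h p := by
  have hz := hI.eq_zero_of_lt (s := s) (fun N x h p hN => pointSource_of_lt _ _ _ _ hN _ _ _)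
  by_cases hh : 2 ≤ h ∧ h ≤ T
  · cases y
    · rw [hI.down _ _ _ hs hh.1 hh.2, leaveDown, hz _ _ _ _ (by omega), hz _ _ _ _ (by omega)]
      simp
    · rw [hI.up _ _ _ hs hh.1 hh.2, leaveUp, hz _ _ _ _ (by omega), hz _ _ _ _ (by omega)]
      simp
  · rw [hI.out _ _ _ _ hh, pointSource_of_height_ne _ _ _ _ (by omega)]

theorem IsArrival.congr {S S' : Family} (hI : IsArrival T S I) (h : S = S') : IsArrival T S' I :=
  h ▸ hI

theorem IsArrival.unique {S J : Family} (hI : IsArrival T S I) (hJ : IsArrival T S J)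
    (N : ℤ) (y : Bool) (h p : ℤ) : I N y h p = J N y h p := by
  rcases lt_or_ge N 0 with h0 | h0
  · rw [hI.neg _ _ _ _ h0, hJ.neg _ _ _ _ h0]
  obtain ⟨n, rfl⟩ := Int.eq_ofNat_of_zero_le h0
  induction n generalizing y h p with
  | zero =>
    by_cases hh : 2 ≤ h ∧ h ≤ T
    · cases y
      · rw [hI.down _ _ _ h0 hh.1 hh.2, hJ.down _ _ _ h0 hh.1 hh.2, hI.leaveDown_neg (by simp),
          hJ.leaveDown_neg (by simp)]
      · rw [hI.up _ _ _ h0 hh.1 hh.2, hJ.up _ _ _ h0 hh.1 hh.2, hI.leaveUp_neg (by simp),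
          hJ.leaveUp_neg (by simp)]
    · rw [hI.out _ _ _ _ hh, hJ.out _ _ _ _ hh]
  | succ n ih =>
    have e : ((n + 1 : ℕ) : ℤ) - 1 = n := by push_cast; ring
    have ih' := fun x h p => ih x h p (by omega)
    by_cases hh : 2 ≤ h ∧ h ≤ T
    · cases y
      · rw [hI.down _ _ _ h0 hh.1 hh.2, hJ.down _ _ _ h0 hh.1 hh.2, e]
        simp only [leaveDown, ih']
      · rw [hI.up _ _ _ h0 hh.1 hh.2, hJ.up _ _ _ h0 hh.1 hh.2, e]
        simp only [leaveUp, ih']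
    · rw [hI.out _ _ _ _ hh, hJ.out _ _ _ _ hh]

/-- On the ceiling an ascending path must turn. The turn is a peak, hence not straight and without
weight. -/
theorem IsArrival.after_source_top (hI : IsArrival T (pointSource s true T c w) I) (hs : 0 ≤ s)
    (hT : 3 ≤ T) (y : Bool) (h p : ℤ) :
    I (s + 1) y h p = pointSource (s + 1) false (T - 1) (c + 1) w (s + 1) y h p := by
  have h0 := hI.at_source hs (by omega) le_rfl
  by_cases hh : 2 ≤ h ∧ h ≤ T
  · cases y
    · rw [hI.down _ _ _ (by omega) hh.1 hh.2, pointSource_of_gt _ _ _ _ (by omega),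
        add_sub_cancel_right, leaveDown, h0, h0]
      have : (h + 1 = T ∧ p - 1 = c) ↔ (h = T - 1 ∧ p = c + 1) := by omega
      simp [pointSource, this]
    · rw [hI.up _ _ _ (by omega) hh.1 hh.2, pointSource_of_gt _ _ _ _ (by omega),
        add_sub_cancel_right, leaveUp, h0, h0, pointSource_of_height_ne _ _ _ _ (by omega),
        pointSource_of_height_ne _ _ _ _ (by omega)]
      simp [pointSource]
  · rw [hI.out _ _ _ _ hh, pointSource_of_height_ne _ _ _ _ (by omega)]

/-- The fictitious descending letter at height `2`, which is even, makes the forced ascent a valley;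
no weight arises. -/
theorem IsArrival.after_source_bottom (hI : IsArrival T (pointSource 0 false 2 0 0) I)
    (hT : 3 ≤ T) (y : Bool) (h p : ℤ) : I 1 y h p = pointSource 1 true 3 0 0 1 y h p := by
  have h0 := hI.at_source le_rfl le_rfl (by omega)
  by_cases hh : 2 ≤ h ∧ h ≤ T
  · cases y
    · rw [hI.down _ _ _ (by norm_num) hh.1 hh.2, pointSource_of_gt _ _ _ _ (by norm_num), sub_self,
        leaveDown, h0, h0, pointSource_of_height_ne _ _ _ _ (by omega),
        pointSource_of_height_ne _ _ _ _ (by omega)]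
      simp [pointSource]
    · rw [hI.up _ _ _ (by norm_num) hh.1 hh.2, pointSource_of_gt _ _ _ _ (by norm_num), sub_self,
        leaveUp, h0, h0]
      by_cases h3 : h = 3
      · subst h3
        simp [pointSource]
      · have : h - 1 ≠ 2 := by omega
        simp [pointSource, h3, this]
  · rw [hI.out _ _ _ _ hh, pointSource_of_height_ne _ _ _ _ (by omega)]

/-- The relations between the paths `J` of a strip and the paths `I` of the strip that is smaller by
one, from time `τ` on. -/
structure Enlarges (T τ s A : ℤ) (I J : Family) : Prop where
  up : ∀ N h p, τ ≤ N → 2 ≤ h → h ≤ T → leaveUp J N h p = insertUp s A I N h p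
  down : ∀ N h p, τ ≤ N → 2 ≤ h → h ≤ T →
    leaveDown J N (h + 1) p = insertDown s A I (N + 1) h p
  top : ∀ N p, τ ≤ N → 2 ≤ T → leaveUp J N T p = insertDown s A I (N + 2) T (p + 1)

/-- Once the lifted source has passed, the recursions for `insertUp` and `insertDown` lose their
source terms and express departures of the larger strip. The family `J` may start differently from
the lifted family `K`; only agreement from `τ` on matters. On the ceiling of the smaller strip, an
upward departure goes to `T + 1` and is forced back two steps later with one more peak. -/
theorem enlarges_of_agree {J K : Family} {τ : ℤ} (hI : IsArrival T (pointSource s x A c w) I)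
    (hs : 0 ≤ s) (hc : 0 ≤ c) (hA : 2 ≤ A) (hAT : A ≤ T)
    (hK : IsArrival (T + 1) (liftSource s x A c w) K)
    (hτ : s + 2 * c ≤ τ) (hτ' : x = true → s + 2 * c + 1 ≤ τ)
    (hJ : ∀ N y h p, τ ≤ N → J N y h p = K N y h p) : Enlarges T τ s A I J := by
  have hD := fun N => (arrival_eq_insert hI hs hc hA hAT hK N).1
  have hU := fun N => (arrival_eq_insert hI hs hc hA hAT hK N).2
  have hU' : ∀ N h p, K N true h p = insertUp s A I (N - 1) (h - 1) p := by
    intro N h p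
    have := hU (N - 1) (h - 1) p
    rwa [sub_add_cancel, sub_add_cancel] at this
  have srcD : ∀ N h p, τ ≤ N →
      (if x = false then pointSource (s + 2 * c) false A c (w + c * s / 2) (N + 1) false h p
        else 0) = 0 := by
    intro N h p hN
    split_ifs
    · exact pointSource_of_gt _ _ _ _ (by omega) _ _ _
    · rfl
  have up : ∀ N h p, τ ≤ N → 2 ≤ h → h ≤ T → leaveUp J N h p = insertUp s A I N h p := by
    intro N h p hN h2 hT
    have hsrc : (if x = true then pointSource (s + 2 * c + 1) true (A + 1) c
        (w + c * s / 2 + s / 4) (N + 1) true (h + 1) p else 0) = 0 := by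
      split_ifs with hx
      · have := hτ' hx
        exact pointSource_of_gt _ _ _ _ (by omega) _ _ _
      · rfl
    rw [insertUp_step hI hs hc _ _ h2 hT, hsrc, add_zero, leaveUp, hJ _ _ _ _ hN, hJ _ _ _ _ hN,
      hD, hU']
  refine ⟨up, ?_, ?_⟩
  · intro N h p hN h2 hT
    rw [insertDown_succ hI hs hc _ _ h2 hT, srcD _ _ _ hN, add_zero, leaveDown, hJ _ _ _ _ hN,
      hJ _ _ _ _ hN, hD, hU', add_sub_cancel_right]
  · intro N p hN h2
    have e := insertDown_succ hI hs hc (N + 1) (p + 1) h2 le_rfl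
    rw [srcD _ _ _ (by omega), insertDown_out hI (h := T + 1) (by omega), mul_zero, zero_add,
      add_zero, add_sub_cancel_right, add_sub_cancel_right, show N + 1 + 1 = N + 2 by ring] at e
    rw [e, up N T p hN h2 le_rfl]

end

/-! ### Extension of paths to the floor and one reduction -/

/-- The starting point, in a path extended to the left down to height `2`, of the paths that start
at `A` after an ascending (`e = true`) or descending edge. -/
noncomputable def leftSource (T : ℤ) (e : Bool) (A : ℤ) : Family :=
  if e = false ∧ A < T then
    pointSource (2 * T - 2 - A) false A 1
      (((T - 3) * (T - 2) + (2 * T - 3 - A) * (2 * T - 2 - A) - (T - 2) * (T - 1)) / 8)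
  else if 3 ≤ A then pointSource (A - 2) true A 0 ((A - 3) * (A - 2) / 8)
  else pointSource 0 false 2 0 0

/-- The length of the extension of a path beyond its end point `A`. -/
def sideTime (T : ℤ) (e : Bool) (A : ℤ) : ℤ := if e = true then A - 2 else 2 * T - 2 - A

/-- The height of the end point after the reduction of the strip `[2, T]` to `[2, T - 1]`. -/
def nextHeight (T : ℤ) (e : Bool) (A : ℤ) : ℤ := if e = true then max (A - 1) 2 else min A (T - 1)

/-- An extension that stops on the ceiling has no descending part, so both kinds of edge lead to the
same ascending extension. -/
theorem leftSource_top (T : ℤ) : leftSource T false T = leftSource T true T := by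
  simp [leftSource]

/-- An ascending initial segment gains one step when the first peak is raised, so the start at `A`
is the lift of the start at `A - 1`, unless `A - 1` has already met the floor. -/
theorem enlarges_left_of_true {T A : ℤ} (hA : 2 ≤ A) (hAT : A ≤ T + 1)
    (hT : 2 ≤ T) {I J : Family} (hI : IsArrival T (leftSource T true (max (A - 1) 2)) I)
    (hJ : IsArrival (T + 1) (leftSource (T + 1) true A) J) :
    Enlarges T (A - 2) (max (A - 1) 2 - 2) (max (A - 1) 2) I J := by
  rcases lt_or_ge A 4 with h4 | h4
  · have hm : max (A - 1) 2 = 2 := by omega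
    rw [hm] at hI ⊢
    replace hI := hI.congr (S' := pointSource (2 - 2) false 2 0 0) (by simp [leftSource])
    set K := arrival (T + 1) (liftSource (2 - 2) false 2 0 0)
    have hK : IsArrival (T + 1) (liftSource (2 - 2) false 2 0 0) K := isArrival_arrival _ _
    have hK' : IsArrival (T + 1) (pointSource 0 false 2 0 0) K :=
      hK.congr (by simp [liftSource])
    refine enlarges_of_agree hI le_rfl le_rfl le_rfl hT hK (by omega) (by simp) ?_
    -- Both heights reduce to `2`. For `A = 3` the source is the forced first step of the path from
    -- the floor.
    obtain rfl | rfl : A = 2 ∨ A = 3 := by omega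
    · intro N y h p _
      exact (hJ.congr (by simp [leftSource])).unique hK' _ _ _ _
    · replace hJ := hJ.congr (S' := pointSource 1 true 3 0 0) (by simp [leftSource])
      have hJ1 := hJ.at_source (by norm_num) (by norm_num) hAT
      intro N y h p hN
      refine hJ.eq_of_eq hK' (s := 1) (by norm_num)
        (fun N x h p hN => pointSource_of_gt _ _ _ _ hN _ _ _)
        (fun N x h p hN => pointSource_of_gt _ _ _ _ (by omega) _ _ _) ?_ N (by omega) _ _ _
      intro y h p
      rw [hJ1, hK'.after_source_bottom (by omega)]
  · have hm : max (A - 1) 2 = A - 1 := by omega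
    rw [hm] at hI ⊢
    have e1 : leftSource T true (A - 1) =
        pointSource (A - 1 - 2) true (A - 1) 0 (((A - 1 : ℤ) - 3) * ((A - 1 : ℤ) - 2) / 8) := by
      rw [leftSource, if_neg (by simp), if_pos (by omega)]
    have e2 : leftSource (T + 1) true A =
        liftSource (A - 1 - 2) true (A - 1) 0 (((A - 1 : ℤ) - 3) * ((A - 1 : ℤ) - 2) / 8) := by
      rw [leftSource, if_neg (by simp), if_pos (by omega), liftSource, if_pos rfl]
      congr 1
      · ring
      · ring
      · push_cast; ring
    refine enlarges_of_agree (hI.congr e1) (by omega) le_rfl (by omega) (by omega) (hJ.congr e2)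
      (by omega) (by omega) (fun _ _ _ _ _ => rfl)

/-- For a descending edge the extension touches the ceiling. Raising the ceiling adds two steps and
leaves the point `A` in place, as long as `A` still lies below the ceiling of the smaller strip. -/
theorem enlarges_left {T A : ℤ} (e : Bool) (hA : 2 ≤ A) (hAT : A ≤ T + 1)
    (hT : 2 ≤ T) {I J : Family}
    (hI : IsArrival T (leftSource T e (nextHeight (T + 1) e A)) I)
    (hJ : IsArrival (T + 1) (leftSource (T + 1) e A) J) :
    Enlarges T (sideTime (T + 1) e A) (sideTime T e (nextHeight (T + 1) e A))
      (nextHeight (T + 1) e A) I J := by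
  cases e
  swap
  · exact enlarges_left_of_true hA hAT hT hI hJ
  simp only [nextHeight, sideTime, Bool.false_eq_true, if_false, add_sub_cancel_right] at *
  rcases lt_trichotomy A T with h | h | h
  · rw [min_eq_left h.le] at hI ⊢
    have e1 : leftSource T false A = pointSource (2 * T - 2 - A) false A 1
      (((T - 3) * (T - 2) + (2 * T - 3 - A) * (2 * T - 2 - A) - (T - 2) * (T - 1)) / 8) := by
      rw [leftSource, if_pos ⟨rfl, h⟩]
    have e2 : leftSource (T + 1) false A = liftSource (2 * T - 2 - A) false A 1
      (((T - 3) * (T - 2) + (2 * T - 3 - A) * (2 * T - 2 - A) - (T - 2) * (T - 1)) / 8) := by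
      rw [leftSource, if_pos ⟨rfl, by omega⟩, liftSource, if_neg (by simp)]
      congr 1
      · ring
      · push_cast; ring
    exact enlarges_of_agree (hI.congr e1) (by omega) (by omega) hA h.le (hJ.congr e2) (by omega)
      (by simp) (fun _ _ _ _ _ => rfl)
  -- Here the reduced point is on the ceiling, so its extension is purely ascending. The lift ends
  -- on the new ceiling `A + 1` at time `A - 1`; the forced descent then gives the required source
  -- at `(A, A)` with one peak.
  · subst h
    rw [min_self] at hI ⊢
    rw [leftSource_top] at hI
    have hJ' := hJ.congr (S' := pointSource A false A 1 ((A - 2) * (A - 1) / 8)) (by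
      rw [leftSource, if_pos ⟨rfl, by omega⟩]
      congr 1
      · ring
      · push_cast; ring)
    have hJ1 := hJ'.at_source (by omega) (by omega) (by omega)
    rcases lt_or_ge A 3 with h3 | h3
    · obtain rfl : A = 2 := by omega
      replace hI := hI.congr (S' := pointSource (2 * 2 - 2 - 2) false 2 0 0)
        (by simp [leftSource])
      set K := arrival (2 + 1) (liftSource (2 * 2 - 2 - 2) false 2 0 0)
      have hK : IsArrival (2 + 1) (liftSource (2 * 2 - 2 - 2) false 2 0 0) K :=
        isArrival_arrival _ _
      have hK' : IsArrival (2 + 1) (pointSource 0 false 2 0 0) K :=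
        hK.congr (by simp [liftSource])
      refine enlarges_of_agree hI le_rfl le_rfl le_rfl hT hK (by omega) (by simp) ?_
      intro N y h p hN
      refine hJ'.eq_of_eq hK' (s := 2) (by norm_num)
        (fun N x h p hN => pointSource_of_gt _ _ _ _ hN _ _ _)
        (fun N x h p hN => pointSource_of_gt _ _ _ _ (by omega) _ _ _) ?_ N (by omega) _ _ _
      have hK2 : IsArrival (2 + 1) (pointSource 1 true (2 + 1) 0 0)
          (arrival (2 + 1) (pointSource 1 true (2 + 1) 0 0)) := isArrival_arrival _ _
      have hK1 : ∀ y h p, K 2 y h p = arrival (2 + 1) (pointSource 1 true (2 + 1) 0 0) 2 y h p :=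
        hK'.eq_of_eq hK2 (s := 1) (by norm_num)
          (fun N x h p hN => pointSource_of_gt _ _ _ _ (by omega) _ _ _)
          (fun N x h p hN => pointSource_of_gt _ _ _ _ hN _ _ _)
          (fun y h p => by
            rw [hK'.after_source_bottom (by norm_num),
              hK2.at_source (by norm_num) (by norm_num) (by norm_num)]
            norm_num) 2 (by norm_num)
      intro y h p
      have := hK2.after_source_top (by norm_num) (by norm_num) y h p
      rw [hJ1, hK1]
      norm_num at this ⊢
      exact this.symm
    · replace hI := hI.congr
        (S' := pointSource (2 * A - 2 - A) true A 0 ((A - 3) * (A - 2) / 8)) (by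
        rw [leftSource, if_neg (by simp), if_pos h3]
        congr 1; ring)
      set K := arrival (A + 1) (liftSource (2 * A - 2 - A) true A 0 ((A - 3) * (A - 2) / 8))
      have hK : IsArrival (A + 1)
        (liftSource (2 * A - 2 - A) true A 0 ((A - 3) * (A - 2) / 8)) K := isArrival_arrival _ _
      have hK' : IsArrival (A + 1) (pointSource (A - 1) true (A + 1) 0 ((A - 2) * (A - 1) / 8)) K :=
        hK.congr (by
          rw [liftSource, if_pos rfl]
          congr 1
          · ring
          · push_cast; ring)
      refine enlarges_of_agree hI (by omega) le_rfl hA le_rfl hK (by omega) (by omega) ?_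
      intro N y h p hN
      refine hJ'.eq_of_eq hK' (s := A) (by omega)
        (fun N x h p hN => pointSource_of_gt _ _ _ _ hN _ _ _)
        (fun N x h p hN => pointSource_of_gt _ _ _ _ (by omega) _ _ _) ?_ N (by omega) _ _ _
      intro y h p
      have := hK'.after_source_top (by omega) (by omega) y h p
      rw [sub_add_cancel, add_sub_cancel_right, zero_add] at this
      rw [hJ1, this]
  · obtain rfl : A = T + 1 := by omega
    rw [min_eq_right (by omega)] at hI ⊢
    rw [leftSource_top] at hI hJ
    have hm : max (T + 1 - 1) 2 = T := by omega
    have := enlarges_left_of_true (T := T) (A := T + 1) hA hAT hT (by rw [hm]; exact hI) hJ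
    rw [hm] at this
    convert this using 1 <;> ring

/-- Paths of the strip `[2, T]` extended on both sides to paths from height `2` to height `2`, by
total length and number of peaks. -/
noncomputable def extendedGF (T : ℤ) (e : Bool) (A : ℤ) (f : Bool) (B M p : ℤ) :
    HahnSeries ℚ ℚ :=
  if f = false ∧ B < T then
    qPow (((2 * T - B - 4) * (M - (2 * T - 2 - B)) + (2 * T - B - 3) * (2 * T - B - 2) / 2
      - (T - B)) / 4) *
      leaveUp (arrival T (leftSource T e A)) (M - (2 * T - 2 - B)) B (p - 1)
  else qPow (((B - 3) * (M - (B - 2)) + (B - 3) * (B - 2) / 2) / 4) *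
      leaveDown (arrival T (leftSource T e A)) (M - (B - 2)) B p

theorem sideTime_false (T A : ℤ) : sideTime T false A = 2 * T - 2 - A := rfl

theorem sideTime_true (T A : ℤ) : sideTime T true A = A - 2 := rfl

theorem leftSource_eq_pointSource (T : ℤ) (e : Bool) {A : ℤ} (hA : 2 ≤ A) (hAT : A ≤ T) :
    ∃ x c w, leftSource T e A = pointSource (sideTime T e A) x A c w ∧ 0 ≤ c := by
  unfold leftSource
  split_ifs with h1 h2
  · rw [h1.1, sideTime_false]
    exact ⟨_, _, _, rfl, by norm_num⟩
  · refine ⟨true, 0, (A - 3) * (A - 2) / 8, ?_, le_rfl⟩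
    congr 1
    cases e
    · rw [sideTime_false]; simp only [true_and, not_lt] at h1; omega
    · rfl
  · obtain rfl : A = 2 := by omega
    refine ⟨false, 0, 0, ?_, le_rfl⟩
    congr 1
    cases e
    · rw [sideTime_false]; simp only [true_and, not_lt] at h1; omega
    · rfl

theorem sideTime_nonneg (T : ℤ) (e : Bool) {A : ℤ} (hA : 2 ≤ A) (hAT : A ≤ T) :
    0 ≤ sideTime T e A := by
  cases e
  · rw [sideTime_false]; omega
  · rw [sideTime_true]; omega

theorem nextHeight_ge {T : ℤ} (e : Bool) {A : ℤ} (hA : 2 ≤ A) (hT : 3 ≤ T) :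
    2 ≤ nextHeight T e A := by
  unfold nextHeight; split_ifs <;> omega

theorem nextHeight_le {T : ℤ} (e : Bool) {A : ℤ} (hAT : A ≤ T) (hT : 3 ≤ T) :
    nextHeight T e A ≤ T - 1 := by
  unfold nextHeight; split_ifs <;> omega

/-- No edge ascends to the floor, so every arrival at `2` is a descent. Leaving downwards is only
formal there, and differs from leaving upwards by the weight of a straight vertex. -/
theorem IsArrival.leaveDown_two {T : ℤ} {e : Bool} {A : ℤ} {I : Family}
    (hI : IsArrival T (leftSource T e A) I) (N p : ℤ) :
    leaveDown I N 2 p = qPow ((N : ℚ) / 4) * leaveUp I N 2 p := by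
  have hz : ∀ p, I N true 2 p = 0 := by
    intro p
    by_cases hT : 2 ≤ T
    · rcases lt_or_ge N 0 with hN | hN
      · exact hI.neg _ _ _ _ hN
      rw [hI.up _ _ _ hN le_rfl hT, hI.leaveUp_out (by omega), add_zero]
      unfold leftSource
      split_ifs with h1 h2
      · simp [pointSource]
      · exact pointSource_of_height_ne _ _ _ _ (by omega) _ _ _
      · simp [pointSource]
    · exact hI.out _ _ _ _ (by omega)
  simp [leaveDown, leaveUp, hz]

/-- Removal of the smallest peaks. -/
theorem extendedGF_step {T : ℤ} (hT : 3 ≤ T) (e f : Bool) {A B M : ℤ} (hA : 2 ≤ A) (hAT : A ≤ T)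
    (hB : 2 ≤ B) (hBT : B ≤ T) (hM : sideTime T e A + sideTime T f B ≤ M) (p : ℤ) :
    extendedGF T e A f B M p = ∑ n ∈ Finset.range (p.toNat + 1),
      qPow (((p : ℚ) - n) * (M - 2 * p) / 2 + n * ((sideTime (T - 1) f (nextHeight T f B)
        + nextHeight T f B % 2 : ℤ) : ℚ) / 2) *
      (qBinomMod n ((M - 2 * p - sideTime (T - 1) e (nextHeight T e A)
          - sideTime (T - 1) f (nextHeight T f B) - nextHeight T e A % 2
          - nextHeight T f B % 2) / 2) *
        extendedGF (T - 1) e (nextHeight T e A) f (nextHeight T f B) (M - 2 * p) (p - n)) := by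
  obtain ⟨T, rfl⟩ : ∃ T', T = T' + 1 := ⟨T - 1, by ring⟩
  have hA1 := nextHeight_ge e hA hT
  have hA2 := nextHeight_le e hAT hT
  rw [add_sub_cancel_right] at *
  set A' := nextHeight (T + 1) e A with hA'
  have hIs := isArrival_arrival T (leftSource T e A')
  have hJs := isArrival_arrival (T + 1) (leftSource (T + 1) e A)
  have E := enlarges_left e hA hAT (by omega) hIs hJs
  rw [← hA'] at E
  obtain ⟨x, c, w, hsrc, hc⟩ := leftSource_eq_pointSource T e hA1 hA2
  have hI := hIs.congr hsrc
  have hs := sideTime_nonneg T e hA1 hA2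
  set s := sideTime T e A' with hs'
  set I := arrival T (leftSource T e A') with hIdef
  set J := arrival (T + 1) (leftSource (T + 1) e A) with hJdef
  by_cases hdown : f = false ∧ B < T + 1
  · obtain ⟨rfl, hB1⟩ := hdown
    rw [sideTime_false] at hM
    have hB' : nextHeight (T + 1) false B = B := by simp [nextHeight]; omega
    rw [hB', sideTime_false]
    rcases (Int.lt_add_one_iff.1 hB1).lt_or_eq with hlt | rfl
    · simp only [extendedGF, hB1, hlt, true_and, if_true]
      rw [← hJdef, E.up _ _ _ (by omega) hB (by omega),
        insertUp_eq hI hc _ _ _ (K := p.toNat + 1) (by omega), Finset.mul_sum]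
      refine Finset.sum_congr rfl fun n _ => ?_
      have e1 : M - (2 * (T + 1) - 2 - B) - 2 * (p - 1) = M - 2 * p - (2 * T - 2 - B) := by ring
      have e2 : p - n - 1 = p - 1 - (n : ℤ) := by ring
      rw [e1, e2, qPow_mul_qPow_mul, mul_left_comm (qBinomMod _ _), qPow_mul_qPow_mul]
      congr 1
      · congr 1; push_cast; ring
      · congr 2
        unfold slots; congr 1; ring
    -- The end point is the ceiling of the smaller strip. The ascent to `B + 1` and the forced
    -- return are absorbed into a downward arrival, and the reduced extension only descends.
    · simp only [extendedGF, hB1, true_and, if_true, lt_irrefl, and_false, if_false]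
      rw [← hJdef, E.top _ _ (by omega) hB, insertDown, sub_add_cancel, Finset.mul_sum]
      refine Finset.sum_congr rfl fun n _ => ?_
      have e1 : M - (2 * (B + 1) - 2 - B) + 2 - 2 * p = M - 2 * p - (B - 2) := by ring
      rw [e1, qPow_mul_qPow_mul, mul_left_comm (qBinomMod _ _), qPow_mul_qPow_mul]
      congr 1
      · congr 1; push_cast; ring
      · congr 2
        unfold slots; congr 1; ring
  · have hst : sideTime (T + 1) f B = B - 2 := by
      cases f
      · rw [sideTime_false]; simp only [true_and, not_lt] at hdown; omega
      · rfl
    have hdown' : ¬ (f = false ∧ nextHeight (T + 1) f B < T) := by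
      rintro ⟨rfl, h⟩
      simp only [true_and, not_lt] at hdown
      have : nextHeight (T + 1) false B = T := by simp [nextHeight]; omega
      omega
    have hst' : sideTime T f (nextHeight (T + 1) f B) = nextHeight (T + 1) f B - 2 := by
      cases f
      · simp only [true_and, not_lt] at hdown'
        have := nextHeight_le false hBT hT
        rw [sideTime_false]; omega
      · rfl
    rw [hst] at hM
    rw [hst']
    simp only [extendedGF, if_neg hdown, if_neg hdown']
    rw [← hJdef, ← hIdef]
    -- At `B = 2` the factor `B - 3 = -1` in the extension weight cancels the formal straight
    -- vertex, so the downward departure can be traded for an upward one.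
    rcases hB.eq_or_lt with rfl | hB2
    · have hB' : nextHeight (T + 1) f 2 = 2 := by
        cases f
        · simp at hdown; omega
        · simp [nextHeight]
      rw [hB', hJs.leaveDown_two, E.up _ _ _ (by omega) le_rfl (by omega), insertUp,
        Finset.mul_sum, Finset.mul_sum]
      refine Finset.sum_congr rfl fun n _ => ?_
      rw [hIs.leaveDown_two]
      simp only [sub_self, sub_zero, mul_left_comm (qBinomMod _ _) (qPow _), qPow_mul_qPow_mul]
      congr 1
      · congr 1; push_cast; ring
    · have hB' : nextHeight (T + 1) f B = B - 1 := by
        cases f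
        · simp at hdown; simp [nextHeight]; omega
        · simp [nextHeight]; omega
      have ed := E.down (M - (B - 2)) (B - 1) p (by omega) (by omega) (by omega)
      rw [sub_add_cancel] at ed
      rw [hB', ed, insertDown, Finset.mul_sum]
      refine Finset.sum_congr rfl fun n _ => ?_
      have e1 : M - (B - 2) + 1 - 2 * p = M - 2 * p - (B - 1 - 2) := by ring
      rw [e1, qPow_mul_qPow_mul, mul_left_comm (qBinomMod _ _), qPow_mul_qPow_mul]
      congr 1
      · congr 1; push_cast; ring
      · congr 2
        unfold slots; congr 1; ring

/-- The remaining time ends before the left extension is complete. -/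
theorem extendedGF_of_lt (T : ℤ) (e f : Bool) {A B M : ℤ} (hA : 2 ≤ A) (hAT : A ≤ T)
    (hBT : B ≤ T) (hM : M < sideTime T e A + sideTime T f B) (p : ℤ) :
    extendedGF T e A f B M p = 0 := by
  obtain ⟨x, c, w, hsrc, -⟩ := leftSource_eq_pointSource T e hA hAT
  have hI := (isArrival_arrival T (leftSource T e A)).congr hsrc
  have hz := hI.eq_zero_of_lt (s := sideTime T e A)
    (fun N x h p hN => pointSource_of_lt _ _ _ _ hN _ _ _)
  unfold extendedGF
  split_ifs with h
  · rw [h.1, sideTime_false] at hM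
    rw [leaveUp, hz _ _ _ _ (by omega), hz _ _ _ _ (by omega)]; simp
  · have hst : sideTime T f B = B - 2 := by
      cases f
      · rw [sideTime_false]; simp only [true_and, not_lt] at h; omega
      · rfl
    rw [hst] at hM
    rw [leaveDown, hz _ _ _ _ (by omega), hz _ _ _ _ (by omega)]; simp

/-- In the strip with the single height `2` no step is possible, so only the empty path exists. -/
theorem extendedGF_two (e f : Bool) {M : ℤ} (hM : 0 ≤ M) (p : ℤ) :
    extendedGF 2 e 2 f 2 M p = if M = 0 ∧ p = 0 then 1 else 0 := by
  have hI := isArrival_arrival 2 (leftSource 2 e 2)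
  have hI' := hI.congr (S' := pointSource 0 false 2 0 0) (by simp [leftSource])
  rw [extendedGF, if_neg (by simp), hI.leaveDown_two, qPow_mul_qPow_mul]
  have he : (((2 : ℤ) - 3 : ℚ) * (M - ((2 : ℤ) - 2)) + ((2 : ℤ) - 3) * ((2 : ℤ) - 2) / 2) / 4
      + ((M - (2 - 2) : ℤ) : ℚ) / 4 = 0 := by push_cast; ring
  rw [he, qPow_zero, one_mul, sub_self, sub_zero]
  rcases hM.eq_or_lt with rfl | hM
  · rw [leaveUp, hI'.at_source le_rfl le_rfl le_rfl, hI'.at_source le_rfl le_rfl le_rfl]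
    simp [pointSource, qPow_zero]
  · rw [if_neg (by omega), leaveUp, hI'.down _ _ _ hM.le le_rfl le_rfl,
      hI'.up _ _ _ hM.le le_rfl le_rfl, hI'.leaveDown_out (by omega), hI'.leaveUp_out (by omega),
      pointSource_of_gt _ _ _ _ hM, pointSource_of_gt _ _ _ _ hM]
    simp

/-! ### Iterated reduction -/

/-- `sideTime` after `i` reductions. -/
def sideAt (T : ℤ) (e : Bool) (A i : ℤ) : ℤ :=
  if e = true then pabs (A - 2 - i) else pabs (T - A - i) + (T - 2 - i)

/-- The height of the end point after `i` reductions. -/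
def heightAt (T : ℤ) (e : Bool) (A i : ℤ) : ℤ :=
  if e = true then 2 + pabs (A - 2 - i) else min A (T - i)

theorem sideAt_zero (T : ℤ) (e : Bool) {A : ℤ} (hA : 2 ≤ A) (hAT : A ≤ T) :
    sideAt T e A 0 = sideTime T e A := by
  unfold sideAt sideTime pabs; split_ifs <;> omega

theorem sideAt_succ {T : ℤ} (e : Bool) {A i : ℤ} (hA : 2 ≤ A) (hAT : A ≤ T + 1) (hi : 0 ≤ i) :
    sideAt (T + 1) e A (i + 1) = sideAt T e (nextHeight (T + 1) e A) i := by
  unfold sideAt nextHeight pabs; cases e <;> simp <;> split_ifs <;> omega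

theorem heightAt_succ {T : ℤ} (e : Bool) {A i : ℤ} (hA : 2 ≤ A) (hAT : A ≤ T + 1) (hi : 0 ≤ i) :
    heightAt (T + 1) e A (i + 1) = heightAt T e (nextHeight (T + 1) e A) i := by
  unfold heightAt nextHeight pabs; cases e <;> simp <;> (try split_ifs) <;> omega

theorem heightAt_zero (T : ℤ) (e : Bool) {A : ℤ} (hA : 2 ≤ A) (hAT : A ≤ T) :
    heightAt T e A 0 = A := by
  unfold heightAt pabs; split_ifs <;> omega

/-- `∑_{k > i} n_k`. -/
def tailCount {k : ℕ} (n : Fin k → ℕ) (i : ℤ) : ℤ :=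
  ∑ j : Fin k, if i < ((j : ℕ) : ℤ) + 1 then (n j : ℤ) else 0

/-- `2 ∑_{k > i} (k - i) n_k`. -/
def tailLength {k : ℕ} (n : Fin k → ℕ) (i : ℤ) : ℤ :=
  2 * ∑ j : Fin k, if i < ((j : ℕ) : ℤ) + 1 then (((j : ℕ) : ℤ) + 1 - i) * (n j : ℤ) else 0

theorem tailCount_cons {k : ℕ} (a : ℕ) (n : Fin k → ℕ) {i : ℤ} (hi : 0 ≤ i) :
    tailCount (Fin.cons a n : Fin (k + 1) → ℕ) (i + 1) = tailCount n i := by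
  simp [tailCount, Fin.sum_univ_succ, not_lt.2 hi]

theorem tailLength_cons {k : ℕ} (a : ℕ) (n : Fin k → ℕ) {i : ℤ} (hi : 0 ≤ i) :
    tailLength (Fin.cons a n : Fin (k + 1) → ℕ) (i + 1) = tailLength n i := by
  simp [tailLength, Fin.sum_univ_succ, not_lt.2 hi]

theorem tailLength_sub_succ {k : ℕ} (n : Fin k → ℕ) (i : ℤ) :
    tailLength n i - tailLength n (i + 1) = 2 * tailCount n i := by
  unfold tailLength tailCount
  rw [← mul_sub, ← Finset.sum_sub_distrib]
  congr 1
  refine Finset.sum_congr rfl fun j _ => ?_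
  split_ifs with h1 h2
  · ring
  · have : i = (j : ℕ) := by omega
    rw [this]; ring
  · omega
  · ring

theorem tailCount_zero {k : ℕ} (n : Fin k → ℕ) : tailCount n 0 = ((∑ j, n j : ℕ) : ℤ) := by
  unfold tailCount
  push_cast
  refine Finset.sum_congr rfl fun j _ => if_pos (by omega)

theorem tailCount_sub_succ {k : ℕ} (n : Fin k → ℕ) (j : Fin k) :
    tailCount n (j : ℕ) - tailCount n ((j : ℕ) + 1) = n j := by
  unfold tailCount
  rw [← Finset.sum_sub_distrib, Finset.sum_eq_single j]
  · simp
  · intro i _ hi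
    have : (i : ℕ) ≠ j := fun h => hi (Fin.ext h)
    split_ifs <;> omega
  · simp

theorem tailLength_of_le {k : ℕ} (n : Fin k → ℕ) {i : ℤ} (hi : k ≤ i) : tailLength n i = 0 := by
  unfold tailLength
  rw [Finset.sum_eq_zero, mul_zero]
  intro j _
  rw [if_neg]
  have := j.2
  omega

/-- The contribution of a vector to the generating function of extended paths. -/
noncomputable def extendedTerm (T : ℤ) (e : Bool) (A : ℤ) (f : Bool) (B : ℤ) {k : ℕ}
    (n : Fin k → ℕ) : HahnSeries ℚ ℚ :=
  ∏ j : Fin k,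
    (qPow ((tailCount n ((j : ℕ) + 1) : ℚ) * tailLength n ((j : ℕ) + 1) / 2
      + n j * ((sideAt T f B ((j : ℕ) + 1) + heightAt T f B ((j : ℕ) + 1) % 2 : ℤ) : ℚ) / 2) *
    qBinomMod (n j) ((tailLength n ((j : ℕ) + 1) - sideAt T e A ((j : ℕ) + 1)
      - sideAt T f B ((j : ℕ) + 1) - heightAt T e A ((j : ℕ) + 1) % 2
      - heightAt T f B ((j : ℕ) + 1) % 2) / 2))

/-- The first entry belongs to the first reduction; the other factors are those of the reduced strip
with the stage shifted by one. -/
theorem extendedTerm_cons {T : ℤ} (e f : Bool) {A B : ℤ} (hA : 2 ≤ A) (hAT : A ≤ T + 1)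
    (hB : 2 ≤ B) (hBT : B ≤ T + 1) (hT : 2 ≤ T) {k : ℕ} (a : ℕ) (n : Fin k → ℕ) :
    extendedTerm (T + 1) e A f B (Fin.cons a n : Fin (k + 1) → ℕ) =
      (qPow ((tailCount n 0 : ℚ) * tailLength n 0 / 2
        + a * ((sideTime T f (nextHeight (T + 1) f B) + nextHeight (T + 1) f B % 2 : ℤ) : ℚ) / 2) *
      qBinomMod a ((tailLength n 0 - sideTime T e (nextHeight (T + 1) e A)
        - sideTime T f (nextHeight (T + 1) f B) - nextHeight (T + 1) e A % 2
        - nextHeight (T + 1) f B % 2) / 2)) *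
      extendedTerm T e (nextHeight (T + 1) e A) f (nextHeight (T + 1) f B) n := by
  have a1 := nextHeight_ge e hA (show 3 ≤ T + 1 by omega)
  have a2 := nextHeight_le e hAT (show 3 ≤ T + 1 by omega)
  have b1 := nextHeight_ge f hB (show 3 ≤ T + 1 by omega)
  have b2 := nextHeight_le f hBT (show 3 ≤ T + 1 by omega)
  rw [add_sub_cancel_right] at a2 b2
  unfold extendedTerm
  rw [Fin.prod_univ_succ]
  congr 1
  · simp only [Fin.val_zero, Nat.cast_zero, Fin.cons_zero]
    rw [tailCount_cons a n le_rfl, tailLength_cons a n le_rfl, sideAt_succ e hA hAT le_rfl,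
      sideAt_succ f hB hBT le_rfl, heightAt_succ e hA hAT le_rfl, heightAt_succ f hB hBT le_rfl,
      sideAt_zero T e a1 a2, sideAt_zero T f b1 b2, heightAt_zero T e a1 a2,
      heightAt_zero T f b1 b2]
  · refine Finset.prod_congr rfl fun j _ => ?_
    simp only [Fin.val_succ, Nat.cast_add, Nat.cast_one, Fin.cons_succ]
    have h0 : (0 : ℤ) ≤ (j : ℕ) + 1 := by omega
    rw [tailCount_cons a n h0, tailLength_cons a n h0, sideAt_succ e hA hAT h0,
      sideAt_succ f hB hBT h0, heightAt_succ e hA hAT h0, heightAt_succ f hB hBT h0]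

theorem sum_antidiagonalTuple_succ {M : Type*} [AddCommMonoid M] (k p : ℕ)
    (F : (Fin (k + 1) → ℕ) → M) :
    ∑ n ∈ Finset.Nat.antidiagonalTuple (k + 1) p, F n =
      ∑ a ∈ Finset.range (p + 1), ∑ n ∈ Finset.Nat.antidiagonalTuple k (p - a),
        F (Fin.cons a n) := by
  rw [Finset.sum_sigma']
  refine Finset.sum_bij' (fun n _ => ⟨n 0, Fin.tail n⟩) (fun x _ => Fin.cons x.1 x.2) ?_ ?_ ?_ ?_ ?_
  · intro n hn
    rw [Finset.Nat.mem_antidiagonalTuple, Fin.sum_univ_succ] at hn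
    simp only [Finset.mem_sigma, Finset.mem_range, Finset.Nat.mem_antidiagonalTuple, Fin.tail]
    omega
  · rintro ⟨a, n⟩ hx
    simp only [Finset.mem_sigma, Finset.mem_range, Finset.Nat.mem_antidiagonalTuple] at hx
    rw [Finset.Nat.mem_antidiagonalTuple, Fin.sum_univ_succ]
    simp only [Fin.cons_zero, Fin.cons_succ]
    omega
  · intro n _; exact Fin.cons_self_tail n
  · rintro ⟨a, n⟩ _; simp
  · intro n _; rw [Fin.cons_self_tail]

/-- All the intermediate lengths are nonnegative. -/
def LengthsNonneg (T : ℤ) (e : Bool) (A : ℤ) (f : Bool) (B : ℤ) {k : ℕ} (n : Fin k → ℕ) : Prop :=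
  ∀ j : Fin k, sideAt T e A ((j : ℕ) + 1) + sideAt T f B ((j : ℕ) + 1) ≤
    tailLength n ((j : ℕ) + 1)

instance (T : ℤ) (e : Bool) (A : ℤ) (f : Bool) (B : ℤ) {k : ℕ} (n : Fin k → ℕ) :
    Decidable (LengthsNonneg T e A f B n) := by unfold LengthsNonneg; infer_instance

/-- Iterates the removal of the smallest peaks until the strip has one height. The reduction
requires the length to be at least that of the two extensions, so at first the sum runs only over
vectors that satisfy this at every stage. -/
theorem extendedGF_eq_sum (k : ℕ) (e f : Bool) (A B M : ℤ) (hA : 2 ≤ A) (hAT : A ≤ k + 2)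
    (hB : 2 ≤ B) (hBT : B ≤ k + 2) (hM : sideTime (k + 2) e A + sideTime (k + 2) f B ≤ M) (p : ℕ) :
    extendedGF (k + 2) e A f B M p = ∑ n ∈ Finset.Nat.antidiagonalTuple k p,
      if tailLength n 0 = M ∧ LengthsNonneg (k + 2) e A f B n then
        extendedTerm (k + 2) e A f B n else 0 := by
  induction k generalizing A B M p with
  | zero =>
    obtain rfl : A = 2 := by push_cast at hAT; omega
    obtain rfl : B = 2 := by push_cast at hBT; omega
    have h0 : ∀ e, sideTime ((0 : ℕ) + 2) e 2 = 0 := by intro e; cases e <;> rfl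
    rw [h0, h0] at hM
    have := extendedGF_two e f (by simpa using hM) (p : ℤ)
    simp only [Nat.cast_zero, zero_add]
    rw [this]
    cases p with
    | zero =>
      simp [tailLength, LengthsNonneg, extendedTerm, eq_comm]
    | succ p => rw [if_neg (by omega)]; simp
  | succ k ih =>
    have eT : ((k + 1 : ℕ) : ℤ) + 2 = (k + 2 : ℤ) + 1 := by push_cast; ring
    rw [eT] at hAT hBT hM ⊢
    have a1 := nextHeight_ge e hA (show 3 ≤ (k : ℤ) + 2 + 1 by omega)
    have a2 := nextHeight_le e hAT (show 3 ≤ (k : ℤ) + 2 + 1 by omega)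
    have b1 := nextHeight_ge f hB (show 3 ≤ (k : ℤ) + 2 + 1 by omega)
    have b2 := nextHeight_le f hBT (show 3 ≤ (k : ℤ) + 2 + 1 by omega)
    rw [add_sub_cancel_right] at a2 b2
    rw [extendedGF_step (by omega) e f hA hAT hB hBT hM, sum_antidiagonalTuple_succ,
      Int.toNat_natCast, add_sub_cancel_right]
    refine Finset.sum_congr rfl fun a ha => ?_
    rw [Finset.mem_range] at ha
    have epa : (p : ℤ) - a = ((p - a : ℕ) : ℤ) := by omega
    rw [epa]
    have hlen : ∀ n ∈ Finset.Nat.antidiagonalTuple k (p - a),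
        tailLength (Fin.cons a n : Fin (k + 1) → ℕ) 0 = 2 * p + tailLength n 0 ∧
        tailCount n 0 = (p - a : ℕ) := by
      intro n hn
      rw [Finset.Nat.mem_antidiagonalTuple] at hn
      have h1 := tailLength_sub_succ (Fin.cons a n : Fin (k + 1) → ℕ) 0
      rw [tailLength_cons a n le_rfl, tailCount_zero, Fin.sum_univ_succ] at h1
      simp only [Fin.cons_zero, Fin.cons_succ] at h1
      rw [hn] at h1
      refine ⟨by omega, ?_⟩
      rw [tailCount_zero, hn]
    have hgood : ∀ n : Fin k → ℕ,
        LengthsNonneg ((k : ℤ) + 2 + 1) e A f B (Fin.cons a n : Fin (k + 1) → ℕ) ↔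
        sideTime (k + 2) e (nextHeight (k + 2 + 1) e A)
          + sideTime (k + 2) f (nextHeight (k + 2 + 1) f B) ≤ tailLength n 0 ∧
        LengthsNonneg (k + 2) e (nextHeight (k + 2 + 1) e A) f
          (nextHeight (k + 2 + 1) f B) n := by
      intro n
      unfold LengthsNonneg
      rw [Fin.forall_fin_succ]
      refine and_congr ?_ (forall_congr' fun j => ?_)
      · simp only [Fin.val_zero, Nat.cast_zero]
        rw [tailLength_cons a n le_rfl, sideAt_succ e hA hAT le_rfl, sideAt_succ f hB hBT le_rfl,
          sideAt_zero _ e a1 a2, sideAt_zero _ f b1 b2]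
      · have h0 : (0 : ℤ) ≤ (j : ℕ) + 1 := by omega
        simp only [Fin.val_succ, Nat.cast_add, Nat.cast_one]
        rw [tailLength_cons a n h0, sideAt_succ e hA hAT h0, sideAt_succ f hB hBT h0]
    -- Too short a reduced length means that there are no paths on the left, while on the right
    -- `LengthsNonneg` already fails at its first stage.
    rcases lt_or_ge (M - 2 * p) (sideTime (k + 2) e (nextHeight (k + 2 + 1) e A)
        + sideTime (k + 2) f (nextHeight (k + 2 + 1) f B)) with hlt | hge
    · rw [extendedGF_of_lt _ _ _ a1 a2 b2 hlt, mul_zero, mul_zero]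
      refine (Finset.sum_eq_zero fun n hn => if_neg ?_).symm
      rintro ⟨h1, h2⟩
      have h3 := (hlen n hn).1
      have h4 := ((hgood n).1 h2).1
      omega
    · rw [ih _ _ _ a1 a2 b1 b2 hge, Finset.mul_sum, Finset.mul_sum]
      refine Finset.sum_congr rfl fun n hn => ?_
      obtain ⟨h1, h2⟩ := hlen n hn
      by_cases hcond : tailLength n 0 = M - 2 * p ∧ LengthsNonneg (k + 2) e
          (nextHeight (k + 2 + 1) e A) f (nextHeight (k + 2 + 1) f B) n
      · rw [if_pos hcond, if_pos ⟨by omega, (hgood n).2 ⟨by omega, hcond.2⟩⟩,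
          extendedTerm_cons e f hA hAT hB hBT (by omega), h2, hcond.1, mul_assoc]
        congr 2
        have : ((p - a : ℕ) : ℚ) = (p : ℚ) - a := by
          rw [Nat.cast_sub (by omega)]
        push_cast
        rw [this]
      · rw [if_neg hcond, if_neg]
        · simp
        · rintro ⟨h3, h4⟩
          exact hcond ⟨by omega, ((hgood n).1 h4).2⟩

/-! ### Vectors with a negative intermediate length contribute zero -/

theorem sideAt_top {k : ℕ} (e : Bool) {A : ℤ} (hA : 2 ≤ A) (hAT : A ≤ k + 2) :
    sideAt (k + 2) e A k = 0 := by
  unfold sideAt pabs; split_ifs <;> omega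

theorem sideAt_convex (T : ℤ) (e : Bool) (A i : ℤ) :
    2 * sideAt T e A (i + 1) ≤ sideAt T e A i + sideAt T e A (i + 2) := by
  unfold sideAt pabs; cases e <;> simp <;> split_ifs <;> omega

/-- The second difference of `i ↦ 2 ∑ (k - i)₊ n_k` is twice a single entry. -/
theorem tailLength_convex {k : ℕ} (n : Fin k → ℕ) (j : Fin k) :
    tailLength n (j : ℕ) + tailLength n ((j : ℕ) + 2) =
      2 * tailLength n ((j : ℕ) + 1) + 2 * n j := by
  have h1 := tailLength_sub_succ n (j : ℕ)
  have h2 := tailLength_sub_succ n ((j : ℕ) + 1)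
  have h3 := tailCount_sub_succ n j
  rw [show ((j : ℕ) : ℤ) + 1 + 1 = (j : ℕ) + 2 by ring] at h2
  omega

theorem qBinomMod_ne_zero {n m : ℤ} (h : qBinomMod n m ≠ 0) : 0 ≤ m ∨ (n = 0 ∧ m = -1) := by
  unfold qBinomMod at h
  split_ifs at h with h1 h2
  · exact Or.inl h1.2
  · exact Or.inr h2
  · exact absurd rfl h

/-- A sequence that is almost convex below zero stays nonnegative. -/
theorem nonneg_of_almost_convex {k : ℕ} {m n : ℕ → ℤ} (h0 : 0 ≤ m 0) (hk : m k = 0)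
    (hm : ∀ i < k, 0 ≤ m (i + 1) ∨ (n i = 0 ∧ -2 ≤ m (i + 1)))
    (hc : ∀ i < k, m i + m (i + 2) ≤ 2 * m (i + 1) + 2 * n i) (i : ℕ) (hi : i ≤ k) :
    0 ≤ m i := by
  induction i with
  | zero => exact h0
  | succ i ih =>
    have hi0 := ih (by omega)
    -- At the first negative value the matching entry of `n` is zero, so convexity makes the next
    -- value at most `-2`. The lower bound forces equality, hence `-1` before it, and the value
    -- after it is at most `-3`, which is not allowed. The zero at `k` prevents the sequence from
    -- ending earlier.
    by_contra hneg
    rw [not_le] at hneg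
    have hlt : i + 1 < k := lt_of_le_of_ne hi (by rintro rfl; omega)
    have a1 := hm i (by omega)
    have a2 := hc i (by omega)
    have hlt2 : i + 2 < k := lt_of_le_of_ne (by omega) (by rintro rfl; omega)
    have b1 := hm (i + 1) (by omega)
    have b2 := hc (i + 1) (by omega)
    rw [show i + 1 + 1 = i + 2 by ring] at b1 b2
    rw [show i + 1 + 2 = i + 3 by ring] at b2
    have hlt3 : i + 3 < k := lt_of_le_of_ne (by omega) (by rintro rfl; omega)
    have c1 := hm (i + 2) (by omega)
    rw [show i + 2 + 1 = i + 3 by ring] at c1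
    omega

/-- A nonzero modified binomial with a negative second argument has `n = 0` and argument `-1`, which
bounds `m_i` below by `-2`. The extension lengths are convex, so subtracting them from `tailLength`
gives the inequality that the sequence argument requires. -/
theorem nonneg_of_extendedTerm_ne_zero {k : ℕ} {e f : Bool} {A B : ℤ} (hA : 2 ≤ A)
    (hAT : A ≤ k + 2) (hB : 2 ≤ B) (hBT : B ≤ k + 2) {n : Fin k → ℕ}
    (h0 : sideTime (k + 2) e A + sideTime (k + 2) f B ≤ tailLength n 0)
    (hn : extendedTerm (k + 2) e A f B n ≠ 0) (i : ℕ) (hi : i ≤ k) :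
    sideAt (k + 2) e A i + sideAt (k + 2) f B i ≤ tailLength n i := by
  have key := nonneg_of_almost_convex (k := k)
    (m := fun i => tailLength n i - sideAt (k + 2) e A i - sideAt (k + 2) f B i)
    (n := fun i => if h : i < k then (n ⟨i, h⟩ : ℤ) else 0)
    (by
      simp only [Nat.cast_zero]
      rw [sideAt_zero _ e hA hAT, sideAt_zero _ f hB hBT]; omega)
    (by
      rw [sideAt_top e hA hAT, sideAt_top f hB hBT, tailLength_of_le n le_rfl]; rfl)
    (by
      intro i hi
      have h1 := (mul_ne_zero_iff.1 (Finset.prod_ne_zero_iff.1 hn ⟨i, hi⟩ (Finset.mem_univ _))).2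
      have h2 := qBinomMod_ne_zero h1
      simp only [dif_pos hi]
      push_cast
      have e1 := Int.emod_nonneg (heightAt (k + 2) e A ((i : ℤ) + 1)) (by norm_num : (2 : ℤ) ≠ 0)
      have e2 := Int.emod_nonneg (heightAt (k + 2) f B ((i : ℤ) + 1)) (by norm_num : (2 : ℤ) ≠ 0)
      simp only at h2
      omega)
    (by
      intro i hi
      have h1 := tailLength_convex n ⟨i, hi⟩
      have h2 := sideAt_convex (k + 2) e A i
      have h3 := sideAt_convex (k + 2) f B i
      simp only [dif_pos hi]
      push_cast
      simp only at h1
      omega) i hi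
  omega

/-- The fermionic form of the generating function of extended paths. -/
theorem extendedGF_eq_sum' (k : ℕ) (e f : Bool) {A B M : ℤ} (hA : 2 ≤ A) (hAT : A ≤ k + 2)
    (hB : 2 ≤ B) (hBT : B ≤ k + 2) (hM : sideTime (k + 2) e A + sideTime (k + 2) f B ≤ M) (p : ℕ) :
    extendedGF (k + 2) e A f B M p = ∑ n ∈ Finset.Nat.antidiagonalTuple k p,
      if tailLength n 0 = M then extendedTerm (k + 2) e A f B n else 0 := by
  rw [extendedGF_eq_sum k e f A B M hA hAT hB hBT hM]
  refine Finset.sum_congr rfl fun n _ => ?_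
  by_cases h : tailLength n 0 = M
  · by_cases h1 : extendedTerm (k + 2) e A f B n = 0
    · simp [h1]
    · have hL : LengthsNonneg (k + 2) e A f B n := fun j => by
        have := nonneg_of_extendedTerm_ne_zero hA hAT hB hBT (by omega) h1 (j + 1) (by omega)
        exact_mod_cast this
      rw [if_pos h, if_pos ⟨h, hL⟩]
  · rw [if_neg h, if_neg (fun h' => h h'.1)]

/-! ### Removing the extensions -/

/-- `1` for a descending initial edge, which lies after a peak of the extended path. -/
def edgePeak (e : Bool) : ℤ := if e = true then 0 else 1

section

variable {T s A c : ℤ} {x : Bool} {w : ℚ} {I I0 : Family}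

/-- Translating the starting time. -/
theorem arrival_shift (hI : IsArrival T (pointSource s x A c w) I)
    (hI0 : IsArrival T (pointSource 0 x A 0 0) I0) (hs : 0 ≤ s) (hA : 2 ≤ A) (hAT : A ≤ T)
    (N : ℕ) (h p : ℤ) :
    I (N + s) false h (p + c) =
      qPow (w + s * (N - 2 * p + 1 - edgePeak x) / 4) * I0 N false h p ∧
    I (N + s) true h (p + c) =
      qPow (w + s * (N - 2 * p - edgePeak x) / 4) * I0 N true h p := by
  induction N generalizing h p with
  | zero =>
    have h1 := hI.at_source hs hA hAT
    have h2 := hI0.at_source le_rfl hA hAT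
    rw [Nat.cast_zero, zero_add, h1, h1, h2, h2]
    simp only [pointSource, add_eq_right, true_and]
    constructor
    · split_ifs with hh
      · obtain ⟨rfl, -, rfl⟩ := hh
        rw [← qPow_add]; congr 1; simp [edgePeak]
      · simp
    · split_ifs with hh
      · obtain ⟨rfl, -, rfl⟩ := hh
        rw [← qPow_add]; congr 1; simp [edgePeak]
      · simp
  | succ N ih =>
    have e1 : ((N + 1 : ℕ) : ℤ) + s - 1 = N + s := by push_cast; ring
    have e2 : ((N + 1 : ℕ) : ℤ) - 1 = N := by push_cast; ring
    by_cases hh : 2 ≤ h ∧ h ≤ T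
    · constructor
      · rw [hI.down _ _ _ (by omega) hh.1 hh.2, hI0.down _ _ _ (by omega) hh.1 hh.2,
          pointSource_of_gt _ _ _ _ (by push_cast; omega),
          pointSource_of_gt _ _ _ _ (by push_cast; omega), e1, e2, leaveDown, leaveDown,
          show p + c - 1 = p - 1 + c by ring, (ih _ _).1, (ih _ _).2, zero_add, zero_add, mul_add,
          qPow_mul_qPow_mul, qPow_mul_qPow_mul]
        congr 2
        · congr 1; push_cast; ring
        · congr 1; push_cast; ring
      · rw [hI.up _ _ _ (by omega) hh.1 hh.2, hI0.up _ _ _ (by omega) hh.1 hh.2,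
          pointSource_of_gt _ _ _ _ (by push_cast; omega),
          pointSource_of_gt _ _ _ _ (by push_cast; omega), e1, e2, leaveUp, leaveUp,
          (ih _ _).1, (ih _ _).2, zero_add, zero_add, mul_add,
          qPow_mul_qPow_mul, qPow_mul_qPow_mul, mul_ite, mul_zero]
        congr 2
        · congr 1; push_cast; ring
        · congr 2; push_cast; ring
    · rw [hI.out _ _ _ _ hh, hI0.out _ _ _ _ hh, hI.out _ _ _ _ hh, hI0.out _ _ _ _ hh]
      simp

/-- A delay by `s` costs `s / 4` for every straight vertex. Of the `N + 1` vertices, `p` are peaks;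
with a descending last edge there are `p - 1` valleys after an ascending first edge and `p` after a
descending one. -/
theorem leaveDown_shift (hI : IsArrival T (pointSource s x A c w) I)
    (hI0 : IsArrival T (pointSource 0 x A 0 0) I0) (hs : 0 ≤ s) (hA : 2 ≤ A) (hAT : A ≤ T)
    (N : ℕ) (h p : ℤ) : leaveDown I (N + s) h (p + c) =
      qPow (w + s * (N - 2 * p + 2 - edgePeak x) / 4) * leaveDown I0 N h p := by
  rw [leaveDown, leaveDown, show p + c - 1 = p - 1 + c by ring,
    (arrival_shift hI hI0 hs hA hAT N _ _).1, (arrival_shift hI hI0 hs hA hAT N _ _).2, mul_add,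
    qPow_mul_qPow_mul, qPow_mul_qPow_mul]
  congr 2
  · congr 1; push_cast; ring
  · congr 1; push_cast; ring

/-- With an ascending last edge there is one more valley, hence one straight vertex fewer. -/
theorem leaveUp_shift (hI : IsArrival T (pointSource s x A c w) I)
    (hI0 : IsArrival T (pointSource 0 x A 0 0) I0) (hs : 0 ≤ s) (hA : 2 ≤ A) (hAT : A ≤ T)
    (N : ℕ) (h p : ℤ) : leaveUp I (N + s) h (p + c) =
      qPow (w + s * (N - 2 * p + 1 - edgePeak x) / 4) * leaveUp I0 N h p := by
  rw [leaveUp, leaveUp, (arrival_shift hI hI0 hs hA hAT N _ _).1,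
    (arrival_shift hI hI0 hs hA hAT N _ _).2, mul_add, qPow_mul_qPow_mul, qPow_mul_qPow_mul,
    mul_ite, mul_zero]
  congr 2
  · congr 1; push_cast; ring

end

/-- Paths of length `N` from `A` to `B`, with initial edge `e` and final edge determined by `f`, by
number of peaks. -/
noncomputable def innerGF (T : ℤ) (e : Bool) (A : ℤ) (f : Bool) (B N p : ℤ) : HahnSeries ℚ ℚ :=
  if f = true then leaveDown (arrival T (pointSource 0 e A 0 0)) N B p
  else leaveUp (arrival T (pointSource 0 e A 0 0)) N B p

/-- The end point `A` is not the one at which the extension in the direction of `e` is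
degenerate. -/
def EndAllowed (T : ℤ) (e : Bool) (A : ℤ) : Prop := if e = true then 3 ≤ A else A < T

/-- The weight of the extension on the left. -/
def leftWeight (T : ℤ) (e : Bool) (A : ℤ) : ℚ :=
  if e = true then (A - 3) * (A - 2) / 8
  else ((T - 3) * (T - 2) + (2 * T - 3 - A) * (2 * T - 2 - A) - (T - 2) * (T - 1)) / 8

/-- The weight of the extension on the right, of a path that ends at time `M`. -/
def rightWeight (T : ℤ) (f : Bool) (B : ℤ) (M : ℚ) : ℚ :=
  if f = true then ((B - 3) * M + (B - 3) * (B - 2) / 2) / 4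
  else ((2 * T - B - 4) * M + (2 * T - B - 3) * (2 * T - B - 2) / 2 - (T - B)) / 4

theorem leftSource_of_allowed {T : ℤ} {e : Bool} {A : ℤ} (h : EndAllowed T e A) :
    leftSource T e A = pointSource (sideTime T e A) e A (edgePeak e) (leftWeight T e A) := by
  cases e
  · simp only [EndAllowed, Bool.false_eq_true, if_false] at h
    simp [leftSource, h, sideTime, edgePeak, leftWeight]
  · simp only [EndAllowed, if_true] at h
    simp [leftSource, h, sideTime, edgePeak, leftWeight]

/-- For fixed length and number of peaks, the number of straight vertices is fixed as well, so the
delay caused by the left extension is a constant power of `q`, like the weights of the two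
extensions themselves. The number of peaks grows by one for each end that touches the ceiling. -/
theorem extendedGF_eq_innerGF {T : ℤ} {e f : Bool} {A B : ℤ} (hA : 2 ≤ A) (hAT : A ≤ T)
    (he : EndAllowed T e A) (hf : EndAllowed T f B) (N : ℕ) (p : ℤ) :
    extendedGF T e A f B (N + sideTime T e A + sideTime T f B) (p + edgePeak e + edgePeak f) =
      qPow (rightWeight T f B (N + sideTime T e A) + leftWeight T e A +
        sideTime T e A * (N - 2 * p + (2 - edgePeak f) - edgePeak e) / 4) *
      innerGF T e A f B N p := by
  have hI := (isArrival_arrival T (leftSource T e A)).congr (leftSource_of_allowed he)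
  have hI0 := isArrival_arrival T (pointSource 0 e A 0 0)
  have hs := sideTime_nonneg T e hA hAT
  cases f
  · simp only [EndAllowed, Bool.false_eq_true, if_false] at hf
    rw [extendedGF, if_pos ⟨rfl, hf⟩, sideTime_false, add_sub_cancel_right]
    have hp : p + edgePeak e + edgePeak false - 1 = p + edgePeak e := by simp [edgePeak]
    rw [hp, leaveUp_shift hI hI0 hs hA hAT, qPow_mul_qPow_mul]
    simp only [innerGF, Bool.false_eq_true, if_false]
    congr 2
    simp only [rightWeight, Bool.false_eq_true, if_false]
    simp only [edgePeak, Bool.false_eq_true, if_false]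
    push_cast; ring
  · rw [extendedGF, if_neg (by simp), sideTime_true, add_sub_cancel_right]
    have hp : p + edgePeak e + edgePeak true = p + edgePeak e := by simp [edgePeak]
    rw [hp, leaveDown_shift hI hI0 hs hA hAT, qPow_mul_qPow_mul]
    simp only [innerGF, if_true]
    congr 2
    simp only [rightWeight, if_true]
    simp only [edgePeak, if_true]
    push_cast; ring

/-! ### Half-lattice paths satisfy the same recursion -/

theorem isHalfLatticePath_snoc {N : ℕ} (g : Fin (N + 3) → ℚ) (y : ℚ) :
    IsHalfLatticePath (N + 1) (Fin.snoc g y : Fin (N + 3 + 1) → ℚ) ↔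
      IsHalfLatticePath N g ∧ IsHalfInt y ∧ |y - g (Fin.last _)| = 1 / 2 ∧
      (g ⟨N + 1, by omega⟩ = y → (∃ z : ℤ, g ⟨N + 1, by omega⟩ = (z : ℚ)) →
        g (Fin.last _) = g ⟨N + 1, by omega⟩ + 1 / 2) := by
  have H1 : ∀ j : Fin (N + 3), (Fin.snoc g y : Fin (N + 3 + 1) → ℚ) j.castSucc = g j :=
    fun j => Fin.snoc_castSucc ..
  have H2 : (Fin.snoc g y : Fin (N + 3 + 1) → ℚ) (Fin.last _) = y := Fin.snoc_last ..
  have l1 : (Fin.last (N + 1)).castSucc = (⟨N + 1, by omega⟩ : Fin (N + 3)) := rfl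
  constructor
  · rintro ⟨h1, h2, h3⟩
    refine ⟨⟨fun k => ?_, fun k => ?_, fun k => ?_⟩, ?_, ?_, ?_⟩
    · exact H1 k ▸ h1 k.castSucc
    · have := h2 k.castSucc
      rwa [Fin.succ_castSucc, H1, H1] at this
    · have := h3 k.castSucc
      rwa [Fin.succ_castSucc, Fin.succ_castSucc, H1, H1, H1] at this
    · exact H2 ▸ h1 (Fin.last _)
    · have := h2 (Fin.last _)
      rwa [Fin.succ_last, H1, H2] at this
    · have := h3 (Fin.last _)
      rwa [Fin.succ_last, Fin.succ_last, H1, H1, H2] at this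
  · rintro ⟨⟨h1, h2, h3⟩, h4, h5, h6⟩
    refine ⟨fun k => ?_, fun k => ?_, fun k => ?_⟩
    · induction k using Fin.lastCases with
      | last => rwa [H2]
      | cast k => rw [H1]; exact h1 k
    · induction k using Fin.lastCases with
      | last => rwa [Fin.succ_last, H1, H2]
      | cast k => rw [Fin.succ_castSucc, H1, H1]; exact h2 k
    · induction k using Fin.lastCases with
      | last => rwa [Fin.succ_last, Fin.succ_last, H1, H1, H2]
      | cast k => rw [Fin.succ_castSucc, Fin.succ_castSucc, H1, H1, H1]; exact h3 k

theorem abs_edge (b : ℚ) (f : Fin 2) : |b + 1 / 2 - ((f : ℕ) : ℚ) - b| = 1 / 2 := by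
  rw [show b + 1 / 2 - ((f : ℕ) : ℚ) - b = 1 / 2 - ((f : ℕ) : ℚ) by ring]
  fin_cases f <;> norm_num [abs_of_neg]

theorem weight_snoc {N : ℕ} (g : Fin (N + 3) → ℚ) (y : ℚ) :
    weight (N + 1) (Fin.snoc g y : Fin (N + 3 + 1) → ℚ) =
      weight N g + ((N : ℚ) + 1) / 4 * |y - g ⟨N + 1, by omega⟩| := by
  have H1 : ∀ j (hj : j < N + 3), (Fin.snoc g y : Fin (N + 3 + 1) → ℚ) ⟨j, by omega⟩ = g ⟨j, hj⟩ :=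
    fun j hj => Fin.snoc_castSucc (i := ⟨j, hj⟩) ..
  have H2 : (Fin.snoc g y : Fin (N + 3 + 1) → ℚ) ⟨N + 3, by omega⟩ = y := Fin.snoc_last ..
  unfold weight
  rw [Fin.sum_univ_castSucc, mul_add]
  congr 1
  · congr 1
    refine Finset.sum_congr rfl fun j _ => ?_
    rw [← H1 (j + 3) (by omega), ← H1 (j + 1) (by omega)]
    rfl
  · rw [← H1 (N + 1) (by omega)]
    simp only [Fin.val_last]
    rw [H2]
    ring

/-- Removing the last edge of a path. -/
theorem snoc_mem_pathSet {t a b : ℚ} {e f : Fin 2} {N : ℕ} (g : Fin (N + 3) → ℚ) (y : ℚ) :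
    (Fin.snoc g y : Fin (N + 3 + 1) → ℚ) ∈ pathSet t a b e f (N + 1) ↔
      (1 ≤ b ∧ b ≤ t) ∧ y = b + 1 / 2 - ((f : ℕ) : ℚ) ∧
      ((g ∈ pathSet t a (b + 1 / 2) e 1 N ∧ (f = 0 → ∃ z : ℤ, b = z)) ∨
        g ∈ pathSet t a (b - 1 / 2) e 0 N) := by
  have H1 : ∀ j : Fin (N + 3), (Fin.snoc g y : Fin (N + 3 + 1) → ℚ) j.castSucc = g j :=
    fun j => Fin.snoc_castSucc ..
  have H1' : ∀ j (hj : j < N + 3), (Fin.snoc g y : Fin (N + 3 + 1) → ℚ) ⟨j, by omega⟩ = g ⟨j, hj⟩ :=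
    fun j hj => Fin.snoc_castSucc (i := ⟨j, hj⟩) ..
  have H2 : (Fin.snoc g y : Fin (N + 3 + 1) → ℚ) ⟨N + 1 + 2, by omega⟩ = y := Fin.snoc_last ..
  have hrange : (∀ k : Fin (N + 1 + 1), 1 ≤ (Fin.snoc g y : Fin (N + 3 + 1) → ℚ) k.succ.castSucc ∧
      (Fin.snoc g y : Fin (N + 3 + 1) → ℚ) k.succ.castSucc ≤ t) ↔
      (∀ k : Fin (N + 1), 1 ≤ g k.succ.castSucc ∧ g k.succ.castSucc ≤ t) ∧
        1 ≤ g (Fin.last _) ∧ g (Fin.last _) ≤ t := by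
    rw [Fin.forall_fin_succ']
    simp only [Fin.succ_castSucc, Fin.succ_last, H1]
  have hlast : (⟨N + 2, by omega⟩ : Fin (N + 3)) = Fin.last _ := rfl
  simp only [pathSet, Set.mem_ofPred_eq]
  rw [H2, H1' 1 (by omega), H1' 0 (by omega), H1' (N + 1 + 1) (by omega)]
  change (_ ∧ _ ∧ _ ∧ g (Fin.last _) = b ∧ _) ↔ _
  rw [hlast]
  have hg := isHalfLatticePath_snoc g y
  constructor
  · rintro ⟨h1, h2, h3, h4, h5, h6⟩
    obtain ⟨p1, p2, p3, p4⟩ := hg.1 h1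
    obtain ⟨r1, r2⟩ := hrange.1 h2
    have hs : |g (Fin.last _) - g ⟨N + 1, by omega⟩| = 1 / 2 := p1.step (Fin.last _)
    rw [h4] at r2 hs p4
    refine ⟨r2, h6, ?_⟩
    rcases (abs_eq (by norm_num)).1 hs with hs | hs
    · right
      refine ⟨p1, r1, h3, by linarith, h5, ?_⟩
      rw [h4]; simp
    · left
      refine ⟨⟨p1, r1, h3, by linarith, h5, ?_⟩, fun hf => ?_⟩
      · rw [h4]; simp; ring
      · obtain ⟨z, hz⟩ := p1.half (Fin.last _)
        rw [h4] at hz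
        -- The path comes down to `b` and goes up again. If `b` were not an integer, its two
        -- neighbours would be equal integers, and the valley condition would demand a peak.
        rcases Int.even_or_odd' z with ⟨c, rfl | rfl⟩
        · exact ⟨c, by rw [hz]; push_cast; ring⟩
        · exfalso
          have e1 : g ⟨N + 1, by omega⟩ = b + 1 / 2 := by linarith
          have := p4 (by rw [h6, hf, e1]; simp) ⟨c + 1, by rw [e1, hz]; push_cast; ring⟩
          linarith
  · rintro ⟨r, hy, ⟨⟨p1, r1, h3, h4, h5, h6⟩, hf⟩ | ⟨p1, r1, h3, h4, h5, h6⟩⟩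
    all_goals
      have hb : g (Fin.last _) = b := by rw [h6]; simp <;> ring
      refine ⟨hg.2 ⟨p1, ?_, ?_, ?_⟩, hrange.2 ⟨r1, hb ▸ r⟩, h3, hb, h5, hy⟩
    · obtain ⟨z, hz⟩ := p1.half (Fin.last _)
      rw [hb] at hz
      exact ⟨z + 1 - 2 * (f : ℕ), by rw [hy, hz]; push_cast; ring⟩
    · rw [hy, hb]
      exact abs_edge b f
    · rw [h4]
      intro h7 h8
      have hf0 : f = 0 := by
        fin_cases f
        · rfl
        · exfalso; rw [hy] at h7; norm_num at h7; linarith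
      obtain ⟨z, hz⟩ := hf hf0
      obtain ⟨z', hz'⟩ := h8
      exfalso
      rw [hz] at hz'
      have : (2 * z + 1 : ℤ) = 2 * z' := by
        have : (2 * z + 1 : ℚ) = 2 * z' := by linarith
        exact_mod_cast this
      omega
    · obtain ⟨z, hz⟩ := p1.half (Fin.last _)
      rw [hb] at hz
      exact ⟨z + 1 - 2 * (f : ℕ), by rw [hy, hz]; push_cast; ring⟩
    · rw [hy, hb]
      exact abs_edge b f
    · rw [h4, hb]
      intro _ _
      ring

theorem pathGF_of_not_range {t a b : ℚ} (hb : ¬ (1 ≤ b ∧ b ≤ t)) (e f : Fin 2) (N : ℕ) :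
    pathGF t a b e f N = 0 := by
  unfold pathGF
  refine Finset.sum_eq_zero fun h hh => absurd ?_ hb
  rw [Set.Finite.mem_toFinset] at hh
  obtain ⟨-, h2, -, h4, -⟩ := hh
  have := h2 (Fin.last _)
  have h4' : h (Fin.last N).succ.castSucc = b := h4
  rwa [h4'] at this

open Classical in
-- Split by the edge that arrives at `b`. Arriving from above and leaving upwards is a valley,
-- allowed only at integral `b`; the new vertex has weight only if both edges point the same way.
theorem pathGF_succ {t a b : ℚ} (hb : 1 ≤ b ∧ b ≤ t) (e f : Fin 2) (N : ℕ) :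
    pathGF t a b e f (N + 1) =
      (if f = 0 → ∃ z : ℤ, b = z then
        qPow ((if f = 1 then ((N : ℚ) + 1) / 4 else 0)) * pathGF t a (b + 1 / 2) e 1 N else 0) +
      qPow ((if f = 1 then 0 else ((N : ℚ) + 1) / 4)) * pathGF t a (b - 1 / 2) e 0 N := by
  set y : ℚ := b + 1 / 2 - ((f : ℕ) : ℚ) with hy
  set S1 : Finset (Fin (N + 3) → ℚ) := if f = 0 → ∃ z : ℤ, b = z then
    (finite_pathSet t a (b + 1 / 2) e 1 N).toFinset else ∅ with hS1
  set S2 := (finite_pathSet t a (b - 1 / 2) e 0 N).toFinset with hS2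
  have hmem1 : ∀ g, g ∈ S1 ↔ g ∈ pathSet t a (b + 1 / 2) e 1 N ∧ (f = 0 → ∃ z : ℤ, b = z) := by
    intro g
    rw [hS1]
    split_ifs with h
    · simp only [Set.Finite.mem_toFinset]; tauto
    · simp only [Finset.notMem_empty, false_iff]; tauto
  have hmem2 : ∀ g, g ∈ S2 ↔ g ∈ pathSet t a (b - 1 / 2) e 0 N := fun g => by
    rw [hS2, Set.Finite.mem_toFinset]
  have hset : (finite_pathSet t a b e f (N + 1)).toFinset =
      (S1 ∪ S2).image (fun g => (Fin.snoc g y : Fin (N + 3 + 1) → ℚ)) := by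
    ext h
    rw [Set.Finite.mem_toFinset, Finset.mem_image]
    constructor
    · intro hh
      have hs : h = (Fin.snoc (fun j => h j.castSucc) (h (Fin.last (N + 3))) :
        Fin (N + 3 + 1) → ℚ) := (Fin.snoc_init_self h).symm
      rw [hs] at hh
      obtain ⟨-, h2, h3⟩ := (snoc_mem_pathSet _ _).1 hh
      refine ⟨fun j => h j.castSucc, ?_, ?_⟩
      · rw [Finset.mem_union, hmem1, hmem2]; exact h3
      · rw [hy, ← h2]; exact hs.symm
    · rintro ⟨g, hg, rfl⟩
      rw [Finset.mem_union, hmem1, hmem2] at hg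
      exact (snoc_mem_pathSet _ _).2 ⟨hb, hy, hg⟩
  have hdisj : Disjoint S1 S2 := by
    rw [Finset.disjoint_left]
    intro g hg1 hg2
    rw [hmem1] at hg1
    rw [hmem2] at hg2
    have := hg1.1.2.2.2.1
    have := hg2.2.2.2.1
    linarith
  have hinj : Function.Injective (fun g => (Fin.snoc g y : Fin (N + 3 + 1) → ℚ)) := by
    intro g1 g2 h12
    funext j
    have := congrFun h12 j.castSucc
    simpa only [Fin.snoc_castSucc] using this
  rw [pathGF, hset, Finset.sum_image hinj.injOn, Finset.sum_union hdisj]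
  have key : ∀ (r : ℚ) (S : Finset (Fin (N + 3) → ℚ)),
      (∀ g ∈ S, ((N : ℚ) + 1) / 4 * |y - g ⟨N + 1, by omega⟩| = r) →
      ∑ g ∈ S, qPow (weight (N + 1) (Fin.snoc g y : Fin (N + 3 + 1) → ℚ)) =
        qPow r * ∑ g ∈ S, qPow (weight N g) := by
    intro r S hS
    rw [Finset.mul_sum]
    refine Finset.sum_congr rfl fun g hg => ?_
    rw [weight_snoc, hS g hg, add_comm, qPow_add]
  congr 1
  · rw [key (if f = 1 then ((N : ℚ) + 1) / 4 else 0) S1]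
    · rw [hS1]
      split_ifs <;> simp [pathGF]
    · intro g hg
      have := ((hmem1 g).1 hg).1.2.2.2.1
      rw [this, hy, show b + 1 / 2 - ((f : ℕ) : ℚ) - (b + 1 / 2) = - ((f : ℕ) : ℚ) by ring]
      fin_cases f <;> simp
  · rw [key (if f = 1 then 0 else ((N : ℚ) + 1) / 4) S2]
    · rfl
    · intro g hg
      have := ((hmem2 g).1 hg).2.2.2.1
      rw [this, hy, show b + 1 / 2 - ((f : ℕ) : ℚ) - (b - 1 / 2) = 1 - ((f : ℕ) : ℚ) by ring]
      fin_cases f <;> simp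

open Classical in
theorem pathGF_zero {t a b : ℚ} (hab : IsHalfInt a) (ha : 1 ≤ a ∧ a ≤ t) (e f : Fin 2) :
    pathGF t a b e f 0 = if a = b ∧ (e = 0 ∧ f = 0 → ∃ z : ℤ, a = z) then 1 else 0 := by
  have hmem : ∀ h : Fin 3 → ℚ, h ∈ pathSet t a b e f 0 ↔
      (a = b ∧ (e = 0 ∧ f = 0 → ∃ z : ℤ, a = z)) ∧
        h = ![a + 1 / 2 - ((e : ℕ) : ℚ), a, a + 1 / 2 - ((f : ℕ) : ℚ)] := by
    intro h
    obtain ⟨z, hz⟩ := hab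
    constructor
    · rintro ⟨h1, h2, h3, h4, h5, h6⟩
      have h3' : h 1 = a := h3
      have h4' : h 1 = b := h4
      have h5' : h 0 = a + 1 / 2 - ((e : ℕ) : ℚ) := h5
      have h6' : h 2 = b + 1 / 2 - ((f : ℕ) : ℚ) := h6
      have hab : a = b := h3'.symm.trans h4'
      refine ⟨⟨hab, ?_⟩, ?_⟩
      · rintro ⟨rfl, rfl⟩
        have hv : h 0 = h 2 → (∃ z : ℤ, h 0 = z) → h 1 = h 0 + 1 / 2 := h1.valley 0
        rcases Int.even_or_odd' z with ⟨c, rfl | rfl⟩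
        · exact ⟨c, by rw [hz]; push_cast; ring⟩
        · exfalso
          have := hv (by rw [h5', h6', hab]) ⟨c + 1, by rw [h5', hz]; simp; ring⟩
          rw [h3', h5'] at this
          simp at this
          linarith
      · funext j
        fin_cases j
        · exact h5'
        · exact h3'
        · simpa [hab] using h6'
    · rintro ⟨⟨rfl, hv⟩, rfl⟩
      refine ⟨⟨?_, ?_, ?_⟩, ?_, rfl, rfl, rfl, rfl⟩
      · intro k
        fin_cases k
        · exact ⟨z + 1 - 2 * (e : ℕ), by simp [hz]; ring⟩
        · exact ⟨z, hz⟩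
        · exact ⟨z + 1 - 2 * (f : ℕ), by simp [hz]; ring⟩
      · intro k
        fin_cases k
        · change |a - (a + 1 / 2 - ((e : ℕ) : ℚ))| = 1 / 2
          rw [abs_sub_comm]
          exact abs_edge a e
        · change |(a + 1 / 2 - ((f : ℕ) : ℚ)) - a| = 1 / 2
          exact abs_edge a f
      · intro k
        obtain rfl : k = 0 := Fin.ext (by omega)
        change a + 1 / 2 - ((e : ℕ) : ℚ) = a + 1 / 2 - ((f : ℕ) : ℚ) →
          (∃ z : ℤ, a + 1 / 2 - ((e : ℕ) : ℚ) = z) → a = a + 1 / 2 - ((e : ℕ) : ℚ) + 1 / 2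
        intro h1 ⟨z', hz'⟩
        fin_cases e
        · have hf : f = 0 := by
            fin_cases f
            · rfl
            · exfalso; norm_num at h1; linarith
          obtain ⟨w, hw⟩ := hv ⟨rfl, hf⟩
          exfalso
          rw [hw] at hz'
          simp at hz'
          have : (2 * w + 1 : ℤ) = 2 * z' := by
            have : (2 * w + 1 : ℚ) = 2 * z' := by linarith
            exact_mod_cast this
          omega
        · norm_num; ring
      · intro k
        obtain rfl : k = 0 := Fin.ext (by omega)
        exact ha
  unfold pathGF
  split_ifs with h
  · rw [Finset.sum_eq_single ![a + 1 / 2 - ((e : ℕ) : ℚ), a, a + 1 / 2 - ((f : ℕ) : ℚ)]]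
    · simp [weight, qPow_zero]
    · intro g hg hne
      rw [Set.Finite.mem_toFinset] at hg
      exact absurd ((hmem g).1 hg).2 hne
    · intro hne
      rw [Set.Finite.mem_toFinset] at hne
      exact absurd ((hmem _).2 ⟨h, rfl⟩) hne
  · refine Finset.sum_eq_zero fun g hg => ?_
    rw [Set.Finite.mem_toFinset] at hg
    exact absurd ((hmem g).1 hg).1 h

section

variable {T A : ℤ} {e : Bool}

theorem innerGF_zero (hA : 2 ≤ A) (hAT : A ≤ T) (f : Bool) (B p : ℤ) :
    innerGF T e A f B 0 p =
      if B = A ∧ p = (if e = true ∧ f = true then 1 else 0) ∧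
        (e = false ∧ f = false → Even B) then 1 else 0 := by
  have hI := isArrival_arrival T (pointSource 0 e A 0 0)
  have h0 := hI.at_source le_rfl hA hAT
  cases f
  · simp only [innerGF, Bool.false_eq_true, if_false, leaveUp, h0, pointSource]
    cases e
    · simp only [true_and, qPow_zero]
      by_cases hB : Even B <;> simp [hB]
    · simp [qPow_zero]
  · simp only [innerGF, if_true, leaveDown, h0, pointSource]
    cases e
    · simp [qPow_zero]
    · simp [qPow_zero, sub_eq_zero]

theorem innerGF_succ_true {B : ℤ} (hB : 2 ≤ B) (hBT : B ≤ T) (N : ℕ) (p : ℤ) :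
    innerGF T e A true B (N + 1 : ℕ) p =
      qPow (((N : ℚ) + 1) / 4) * innerGF T e A true (B + 1) N p +
        innerGF T e A false (B - 1) N (p - 1) := by
  have hI := isArrival_arrival T (pointSource 0 e A 0 0)
  simp only [innerGF, if_true, Bool.false_eq_true, if_false]
  rw [leaveDown, hI.down _ _ _ (by omega) hB hBT, hI.up _ _ _ (by omega) hB hBT,
    pointSource_of_gt _ _ _ _ (by push_cast; omega),
    pointSource_of_gt _ _ _ _ (by push_cast; omega),
    show ((N + 1 : ℕ) : ℤ) - 1 = N by push_cast; ring]
  simp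

theorem innerGF_succ_false {B : ℤ} (hB : 2 ≤ B) (hBT : B ≤ T) (N : ℕ) (p : ℤ) :
    innerGF T e A false B (N + 1 : ℕ) p =
      (if Even B then innerGF T e A true (B + 1) N p else 0) +
      qPow (((N : ℚ) + 1) / 4) * innerGF T e A false (B - 1) N p := by
  have hI := isArrival_arrival T (pointSource 0 e A 0 0)
  simp only [innerGF, if_true, Bool.false_eq_true, if_false]
  rw [leaveUp, hI.down _ _ _ (by omega) hB hBT, hI.up _ _ _ (by omega) hB hBT,
    pointSource_of_gt _ _ _ _ (by push_cast; omega),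
    pointSource_of_gt _ _ _ _ (by push_cast; omega),
    show ((N + 1 : ℕ) : ℤ) - 1 = N by push_cast; ring]
  simp [add_comm]

theorem innerGF_out {B : ℤ} (hB : ¬ (2 ≤ B ∧ B ≤ T)) (f : Bool) (N p : ℤ) :
    innerGF T e A f B N p = 0 := by
  have hI := isArrival_arrival T (pointSource 0 e A 0 0)
  unfold innerGF
  split_ifs
  · exact hI.leaveDown_out hB _ _
  · exact hI.leaveUp_out hB _ _

/-- Each peak needs its own vertex, and there are `N + 1` of them. This makes the sum over the
number of peaks finite. -/
theorem innerGF_eq_zero_of_peaks (hA : 2 ≤ A) (hAT : A ≤ T) (f : Bool) (B : ℤ) (N : ℕ) (p : ℤ)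
    (hp : p < 0 ∨ (N : ℤ) + 1 < p) : innerGF T e A f B N p = 0 := by
  induction N generalizing f B p with
  | zero =>
    rw [Nat.cast_zero, innerGF_zero hA hAT, if_neg]
    rintro ⟨-, h, -⟩
    split_ifs at h <;> omega
  | succ N ih =>
    by_cases hB : 2 ≤ B ∧ B ≤ T
    · push_cast at hp
      cases f
      · rw [innerGF_succ_false hB.1 hB.2, ih _ _ _ (by omega), ih _ _ _ (by omega)]
        simp
      · rw [innerGF_succ_true hB.1 hB.2, ih _ _ _ (by omega), ih _ _ _ (by omega)]
        simp
    · exact innerGF_out hB _ _ _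

end

theorem even_iff_exists_intCast {x : ℚ} {X : ℤ} (hX : 2 * x = X) :
    (∃ z : ℤ, x = z) ↔ Even X := by
  constructor
  · rintro ⟨z, rfl⟩
    exact ⟨z, by have : (2 * z : ℤ) = X := by exact_mod_cast hX
                 omega⟩
  · rintro ⟨z, rfl⟩
    exact ⟨z, by push_cast at hX; linarith⟩

/-- The generating function of half-lattice paths, by number of peaks. -/
theorem pathGF_eq_sum_innerGF {T A : ℤ} {t a : ℚ} (hT : 2 * t = T) (hA : 2 * a = A) (hA2 : 2 ≤ A)
    (hAT : A ≤ T) (e : Fin 2) (N : ℕ) {b : ℚ} {B : ℤ} (hB : 2 * b = B) (f : Fin 2) :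
    pathGF t a b e f N =
      ∑ p ∈ Finset.range (N + 2), innerGF T (decide (e = 1)) A (decide (f = 1)) B N p := by
  have hrange : ∀ {b : ℚ} {B : ℤ}, 2 * b = B → (1 ≤ b ∧ b ≤ t ↔ 2 ≤ B ∧ B ≤ T) := by
    intro b B hB
    rw [← @Int.cast_le ℚ, ← @Int.cast_le ℚ, ← hB, ← hT]
    push_cast
    constructor <;> rintro ⟨h1, h2⟩ <;> constructor <;> linarith
  induction N generalizing b B f with
  | zero =>
    rw [pathGF_zero ⟨A, by linarith⟩ ((hrange hA).2 ⟨hA2, hAT⟩)]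
    have hab : a = b ↔ B = A := by
      rw [← @Int.cast_inj ℚ, ← hA, ← hB]
      constructor <;> intro h <;> linarith
    simp only [Nat.cast_zero, innerGF_zero hA2 hAT, even_iff_exists_intCast hA, hab,
      Finset.sum_range_succ, Finset.sum_range_zero]
    by_cases hBA : B = A
    · subst hBA
      fin_cases e <;> fin_cases f <;> simp
    · simp [hBA]
  | succ N ih =>
    by_cases hr : 2 ≤ B ∧ B ≤ T
    · have h1 : 2 * (b + 1 / 2) = ((B + 1 : ℤ) : ℚ) := by push_cast; linarith
      have h2 : 2 * (b - 1 / 2) = ((B - 1 : ℤ) : ℚ) := by push_cast; linarith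
      have hz : ∀ f B, innerGF T (decide (e = 1)) A f B N ((N + 2 : ℕ) : ℤ) = 0 := fun f B =>
        innerGF_eq_zero_of_peaks hA2 hAT _ _ _ _ (by push_cast; omega)
      have hsum : ∀ f B, ∑ p ∈ Finset.range (N + 1 + 2), innerGF T (decide (e = 1)) A f B N p =
          ∑ p ∈ Finset.range (N + 2), innerGF T (decide (e = 1)) A f B N p := fun f B => by
        rw [show N + 1 + 2 = N + 2 + 1 by ring, Finset.sum_range_succ, hz, add_zero]
      have hsum' : ∀ f B, ∑ p ∈ Finset.range (N + 1 + 2),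
          innerGF T (decide (e = 1)) A f B N ((p : ℤ) - 1) =
          ∑ p ∈ Finset.range (N + 2), innerGF T (decide (e = 1)) A f B N p := fun f B => by
        rw [show N + 1 + 2 = N + 2 + 1 by ring, Finset.sum_range_succ',
          innerGF_eq_zero_of_peaks hA2 hAT _ _ _ _ (by simp), add_zero]
        simp
      rw [pathGF_succ ((hrange hB).2 hr), ih h1, ih h2]
      simp only [even_iff_exists_intCast hB, decide_true]
      have d0 : decide ((0 : Fin 2) = 1) = false := rfl
      rw [d0]
      fin_cases f
      · change _ = ∑ p ∈ Finset.range (N + 1 + 2),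
          innerGF T (decide (e = 1)) A false B (N + 1 : ℕ) p
        simp only [innerGF_succ_false hr.1 hr.2, Finset.sum_add_distrib, ← Finset.mul_sum, hsum]
        by_cases hE : Even B <;> simp [hE, qPow_zero, hsum]
      · change _ = ∑ p ∈ Finset.range (N + 1 + 2),
          innerGF T (decide (e = 1)) A true B (N + 1 : ℕ) p
        simp only [innerGF_succ_true hr.1 hr.2, Finset.sum_add_distrib, ← Finset.mul_sum, hsum,
          hsum']
        simp [qPow_zero]
    · rw [pathGF_of_not_range (fun h => hr ((hrange hB).1 h))]
      exact (Finset.sum_eq_zero fun p _ => innerGF_out hr _ _ _).symm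

/-! ### The exponent -/

/-- Quadratic form of the Cartan matrix of type `A`. -/
theorem cartanMatrix_A_quadratic (r : ℕ) (V : ℕ → ℤ) (hV : V (r + 1) = 0) :
    ((fun i : Fin r => V (i + 1)) ⬝ᵥ (CartanMatrix.A r *ᵥ fun i : Fin r => V (i + 1))) =
      2 * ∑ i ∈ Finset.range r, V (i + 1) * (V (i + 1) - V (i + 2)) := by
  have hmul : ∀ i : Fin r, (CartanMatrix.A r *ᵥ fun i : Fin r => V (i + 1)) i =
      2 * V (i + 1) - (if (i : ℕ) = 0 then 0 else V i) - V (i + 2) := by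
    intro i
    have hi := i.2
    have h1 : ∀ c, ∑ j ∈ Finset.range r, (if c = j then V (j + 1) else 0) =
        if c < r then V (c + 1) else 0 := fun c => by
      rw [Finset.sum_ite_eq]; simp
    have h2 : V (i + 2) = if (i : ℕ) + 1 < r then V (i + 2) else 0 := by
      split_ifs with h
      · rfl
      · rw [show (i : ℕ) + 2 = r + 1 by omega, hV]
    have h3 : (if (i : ℕ) = 0 then 0 else V i) =
        ∑ j ∈ Finset.range r, if j + 1 = (i : ℕ) then V (j + 1) else 0 := by
      rcases Nat.eq_zero_or_eq_succ_pred (i : ℕ) with h | h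
      · rw [if_pos h, Finset.sum_eq_zero]
        intro j _
        rw [if_neg (by omega)]
      · rw [h]
        simp only [Nat.succ_eq_add_one, Nat.add_right_cancel_iff, Nat.succ_ne_zero, if_false]
        rw [Finset.sum_ite_eq', if_pos (Finset.mem_range.2 (by omega))]
    rw [h2, h3, show (i : ℕ) + 2 = (i : ℕ) + 1 + 1 by ring, ← h1]
    have h4 : 2 * V (i + 1) =
        2 * ∑ j ∈ Finset.range r, if (i : ℕ) = j then V (j + 1) else 0 := by
      rw [h1, if_pos hi]
    rw [h4, Finset.mul_sum, ← Finset.sum_sub_distrib, ← Finset.sum_sub_distrib,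
      Finset.sum_range, Matrix.mulVec, dotProduct]
    refine Finset.sum_congr rfl fun j _ => ?_
    simp only [CartanMatrix.A, Matrix.of_apply, Fin.ext_iff]
    split_ifs <;> omega
  have hsum : ∀ i ∈ Finset.range r, V (i + 1) *
      (2 * V (i + 1) - (if i = 0 then 0 else V i) - V (i + 2)) =
      2 * (V (i + 1) * (V (i + 1) - V (i + 2))) +
        ((if i + 1 = 0 then 0 else V (i + 1) * V (i + 1 + 1)) -
          (if i = 0 then 0 else V i * V (i + 1))) := by
    intro i _
    rw [if_neg (Nat.succ_ne_zero i)]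
    split_ifs <;> ring
  rw [dotProduct]
  simp only [hmul]
  rw [← Finset.sum_range fun i => V (i + 1) *
    (2 * V (i + 1) - (if i = 0 then 0 else V i) - V (i + 2)), Finset.sum_congr rfl hsum,
    Finset.sum_add_distrib, ← Finset.mul_sum,
    Finset.sum_range_sub (fun i => if i = 0 then 0 else V i * V (i + 1)), hV]
  simp

/-- Summation by parts for the exponent of the fermionic sum. -/
theorem sum_by_parts (k : ℕ) (M DL DR : ℕ → ℚ) (hM : M k = 0) (hM' : M (k + 1) = 0)
    (hL : DL k = 0) (hR : DR k = 0) :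
    ∑ j ∈ Finset.range k, ((M (j + 1) - M (j + 2)) * M (j + 1)
        + (M j - 2 * M (j + 1) + M (j + 2)) * DR (j + 1)
        - (M (j + 1) - DL (j + 1) - DR (j + 1)) *
          ((M (j + 1) - DL (j + 1) - DR (j + 1)) - (M (j + 2) - DL (j + 2) - DR (j + 2)))) =
      ∑ j ∈ Finset.range k, (DR j - 2 * DR (j + 1) + DR (j + 2)) * DR (j + 1) / 2
      - ∑ j ∈ Finset.range k, (DL j - 2 * DL (j + 1) + DL (j + 2)) *
        (M (j + 1) - DL (j + 1) - DR (j + 1) + DL (j + 1) / 2)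
      + (M 0 * DR 1 + M 1 * DL 0 - (DL 0 + DR 0) * (DL 1 + DR 1) / 2
        - DR 1 * DL 0 / 2 + DR 0 * DL 1 / 2) := by
  -- A discrete antiderivative of the difference of the summands. It vanishes at `k`, so only its
  -- value at `0` remains as a boundary term.
  set G : ℕ → ℚ := fun i => M i * DR (i + 1) + M (i + 1) * DL i
    - (DL i + DR i) * (DL (i + 1) + DR (i + 1)) / 2
    - DR (i + 1) * DL i / 2 + DR i * DL (i + 1) / 2 with hG
  have h0 : M 0 * DR 1 + M 1 * DL 0 - (DL 0 + DR 0) * (DL 1 + DR 1) / 2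
      - DR 1 * DL 0 / 2 + DR 0 * DL 1 / 2 = G 0 - G k := by
    simp [hG, hM, hM', hL, hR]
  rw [h0, ← Finset.sum_range_sub', ← Finset.sum_sub_distrib, ← Finset.sum_add_distrib]
  refine Finset.sum_congr rfl fun j _ => ?_
  simp only [hG]
  ring

/-- The index at which `sideAt` has a corner. -/
def corner (T : ℤ) (e : Bool) (A : ℤ) : ℤ := if e = true then A - 2 else T - A

/-- The extension length is piecewise linear in the stage, with slope changing by one at the stage
where the end point meets the floor or the ceiling. This corner is the source of the index `ℓ`. -/
theorem sideAt_second_difference (T : ℤ) (e : Bool) (A i : ℤ) :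
    sideAt T e A i - 2 * sideAt T e A (i + 1) + sideAt T e A (i + 2) =
      if i + 1 = corner T e A then 1 else 0 := by
  unfold sideAt pabs corner; cases e <;> simp <;> split_ifs <;> omega

theorem sum_second_difference_mul {k : ℕ} {e : Bool} {A : ℤ} (h1 : 1 ≤ corner (k + 2) e A)
    (h2 : corner (k + 2) e A ≤ k) (X : ℤ → ℚ) :
    ∑ j ∈ Finset.range k, ((sideAt (k + 2) e A (j : ℕ) : ℚ)
      - 2 * sideAt (k + 2) e A ((j + 1 : ℕ) : ℤ) + sideAt (k + 2) e A ((j + 2 : ℕ) : ℤ)) *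
        X ((j + 1 : ℕ) : ℤ) = X (corner (k + 2) e A) := by
  obtain ⟨c, hc⟩ : ∃ c : ℕ, corner (k + 2) e A = ((c + 1 : ℕ) : ℤ) :=
    ⟨(corner (k + 2) e A - 1).toNat, by push_cast; omega⟩
  rw [hc] at h2 ⊢
  have key : ∀ j ∈ Finset.range k, ((sideAt (k + 2) e A (j : ℕ) : ℚ)
      - 2 * sideAt (k + 2) e A ((j + 1 : ℕ) : ℤ) + sideAt (k + 2) e A ((j + 2 : ℕ) : ℤ)) *
        X ((j + 1 : ℕ) : ℤ) = if j = c then X ((j + 1 : ℕ) : ℤ) else 0 := by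
    intro j _
    have h := sideAt_second_difference (k + 2) e A j
    rw [hc] at h
    have h' : (sideAt (k + 2) e A (j : ℕ) : ℚ) - 2 * sideAt (k + 2) e A ((j + 1 : ℕ) : ℤ)
        + sideAt (k + 2) e A ((j + 2 : ℕ) : ℤ) = if j = c then 1 else 0 := by
      push_cast at h ⊢
      have : ((j : ℤ) + 1 = c + 1) ↔ j = c := by omega
      simp only [this] at h
      split_ifs at h ⊢ <;> exact_mod_cast h
    rw [h']
    simp
  rw [Finset.sum_congr rfl key, Finset.sum_ite_eq', if_pos (Finset.mem_range.2 (by omega))]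

/-- The exponent by which the extended paths differ from the original ones. -/
def extensionWeight (T : ℤ) (e : Bool) (A : ℤ) (f : Bool) (B N p : ℤ) : ℚ :=
  rightWeight T f B (N + sideTime T e A) + leftWeight T e A +
    sideTime T e A * (N - 2 * p + (2 - edgePeak f) - edgePeak e) / 4

/-- The numbers `m_i`. -/
def freeLength (T : ℤ) (e : Bool) (A : ℤ) (f : Bool) (B : ℤ) {k : ℕ} (n : Fin k → ℕ) (i : ℤ) : ℤ :=
  tailLength n i - sideAt T e A i - sideAt T f B i

/-- The exponent of a vector, after removal of the weight of the extension. -/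
def reducedExponent (T : ℤ) (e : Bool) (A : ℤ) (f : Bool) (B : ℤ) {k : ℕ} (n : Fin k → ℕ) : ℚ :=
  1 / 4 * ((∑ j ∈ Finset.range k, freeLength T e A f B n ((j + 1 : ℕ) : ℤ) *
      (freeLength T e A f B n ((j + 1 : ℕ) : ℤ) - freeLength T e A f B n ((j + 2 : ℕ) : ℤ)) : ℤ) : ℚ)
    - 1 / 4 * (freeLength T e A f B n (corner T e A) : ℚ)
    + 1 / 2 * ((∑ j : Fin k, (n j : ℤ) * (heightAt T f B ((j : ℕ) + 1) % 2) : ℤ) : ℚ)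

theorem corner_pos {T : ℤ} {e : Bool} {A : ℤ} (he : EndAllowed T e A) : 1 ≤ corner T e A := by
  cases e <;> simp [EndAllowed, corner] at * <;> omega

theorem corner_le {T : ℤ} {e : Bool} {A : ℤ} (hA : 2 ≤ A) (hAT : A ≤ T) :
    corner T e A ≤ T - 2 := by
  cases e <;> simp [corner] <;> omega

theorem sideAt_one {T : ℤ} {e : Bool} {A : ℤ} (he : EndAllowed T e A) :
    sideAt T e A 1 = sideTime T e A - if e = true then 1 else 2 := by
  cases e <;> simp [EndAllowed, sideAt, sideTime, pabs] at * <;> (try split_ifs) <;> omega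

theorem sideAt_corner {T : ℤ} (e : Bool) {A : ℤ} :
    sideAt T e A (corner T e A) = if e = true then 0 else A - 2 := by
  cases e <;> simp [sideAt, corner, pabs]

/-- Entries and tail counts are second and first differences of `tailLength`, so the exponent is
quadratic in it. Summation by parts compares it with the quadratic form in `tailLength` minus the
extension lengths. The second differences of these lengths pick out the values at the corners,
leaving `m_ℓ` and constants; the boundary terms at stages `0` and `1` make up the extension weight.
-/
theorem exponent_extended {k : ℕ} {e f : Bool} {A B : ℤ} (hA : 2 ≤ A) (hAT : A ≤ k + 2)
    (hB : 2 ≤ B) (hBT : B ≤ k + 2) (he : EndAllowed (k + 2) e A) (hf : EndAllowed (k + 2) f B)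
    (n : Fin k → ℕ) (N p : ℤ)
    (hM : tailLength n 0 = N + sideTime (k + 2) e A + sideTime (k + 2) f B)
    (hp : tailCount n 0 = p + edgePeak e + edgePeak f) :
    ∑ j : Fin k, ((tailCount n ((j : ℕ) + 1) : ℚ) * tailLength n ((j : ℕ) + 1) / 2
      + n j * ((sideAt (k + 2) f B ((j : ℕ) + 1) + heightAt (k + 2) f B ((j : ℕ) + 1) % 2 : ℤ) : ℚ)
        / 2) =
      extensionWeight (k + 2) e A f B N p + reducedExponent (k + 2) e A f B n := by
  have hL1 := corner_pos he
  have hL2 : corner (k + 2) e A ≤ k := by have := corner_le (e := e) hA hAT; omega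
  have hR1 := corner_pos hf
  have hR2 : corner (k + 2) f B ≤ k := by have := corner_le (e := f) hB hBT; omega
  set M : ℕ → ℚ := fun i => tailLength n i with hMd
  set DL : ℕ → ℚ := fun i => sideAt (k + 2) e A i with hDL
  set DR : ℕ → ℚ := fun i => sideAt (k + 2) f B i with hDR
  have key := sum_by_parts k M DL DR
    (by simp [hMd, tailLength_of_le n le_rfl])
    (by simp only [hMd]; rw [tailLength_of_le n (by push_cast; omega)]; simp)
    (by simp [hDL, sideAt_top e hA hAT]) (by simp [hDR, sideAt_top f hB hBT])
  have s1 := sum_second_difference_mul hR1 hR2 (fun i => (sideAt (k + 2) f B i : ℚ) / 2)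
  have s2 := sum_second_difference_mul hL1 hL2 (fun i => (tailLength n i : ℚ)
    - sideAt (k + 2) e A i - sideAt (k + 2) f B i + (sideAt (k + 2) e A i : ℚ) / 2)
  simp only [← mul_div_assoc] at s1
  rw [s1, s2] at key
  have hterm : ∑ j : Fin k, ((tailCount n ((j : ℕ) + 1) : ℚ) * tailLength n ((j : ℕ) + 1) / 2
      + n j * ((sideAt (k + 2) f B ((j : ℕ) + 1) + heightAt (k + 2) f B ((j : ℕ) + 1) % 2 : ℤ) : ℚ)
        / 2) = 1 / 4 * ∑ j ∈ Finset.range k, ((M (j + 1) - M (j + 2)) * M (j + 1)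
        + (M j - 2 * M (j + 1) + M (j + 2)) * DR (j + 1)) +
      1 / 2 * ((∑ j : Fin k, (n j : ℤ) * (heightAt (k + 2) f B ((j : ℕ) + 1) % 2) : ℤ) : ℚ) := by
    rw [Finset.sum_range, Int.cast_sum, Finset.mul_sum, Finset.mul_sum, ← Finset.sum_add_distrib]
    refine Finset.sum_congr rfl fun j _ => ?_
    have h1 : (tailCount n ((j : ℕ) + 1) : ℚ) = (M (j + 1) - M (j + 2)) / 2 := by
      have := tailLength_sub_succ n ((j : ℕ) + 1)
      have h : ((tailLength n ((j : ℕ) + 1) - tailLength n ((j : ℕ) + 1 + 1) : ℤ) : ℚ) =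
        2 * tailCount n ((j : ℕ) + 1) := by rw [this]; push_cast; ring
      simp only [hMd]
      push_cast at h ⊢
      rw [add_assoc, one_add_one_eq_two] at h
      linarith
    have h2 : (n j : ℚ) = (M j - 2 * M (j + 1) + M (j + 2)) / 2 := by
      have := tailLength_convex n j
      have h : ((tailLength n (j : ℕ) + tailLength n ((j : ℕ) + 2) : ℤ) : ℚ) =
        2 * tailLength n ((j : ℕ) + 1) + 2 * n j := by rw [this]; push_cast; ring
      simp only [hMd]
      push_cast at h ⊢
      linarith
    have h3 : (tailLength n ((j : ℕ) + 1) : ℚ) = M (j + 1) := by simp [hMd]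
    have h4 : (sideAt (k + 2) f B ((j : ℕ) + 1) : ℚ) = DR (j + 1) := by simp [hDR]
    rw [Int.cast_add, h1, h3, h4]
    push_cast
    rw [h2]
    ring
  have hfree : ((∑ j ∈ Finset.range k, freeLength (k + 2) e A f B n ((j + 1 : ℕ) : ℤ) *
      (freeLength (k + 2) e A f B n ((j + 1 : ℕ) : ℤ)
        - freeLength (k + 2) e A f B n ((j + 2 : ℕ) : ℤ)) : ℤ) : ℚ) =
      ∑ j ∈ Finset.range k, (M (j + 1) - DL (j + 1) - DR (j + 1)) *
          ((M (j + 1) - DL (j + 1) - DR (j + 1)) - (M (j + 2) - DL (j + 2) - DR (j + 2))) := by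
    rw [Int.cast_sum]
    refine Finset.sum_congr rfl fun j _ => ?_
    simp only [freeLength, hMd, hDL, hDR]
    push_cast
    ring
  rw [hterm, reducedExponent, hfree]
  rw [Finset.sum_sub_distrib] at key
  have hM0 : M 0 = N + sideTime (k + 2) e A + sideTime (k + 2) f B := by
    simp only [hMd]; rw [Nat.cast_zero, hM]; push_cast; ring
  have hM1 : M 1 = M 0 - 2 * (p + edgePeak e + edgePeak f) := by
    have h := tailLength_sub_succ n 0
    rw [hp, zero_add] at h
    have h' : (tailLength n 1 : ℚ) = tailLength n 0 - 2 * (p + edgePeak e + edgePeak f) := by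
      rw [show tailLength n 1 = tailLength n 0 - 2 * (p + edgePeak e + edgePeak f) by omega]
      push_cast; ring
    simpa [hMd] using h'
  have hL0 : DL 0 = sideTime (k + 2) e A := by
    simp only [hDL]; rw [Nat.cast_zero, sideAt_zero _ e hA hAT]
  have hR0 : DR 0 = sideTime (k + 2) f B := by
    simp only [hDR]; rw [Nat.cast_zero, sideAt_zero _ f hB hBT]
  have hL1 : DL 1 = sideTime (k + 2) e A - if e = true then 1 else 2 := by
    simp only [hDL]; rw [Nat.cast_one, sideAt_one he]; push_cast; rfl
  have hR1 : DR 1 = sideTime (k + 2) f B - if f = true then 1 else 2 := by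
    simp only [hDR]; rw [Nat.cast_one, sideAt_one hf]; push_cast; rfl
  have hcL := sideAt_corner (T := k + 2) e (A := A)
  have hcR := sideAt_corner (T := k + 2) f (A := B)
  simp only [freeLength]
  rw [hcL, hcR, hM1, hM0, hL0, hR0, hL1, hR1] at key
  rw [hcL]
  have key' := sub_eq_iff_eq_add.1 key
  rw [key']
  cases e <;> cases f <;>
    simp only [extensionWeight, leftWeight, rightWeight, edgePeak, sideTime, if_true, if_false,
      Bool.false_eq_true] <;> push_cast <;> ring

theorem qPow_sum {ι : Type*} (s : Finset ι) (r : ι → ℚ) :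
    qPow (∑ i ∈ s, r i) = ∏ i ∈ s, qPow (r i) := by
  classical
  induction s using Finset.induction_on with
  | empty => simp [qPow_zero]
  | insert a s ha ih => rw [Finset.sum_insert ha, Finset.prod_insert ha, qPow_add, ih]

/-! ### The fermionic sum for extended paths -/

/-- The product of `q`-binomials of a vector. -/
noncomputable def binomialProduct (T : ℤ) (e : Bool) (A : ℤ) (f : Bool) (B : ℤ) {k : ℕ}
    (n : Fin k → ℕ) : HahnSeries ℚ ℚ :=
  ∏ j : Fin k, qBinomMod (n j) ((freeLength T e A f B n ((j : ℕ) + 1)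
    - heightAt T e A ((j : ℕ) + 1) % 2 - heightAt T f B ((j : ℕ) + 1) % 2) / 2)

theorem extendedTerm_eq (T : ℤ) (e : Bool) (A : ℤ) (f : Bool) (B : ℤ) {k : ℕ} (n : Fin k → ℕ) :
    extendedTerm T e A f B n =
      qPow (∑ j : Fin k, ((tailCount n ((j : ℕ) + 1) : ℚ) * tailLength n ((j : ℕ) + 1) / 2
        + n j * ((sideAt T f B ((j : ℕ) + 1) + heightAt T f B ((j : ℕ) + 1) % 2 : ℤ) : ℚ) / 2)) *
      binomialProduct T e A f B n := by
  rw [extendedTerm, Finset.prod_mul_distrib, qPow_sum]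
  rfl

theorem tailLength_nonneg {k : ℕ} (n : Fin k → ℕ) (i : ℤ) : 0 ≤ tailLength n i := by
  unfold tailLength
  refine mul_nonneg (by norm_num) (Finset.sum_nonneg fun j _ => ?_)
  split_ifs with h
  · exact mul_nonneg (by omega) (by positivity)
  · exact le_rfl

theorem two_mul_sum_le_tailLength {k : ℕ} (n : Fin k → ℕ) :
    2 * ((∑ j, n j : ℕ) : ℤ) ≤ tailLength n 0 := by
  have h1 := tailLength_sub_succ n 0
  have h2 := tailLength_nonneg n (0 + 1)
  rw [tailCount_zero] at h1
  omega

theorem finite_tailLength_eq (k : ℕ) (M : ℤ) : {n : Fin k → ℕ | tailLength n 0 = M}.Finite := by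
  refine (Set.finite_Iic (fun _ : Fin k => M.toNat)).subset fun n hn j => ?_
  have h1 := two_mul_sum_le_tailLength n
  have h2 : n j ≤ ∑ j, n j := Finset.single_le_sum (fun _ _ => Nat.zero_le _) (Finset.mem_univ j)
  have h3 : tailLength n 0 = M := hn
  change n j ≤ M.toNat
  omega

theorem sum_antidiagonalTuple_eq {k : ℕ} (M : ℤ) (F : (Fin k → ℕ) → HahnSeries ℚ ℚ) {P : ℕ}
    (hP : M.toNat < P) :
    ∑ p ∈ Finset.range P, ∑ n ∈ Finset.Nat.antidiagonalTuple k p,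
      (if tailLength n 0 = M then F n else 0) =
    ∑ᶠ n ∈ {n : Fin k → ℕ | tailLength n 0 = M}, F n := by
  have hfin := finite_tailLength_eq k M
  rw [finsum_mem_eq_finite_toFinset_sum _ hfin,
    ← Finset.sum_fiberwise_of_maps_to (g := fun n : Fin k → ℕ => ∑ j, n j) (t := Finset.range P)]
  · refine Finset.sum_congr rfl fun p _ => ?_
    rw [← Finset.sum_filter]
    refine Finset.sum_congr ?_ fun _ _ => rfl
    ext n
    simp only [Finset.mem_filter, Finset.Nat.mem_antidiagonalTuple, Set.Finite.mem_toFinset,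
      Set.mem_ofPred_eq]
    tauto
  · intro n hn
    rw [Set.Finite.mem_toFinset] at hn
    have h1 := two_mul_sum_le_tailLength n
    have h3 : tailLength n 0 = M := hn
    rw [Finset.mem_range]
    omega

/-- Half-lattice paths by the vectors that describe the extended paths. -/
theorem pathGF_eq_finsum {k : ℕ} {A B : ℤ} {t a b : ℚ} (ht : 2 * t = ((k + 2 : ℤ) : ℚ))
    (ha : 2 * a = A) (hb : 2 * b = B) (hA : 2 ≤ A) (hAT : A ≤ k + 2) (hB : 2 ≤ B)
    (hBT : B ≤ k + 2) (e f : Fin 2) (he : EndAllowed (k + 2) (decide (e = 1)) A)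
    (hf : EndAllowed (k + 2) (decide (f = 1)) B) (N : ℕ) :
    pathGF t a b e f N =
      ∑ᶠ n ∈ {n : Fin k → ℕ | tailLength n 0 =
          N + sideTime (k + 2) (decide (e = 1)) A + sideTime (k + 2) (decide (f = 1)) B},
        qPow (reducedExponent (k + 2) (decide (e = 1)) A (decide (f = 1)) B n) *
          binomialProduct (k + 2) (decide (e = 1)) A (decide (f = 1)) B n := by
  rw [pathGF_eq_sum_innerGF ht ha hA hAT e N hb f]
  set e' := decide (e = 1)
  set f' := decide (f = 1)
  set M : ℤ := N + sideTime (k + 2) e' A + sideTime (k + 2) f' B with hM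
  obtain ⟨c, hc⟩ : ∃ c : ℕ, edgePeak e' + edgePeak f' = c :=
    ⟨(edgePeak e' + edgePeak f').toNat, by
      rw [Int.toNat_of_nonneg]
      unfold edgePeak; split_ifs <;> norm_num⟩
  have hinner : ∀ p : ℕ, innerGF (k + 2) e' A f' B N ((p : ℤ) - c) =
      ∑ n ∈ Finset.Nat.antidiagonalTuple k p, if tailLength n 0 = M then
        qPow (reducedExponent (k + 2) e' A f' B n) * binomialProduct (k + 2) e' A f' B n
      else 0 := by
    intro p
    have h1 := extendedGF_eq_innerGF hA hAT he hf N ((p : ℤ) - c)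
    rw [show (p : ℤ) - c + edgePeak e' + edgePeak f' = p by omega, ← hM,
      extendedGF_eq_sum' k e' f' hA hAT hB hBT (by omega) p] at h1
    -- The extension factor depends on the number of peaks but not on the vector, so it cancels for
    -- each `p` separately.
    rw [← mul_right_inj' (qPow_ne_zero _), ← h1, Finset.mul_sum]
    refine Finset.sum_congr rfl fun n hn => ?_
    rw [mul_ite, mul_zero]
    split_ifs with hn0
    · rw [extendedTerm_eq, exponent_extended hA hAT hB hBT he hf n N ((p : ℤ) - c) (hn0.trans hM)
        (by rw [tailCount_zero, Finset.Nat.mem_antidiagonalTuple.1 hn]; omega), qPow_mul_qPow_mul]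
      rfl
    · rfl
  -- The bound is large enough to include all vectors of total length `M`, and, after the shift by
  -- the `c` peaks of the extensions, all possible numbers of inner peaks. The additional terms
  -- vanish.
  rw [← sum_antidiagonalTuple_eq M _ (P := c + (N + 2 + M.toNat)) (by omega)]
  simp only [← hinner]
  rw [Finset.sum_range_add _ c, Finset.sum_eq_zero (s := Finset.range c), zero_add]
  · refine Finset.sum_subset_zero_on_sdiff (fun p hp => ?_) (fun p hp => ?_) (fun p _ => ?_)
    · rw [Finset.mem_range] at hp ⊢; omega
    · rw [Finset.mem_sdiff, Finset.mem_range, Finset.mem_range] at hp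
      exact innerGF_eq_zero_of_peaks hA hAT _ _ _ _ (by push_cast; omega)
    · congr 1; push_cast; ring
  · intro p hp
    rw [Finset.mem_range] at hp
    exact innerGF_eq_zero_of_peaks hA hAT _ _ _ _ (by omega)

/-! ### Comparison with the table of parameters -/

/-- `P` describes the extended paths, up to `2 s` steps at each level. -/
structure Describes (P : FermionicData) (T : ℤ) (e : Bool) (A : ℤ) (f : Bool) (B s : ℤ) : Prop where
  ell : P.ell = corner T e A
  delta : ∀ i, P.Delta i + 2 * s * (T - 2 - i) = sideAt T e A i + sideAt T f B i
  left : ∀ i, P.TL i = heightAt T e A i % 2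
  right : ∀ i, P.TR i = heightAt T f B i % 2

/-- Adding `s` to the last entry. -/
def addLast {r : ℕ} (s : ℕ) (n : Fin (r + 1) → ℕ) : Fin (r + 1) → ℕ :=
  fun j => n j + if j = Fin.last r then s else 0

theorem tailLength_addLast {r : ℕ} (s : ℕ) (n : Fin (r + 1) → ℕ) {i : ℤ} (hi : i ≤ r + 1) :
    tailLength (addLast s n) i = tailLength n i + 2 * s * (r + 1 - i) := by
  unfold tailLength addLast
  rw [Fin.sum_univ_castSucc, Fin.sum_univ_castSucc]
  have h : ∀ j : Fin r, (j.castSucc = Fin.last r) = False := fun j =>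
    eq_false (Fin.castSucc_lt_last j).ne
  simp only [h, if_false, if_true, add_zero, Fin.val_last]
  split_ifs with h1
  · push_cast; ring
  · obtain rfl : i = r + 1 := by omega
    ring

namespace Describes

variable {P : FermionicData} {r : ℕ} {e f : Bool} {A B : ℤ} {s : ℕ}

/-- Increasing the last entry by `s` adds `2 s (T - 2 - i)` to `tailLength`, exactly what `Delta`
omits. -/
theorem mVal_eq (h : Describes P (r + 3) e A f B s) (n : Fin (r + 3 - 2) → ℕ) {i : ℤ}
    (hi : i ≤ r + 1) : mVal P n i = freeLength (r + 3) e A f B (addLast s n) i := by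
  have h1 := h.delta i
  have h2 := tailLength_addLast s n hi
  have h3 : mVal P n i = tailLength (k := r + 1) n i - P.Delta i := rfl
  rw [h3, freeLength, h2]
  linear_combination -h1

theorem freeLength_top (hA : 2 ≤ A) (hAT : A ≤ r + 3) (hB : 2 ≤ B) (hBT : B ≤ r + 3)
    (n : Fin (r + 1) → ℕ) : freeLength (r + 3) e A f B n (r + 1) = 0 := by
  have h1 := sideAt_top (k := r + 1) e hA (by push_cast; omega)
  have h2 := sideAt_top (k := r + 1) f hB (by push_cast; omega)
  push_cast at h1 h2
  rw [show (r : ℤ) + 1 + 2 = r + 3 by ring] at h1 h2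
  rw [freeLength, tailLength_of_le n (by push_cast; omega), h1, h2]
  rfl

theorem heightAt_top (hA : 2 ≤ A) (hAT : A ≤ r + 3) : heightAt (r + 3) e A (r + 1) = 2 := by
  unfold heightAt pabs; split_ifs <;> omega

/-- The last entry enters the parity term with coefficient zero, since after the last reduction the
end height is `2`; and `m` vanishes there, so the sum over one more index has the same quadratic
form. -/
theorem exponent_eq (h : Describes P (r + 3) e A f B s) (hA : 2 ≤ A) (hAT : A ≤ r + 3) (hB : 2 ≤ B)
    (hBT : B ≤ r + 3) (n : Fin (r + 3 - 2) → ℕ) :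
    exponent P n = reducedExponent (r + 3) e A f B (addLast s n) := by
  set V : ℕ → ℤ := fun i => freeLength (r + 3) e A f B (addLast s n) i with hV
  have hV0 : V (r + 1) = 0 := by
    simp only [hV]; push_cast; exact freeLength_top hA hAT hB hBT _
  have h1 : mVec P n = fun i : Fin r => V (i + 1) := by
    funext i
    have := i.2
    simp only [mVec, hV]
    rw [h.mVal_eq n (by omega)]
    push_cast
    rfl
  have h2 : mVal P n P.ell = freeLength (r + 3) e A f B (addLast s n) (corner (r + 3) e A) := by
    rw [h.ell, h.mVal_eq]
    have := corner_le (T := r + 3) (e := e) hA hAT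
    omega
  have h3 : ∑ j : Fin (r + 3 - 2), (n j : ℤ) * P.TR ((j : ℕ) + 1) =
      ∑ j : Fin (r + 1), (addLast s n j : ℤ) * (heightAt (r + 3) f B ((j : ℕ) + 1) % 2) := by
    change ∑ j : Fin (r + 1), (n j : ℤ) * P.TR ((j : ℕ) + 1) = _
    refine Finset.sum_congr rfl fun j _ => ?_
    rw [h.right]
    by_cases hj : j = Fin.last r
    · subst hj
      rw [Fin.val_last, heightAt_top hB hBT]
      simp
    · simp [addLast, hj]
  have h4 := cartanMatrix_A_quadratic r V hV0
  rw [exponent, h1, h2, h3, reducedExponent, Finset.sum_range_succ]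
  change 1 / 8 * (((fun i : Fin r => V (i + 1)) ⬝ᵥ
    (CartanMatrix.A r *ᵥ fun i : Fin r => V (i + 1)) : ℤ) : ℚ) - _ + _ = _
  rw [h4]
  have h5 : freeLength (r + 3) e A f B (addLast s n) ((r + 1 : ℕ) : ℤ) = 0 := hV0
  rw [h5]
  simp only [hV]
  push_cast
  ring

/-- The table's product stops one factor earlier. The additional factor has second argument `0` and
equals `1`, whatever the last entry is. -/
theorem summand_eq (h : Describes P (r + 3) e A f B s) (hA : 2 ≤ A) (hAT : A ≤ r + 3) (hB : 2 ≤ B)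
    (hBT : B ≤ r + 3) (n : Fin (r + 3 - 2) → ℕ) :
    summand P n = qPow (reducedExponent (r + 3) e A f B (addLast s n)) *
      binomialProduct (r + 3) e A f B (addLast s n) := by
  rw [summand, h.exponent_eq hA hAT hB hBT, binomialProduct, Fin.prod_univ_castSucc]
  have hlast : qBinomMod (addLast s n (Fin.last r) : ℤ)
      ((freeLength (r + 3) e A f B (addLast s n) (((Fin.last r : Fin (r + 1)) : ℕ) + 1)
      - heightAt (r + 3) e A (((Fin.last r : Fin (r + 1)) : ℕ) + 1) % 2
      - heightAt (r + 3) f B (((Fin.last r : Fin (r + 1)) : ℕ) + 1) % 2) / 2) = 1 := by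
    rw [Fin.val_last, freeLength_top hA hAT hB hBT, heightAt_top hA hAT, heightAt_top hB hBT]
    exact qBinomMod_zero_right (by positivity)
  rw [hlast, mul_one]
  congr 1
  refine Finset.prod_congr rfl fun j _ => ?_
  have hj := j.2
  have hne : (Fin.castSucc (j : Fin r)) ≠ Fin.last r := (Fin.castSucc_lt_last _).ne
  rw [mHat, h.mVal_eq n (by omega), h.left, h.right]
  congr 2
  simp only [addLast, hne, if_false, add_zero]
  rfl

end Describes

/-- When both end edges descend, the last entry of a contributing vector is positive. -/
theorem pos_of_binomialProduct_ne_zero {r : ℕ} {A B : ℤ} (hA : 2 ≤ A) (hAT : A ≤ r + 3) (hB : 2 ≤ B)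
    (hBT : B ≤ r + 3) {n : Fin (r + 1) → ℕ}
    (h0 : sideTime (r + 3) false A + sideTime (r + 3) false B ≤ tailLength n 0)
    (hn : binomialProduct (r + 3) false A false B n ≠ 0) : 1 ≤ n (Fin.last r) := by
  have hT : ((r + 1 : ℕ) : ℤ) + 2 = r + 3 := by push_cast; ring
  have h := nonneg_of_extendedTerm_ne_zero (k := r + 1) (e := false) (f := false) hA (by omega) hB
    (by omega) (n := n) (by rwa [hT]) (by
      rw [extendedTerm_eq, hT]
      exact mul_ne_zero (qPow_ne_zero _) hn) r (by omega)
  rw [hT] at h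
  have h1 := tailLength_convex n (Fin.last r)
  rw [Fin.val_last, tailLength_of_le n (i := (r : ℤ) + 1) (by push_cast; omega),
    tailLength_of_le n (i := (r : ℤ) + 2) (by push_cast; omega)] at h1
  have h2 : ∀ X, X ≤ (r : ℤ) + 3 → 1 ≤ sideAt (r + 3) false X r := fun X hX => by
    simp only [sideAt, pabs, Bool.false_eq_true, if_false]
    split_ifs <;> omega
  have := h2 A hAT
  have := h2 B hBT
  omega

theorem addLast_injective {r : ℕ} (s : ℕ) : Function.Injective (addLast (r := r) s) := by
  intro m n h
  funext j
  have := congrFun h j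
  simpa [addLast] using this

/-- Increasing the last entry is injective, and its image contains every contributing vector: when
`s = 1`, such a vector has positive last entry, because both extensions still have length at the
stage before the last. -/
theorem Describes.finsum_eq {P : FermionicData} {r : ℕ} {e f : Bool} {A B : ℤ} {s : ℕ}
    (h : Describes P (r + 3) e A f B s) (hs : s = 0 ∨ (s = 1 ∧ e = false ∧ f = false))
    (hA : 2 ≤ A) (hAT : A ≤ r + 3) (hB : 2 ≤ B) (hBT : B ≤ r + 3) (N : ℕ) :
    ∑ᶠ n ∈ {n : Fin (r + 3 - 2) → ℕ | mVal P n 0 = N}, summand P n =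
      ∑ᶠ n ∈ {n : Fin (r + 1) → ℕ | tailLength n 0 =
          N + sideTime (r + 3) e A + sideTime (r + 3) f B},
        qPow (reducedExponent (r + 3) e A f B n) * binomialProduct (r + 3) e A f B n := by
  set F : (Fin (r + 1) → ℕ) → HahnSeries ℚ ℚ := fun n =>
    qPow (reducedExponent (r + 3) e A f B n) * binomialProduct (r + 3) e A f B n with hF
  have hiff : ∀ n : Fin (r + 1) → ℕ, mVal (T := r + 3) P n 0 = N ↔ tailLength (addLast s n) 0 =
      N + sideTime (r + 3) e A + sideTime (r + 3) f B := by
    intro n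
    rw [h.mVal_eq n (by omega), freeLength, sideAt_zero _ e hA hAT, sideAt_zero _ f hB hBT]
    omega
  have himg : ∑ᶠ n ∈ {n : Fin (r + 3 - 2) → ℕ | mVal P n 0 = N}, summand P n =
      ∑ᶠ n ∈ addLast s '' {n : Fin (r + 1) → ℕ | mVal (T := r + 3) P n 0 = N}, F n := by
    rw [finsum_mem_image (addLast_injective s).injOn]
    exact finsum_mem_congr rfl fun n _ => h.summand_eq hA hAT hB hBT n
  rw [himg]
  refine finsum_mem_inter_support_eq' _ _ _ fun n hn => ⟨?_, fun hn0 => ?_⟩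
  · rintro ⟨m, hm, rfl⟩
    exact (hiff m).1 hm
  · have hle : s ≤ n (Fin.last r) := by
      rcases hs with rfl | ⟨rfl, rfl, rfl⟩
      · exact Nat.zero_le _
      · have hn0' : tailLength n 0 = _ := hn0
        exact pos_of_binomialProduct_ne_zero hA hAT hB hBT (by omega) (right_ne_zero_of_mul hn)
    have hadd : addLast s (fun j => n j - if j = Fin.last r then s else 0) = n := by
      funext j
      unfold addLast
      split_ifs with hj
      · subst hj; simp only [if_true]; omega
      · simp [hj]
    refine ⟨_, ?_, hadd⟩
    refine (hiff _).2 ?_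
    rw [hadd]
    exact hn0

/-- An end that touches the ceiling contributes `T - 2 - i` to the extension length. The table keeps
this for one such end and drops both copies when there are two. -/
theorem describes_tableRow {T A B : ℤ} (e f : Fin 2) :
    Describes (tableRow T A B e f) T (decide (e = 1)) A (decide (f = 1)) B
      ((if e = 0 ∧ f = 0 then 1 else 0 : ℕ) : ℤ) := by
  fin_cases e <;> fin_cases f
  all_goals
    refine ⟨rfl, fun i => ?_, fun i => ?_, fun i => ?_⟩
    all_goals
      simp [tableRow, sideAt, heightAt, parityQ, parityR, pabs]
      try split_ifs <;> omega

theorem endAllowed_of_allowed {T A : ℤ} {t a : ℚ} (hT : 2 * t = T) (hA : 2 * a = A) (hA2 : 2 ≤ A)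
    (hAT : A ≤ T) {e : Fin 2} (h : Allowed t a e) : EndAllowed T (decide (e = 1)) A := by
  unfold Allowed at h
  unfold EndAllowed
  by_cases he : e = 1
  · simp only [he, decide_true, if_true] at h ⊢
    have : A ≠ 2 := by
      rintro rfl
      exact h (by push_cast at hA; linarith)
    omega
  · simp only [he, decide_false, if_false, Bool.false_eq_true] at h ⊢
    have : A ≠ T := by
      rintro rfl
      exact h (by linarith)
    omega

theorem mVal_top {T : ℕ} {A B : ℤ} (hT : 2 ≤ T) (hA : 2 ≤ A) (hAT : A ≤ T) (hB : 2 ≤ B)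
    (hBT : B ≤ T) (e f : Fin 2) (n : Fin (T - 2) → ℕ) :
    mVal (tableRow T A B e f) n ((T : ℤ) - 2) = 0 := by
  have h1 : mVal (tableRow T A B e f) n ((T : ℤ) - 2) =
    tailLength n ((T : ℤ) - 2) - (tableRow T A B e f).Delta ((T : ℤ) - 2) := rfl
  rw [h1, tailLength_of_le n (by omega)]
  fin_cases e <;> fin_cases f <;> simp only [tableRow, pabs] <;> split_ifs <;> omega

/-- In every row `Delta i` has the parity of `TL i + TR i`. For `parityR` this uses `x₊ - (-x)₊ =
x`, with `x = i + A - T`. -/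
theorem mHat_parity {T : ℕ} (A B : ℤ) (e f : Fin 2) (n : Fin (T - 2) → ℕ) (i : ℤ) :
    2 * mHat (tableRow T A B e f) n i =
      mVal (tableRow T A B e f) n i - (tableRow T A B e f).TL i - (tableRow T A B e f).TR i ∧
    (2 * mHat (tableRow T A B e f) n i = mVal (tableRow T A B e f) n i ∨
      2 * mHat (tableRow T A B e f) n i = mVal (tableRow T A B e f) n i - 1 ∨
      2 * mHat (tableRow T A B e f) n i = mVal (tableRow T A B e f) n i - 2) := by
  obtain ⟨x, hx⟩ : ∃ x, mVal (tableRow T A B e f) n i = 2 * x - (tableRow T A B e f).Delta i :=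
    ⟨_, rfl⟩
  unfold mHat
  rw [hx]
  fin_cases e <;> fin_cases f <;> simp only [tableRow, parityQ, parityR, pabs] <;> split_ifs <;>
    omega

end HalfLattice

theorem mainTheorem2 (T N : ℕ) (A B : ℤ) (t a b L : ℚ)
    (hT : 2 * t = (T : ℚ)) (hA : 2 * a = (A : ℚ)) (hB : 2 * b = (B : ℚ)) (hN : 2 * L = (N : ℚ))
    (ha1 : 1 ≤ a) (hat : a ≤ t) (hb1 : 1 ≤ b) (hbt : b ≤ t)
    (hLab : ∃ z : ℤ, L + a + b = (z : ℚ))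
    (e f : Fin 2)
    (hae : HalfLattice.Allowed t a e) (hbf : HalfLattice.Allowed t b f) :
    {n : Fin (T - 2) → ℕ |
      (HalfLattice.mVal (HalfLattice.tableRow T A B e f) n 0 : ℚ) = 2 * L}.Finite ∧
    HalfLattice.pathGF t a b e f N =
      (∑ᶠ n ∈ {n : Fin (T - 2) → ℕ |
        (HalfLattice.mVal (HalfLattice.tableRow T A B e f) n 0 : ℚ) = 2 * L},
        HalfLattice.summand (HalfLattice.tableRow T A B e f) n) ∧
    ∀ n : Fin (T - 2) → ℕ,
      HalfLattice.mVal (HalfLattice.tableRow T A B e f) n ((T : ℤ) - 2) = 0 ∧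
      ∀ i : ℤ, 1 ≤ i → i ≤ (T : ℤ) - 2 →
        2 * HalfLattice.mHat (HalfLattice.tableRow T A B e f) n i =
          HalfLattice.mVal (HalfLattice.tableRow T A B e f) n i
            - (HalfLattice.tableRow T A B e f).TL i - (HalfLattice.tableRow T A B e f).TR i ∧
        (2 * HalfLattice.mHat (HalfLattice.tableRow T A B e f) n i =
            HalfLattice.mVal (HalfLattice.tableRow T A B e f) n i ∨
          2 * HalfLattice.mHat (HalfLattice.tableRow T A B e f) n i =
            HalfLattice.mVal (HalfLattice.tableRow T A B e f) n i - 1 ∨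
          2 * HalfLattice.mHat (HalfLattice.tableRow T A B e f) n i =
            HalfLattice.mVal (HalfLattice.tableRow T A B e f) n i - 2) := by
  have hN' : ∀ z : ℤ, (z : ℚ) = 2 * L ↔ z = N := fun z => by
    rw [hN]; exact_mod_cast Iff.rfl
  simp only [hN']
  have cast_range : ∀ {x : ℚ} {X : ℤ}, 2 * x = X → 1 ≤ x → x ≤ t → 2 ≤ X ∧ X ≤ T := by
    intro x X hX h1 h2
    have h3 : (2 : ℚ) ≤ X := by linarith
    have h4 : (X : ℚ) ≤ T := by linarith
    exact ⟨by exact_mod_cast h3, by exact_mod_cast h4⟩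
  obtain ⟨hA2, hAT⟩ := cast_range hA ha1 hat
  obtain ⟨hB2, hBT⟩ := cast_range hB hb1 hbt
  have he := HalfLattice.endAllowed_of_allowed (T := T) hT hA hA2 hAT hae
  have hf := HalfLattice.endAllowed_of_allowed (T := T) hT hB hB2 hBT hbf
  -- The excluded value of `a` is the floor or the ceiling, so the strip has at least two heights.
  have hT3 : 3 ≤ T := by
    unfold HalfLattice.EndAllowed at he
    split_ifs at he <;> omega
  obtain ⟨r, rfl⟩ : ∃ r, T = r + 3 := ⟨T - 3, by omega⟩
  refine ⟨?_, ?_, fun n => ⟨HalfLattice.mVal_top (by omega) hA2 hAT hB2 hBT e f n,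
    fun i _ _ => HalfLattice.mHat_parity A B e f n i⟩⟩
  · refine (HalfLattice.finite_tailLength_eq (r + 1)
      (N + (HalfLattice.tableRow (r + 3 : ℕ) A B e f).Delta 0)).subset fun n hn => ?_
    have h1 : HalfLattice.tailLength (k := r + 1) n 0 -
      (HalfLattice.tableRow (r + 3 : ℕ) A B e f).Delta 0 = N := hn
    change HalfLattice.tailLength (k := r + 1) n 0 = _
    omega
  · have hc : ((r + 3 : ℕ) : ℤ) = r + 3 := by push_cast; ring
    have hc' : ((r + 1 : ℕ) : ℤ) + 2 = r + 3 := by push_cast; ring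
    rw [hc] at hAT hBT he hf ⊢
    have hdesc := HalfLattice.describes_tableRow (T := (r : ℤ) + 3) (A := A) (B := B) e f
    rw [hdesc.finsum_eq (by fin_cases e <;> fin_cases f <;> simp) hA2 hAT hB2 hBT N]
    have hpath := HalfLattice.pathGF_eq_finsum (k := r + 1) (t := t) (by rw [hc', hT, ← hc]; norm_cast)
      hA hB hA2 (by rw [hc']; exact hAT) hB2 (by rw [hc']; exact hBT) e f (by rw [hc']; exact he)
      (by rw [hc']; exact hf) N
    rw [hc'] at hpath
    exact hpath
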